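/- **Theorem 1.** Let $(M,g)$ be a compact smooth Riemannian manifold (without boundary) of dimension $n$, let $(\bar M,\bar g)$ be a smooth Riemannian manifold of dimension $m$, and let $f:M\to\bar M$ be a smooth map with differential $f_*$. Let $g^*=f^*\bar g$ be the pullback metric, $e(f)=\operatorname{trace}_g g^*$ the energy density, $E_U(f)=\frac12\int_U e(f)\,dv_g$ the energy of $f$ on an open set $U\subseteq M$, and $\tau(f)=\operatorname{trace}_g(Df_*)$ the tension field, where $(Df_*)(X,Y)=\bar\nabla'_X f_*Y-f_*\nabla_XY$ with $\nabla$ the Levi-Civita connection of $g$ and $\bar\nabla'$ the connection on $f^*T\bar M$ induced by the Levi-Civita connection of $\bar g$. For a symmetric 2-tensor field $\varphi$ on $M$ let $(\delta\varphi)(Y)=-\sum_{i=1}^n(\nabla_{X_i}\varphi)(X_i,Y)$, where $X_1,\dots,X_n$ is a local $g$-orthonormal frame. The map $f$ is called harmonic if for every relatively compact open $U\subseteq M$ and every smooth variation $(f_t)_{|t|<\varepsilon}$ of $f_0=f$ with compact support in $U$ one has $\frac{d}{dt}\big|_{t=0}E_U(f_t)=0$. 1. For every $x\in M$ and $Y\in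 T_xM$, $$(\delta g^*)(Y)+\tfrac12\,de(f)(Y)=-\bar g\big(\tau(f),f_*Y\big).$$ 2. If $f$ is harmonic, then $\delta g^*=-\frac12\,d e(f)$. 3. Conversely, if $\delta g^*=-\frac12\,d e(f)$ and either $n=m$ and $f$ is a diffeomorphism, or $n\ge m$ and $f$ is a submersion, then $f$ is harmonic. -/

import Mathlib

open Bundle Set MeasureTheory
open scoped Manifold ContDiff Topology

noncomputable section

namespace HarmonicMap

/-- Smooth Riemannian metrics on a smooth `n`-manifold `M` without boundary. -/
abbrev Metric (n : ℕ) (M : Type*) [TopologicalSpace M] [ChartedSpace (EuclideanSpace ℝ (Fin n)) M]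
    [IsManifold (𝓡 n) ∞ M] :=
  ContMDiffRiemannianMetric (𝓡 n) ∞ (EuclideanSpace ℝ (Fin n))
    (fun x : M => TangentSpace (𝓡 n) x)

/-- Fields of bilinear forms on the tangent spaces of `M` (covariant 2-tensor fields). -/
abbrev Tensor2 (n : ℕ) (M : Type*) [TopologicalSpace M]
    [ChartedSpace (EuclideanSpace ℝ (Fin n)) M] :=
  (x : M) → LinearMap.BilinForm ℝ (TangentSpace (𝓡 n) x)

section Coordinates

variable {n : ℕ} {M : Type*} [TopologicalSpace M] [ChartedSpace (EuclideanSpace ℝ (Fin n)) M]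

/-- The partial derivative `∂F/∂yⁱ` of a real function on `ℝⁿ`. -/
def pd (i : Fin n) (F : EuclideanSpace ℝ (Fin n) → ℝ) (y : EuclideanSpace ℝ (Fin n)) : ℝ :=
  fderiv ℝ F y (EuclideanSpace.single i 1)

/-- The coordinate vector field `∂ᵢ` of the chart at `p`, at the point with coordinates `y`. -/
def coordVec (p : M) (i : Fin n) (y : EuclideanSpace ℝ (Fin n)) :
    TangentSpace (𝓡 n) ((extChartAt (𝓡 n) p).symm y) :=
  mfderiv 𝓘(ℝ, EuclideanSpace ℝ (Fin n)) (𝓡 n) (extChartAt (𝓡 n) p).symm y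
    (EuclideanSpace.single i (1 : ℝ) : EuclideanSpace ℝ (Fin n))

/-- The component `Yʲ` of a tangent vector `Y` at `x` in the chart at `x`, so that
`Y = ∑ⱼ Yʲ ∂ⱼ`. -/
def component (x : M) (Y : TangentSpace (𝓡 n) x) (j : Fin n) : ℝ :=
  (show EuclideanSpace ℝ (Fin n) from
    mfderiv (𝓡 n) 𝓘(ℝ, EuclideanSpace ℝ (Fin n)) (extChartAt (𝓡 n) x) x Y) j

/-- The matrix `φᵢⱼ = φ(∂ᵢ, ∂ⱼ)` of a 2-tensor field in the chart at `p`, as a function of the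
coordinates `y`. -/
def coeff (φ : Tensor2 n M) (p : M) (y : EuclideanSpace ℝ (Fin n)) : Matrix (Fin n) (Fin n) ℝ :=
  Matrix.of fun i j => φ ((extChartAt (𝓡 n) p).symm y) (coordVec p i y) (coordVec p j y)

variable [IsManifold (𝓡 n) ∞ M]

/-- The metric `g` as a 2-tensor field. -/
def metricTensor (g : Metric n M) : Tensor2 n M := fun x =>
  LinearMap.mk₂ ℝ (fun v w => g.inner x v w) (by simp) (by simp) (by simp) (by simp)

/-- The inverse matrix `gⁱʲ` of the metric in the chart at `p`. -/
def invCoeff (g : Metric n M) (p : M) (y : EuclideanSpace ℝ (Fin n)) : Matrix (Fin n) (Fin n) ℝ :=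
  (coeff (metricTensor g) p y)⁻¹

/-- The Christoffel symbols of the Levi-Civita connection of `g` in the chart at `p`:
`Γᵏᵢⱼ = ½ ∑ₗ gᵏˡ (∂ᵢ gⱼₗ + ∂ⱼ gᵢₗ - ∂ₗ gᵢⱼ)`, that is, `∇_{∂ᵢ} ∂ⱼ = ∑ₖ Γᵏᵢⱼ ∂ₖ`. -/
def christoffel (g : Metric n M) (p : M) (k i j : Fin n) (y : EuclideanSpace ℝ (Fin n)) : ℝ :=
  (1 / 2) * ∑ l, invCoeff g p y k l *
    (pd i (fun z => coeff (metricTensor g) p z j l) y + pd j (fun z => coeff (metricTensor g) p z i l) y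
      - pd l (fun z => coeff (metricTensor g) p z i j) y)

/-- The components `(∇_{∂ₖ} φ)(∂ᵢ, ∂ⱼ)` of the covariant derivative of a 2-tensor field with respect
to the Levi-Civita connection of `g`, in the chart at `p`. -/
def covDeriv (g : Metric n M) (φ : Tensor2 n M) (p : M) (k i j : Fin n)
    (y : EuclideanSpace ℝ (Fin n)) : ℝ :=
  pd k (fun z => coeff φ p z i j) y
    - ∑ l, christoffel g p l k i y * coeff φ p y l j
    - ∑ l, christoffel g p l k j y * coeff φ p y i l

/-- The divergence `δφ` of a symmetric 2-tensor field, a 1-form: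
`(δφ)(Y) = - trace_g ((X, X') ↦ (∇_X φ)(X', Y))`, computed at `x` in the chart at `x`. -/
def divergence (g : Metric n M) (φ : Tensor2 n M) (x : M) (Y : TangentSpace (𝓡 n) x) : ℝ :=
  -∑ j, (∑ k, ∑ i, invCoeff g x (extChartAt (𝓡 n) x x) k i *
    covDeriv g φ x k i j (extChartAt (𝓡 n) x x)) * component x Y j

/-- The function `trace_g φ = ∑ᵢⱼ gⁱʲ φᵢⱼ`, computed at `x` in the chart at `x`. -/
def traceMetric (g : Metric n M) (φ : Tensor2 n M) (x : M) : ℝ :=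
  ∑ i, ∑ j, invCoeff g x (extChartAt (𝓡 n) x x) i j * coeff φ x (extChartAt (𝓡 n) x x) i j

/-- The measure `√(det gᵢⱼ) dy¹ ⋯ dyⁿ` on the domain of the chart at `p`, extended by zero
to `M`. -/
def chartVolume [MeasurableSpace M] (g : Metric n M) (p : M) : Measure M :=
  (((volume : Measure (EuclideanSpace ℝ (Fin n))).restrict (extChartAt (𝓡 n) p).target).withDensity
    (fun y => ENNReal.ofReal (Real.sqrt (coeff (metricTensor g) p y).det))).map (extChartAt (𝓡 n) p).symm

/-- The Riemannian volume measure `dv_g`: the least measure that dominates the measures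
`√(det gᵢⱼ) dy¹ ⋯ dyⁿ` of all the charts. Since those agree on overlaps of chart domains, this is the
measure that is given by `√(det gᵢⱼ) dy¹ ⋯ dyⁿ` on each chart domain. -/
def riemannianVolume [MeasurableSpace M] (g : Metric n M) : Measure M :=
  ⨆ p : M, chartVolume g p

end Coordinates

section Maps

variable {n m : ℕ}
  {M : Type*} [TopologicalSpace M] [ChartedSpace (EuclideanSpace ℝ (Fin n)) M]
  {N : Type*} [TopologicalSpace N] [ChartedSpace (EuclideanSpace ℝ (Fin m)) N]
  [IsManifold (𝓡 m) ∞ N]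

/-- The pullback metric (first fundamental form) `g* = f*h`. -/
def pullbackMetric (h : Metric m N) (f : M → N) : Tensor2 n M := fun x =>
  LinearMap.mk₂ ℝ
    (fun v w => h.inner (f x) (mfderiv (𝓡 n) (𝓡 m) f x v) (mfderiv (𝓡 n) (𝓡 m) f x w))
    (by simp) (by simp) (by simp) (by simp)

variable [IsManifold (𝓡 n) ∞ M]

/-- The energy density `e(f) = trace_g (f*h)`. -/
def energyDensity (g : Metric n M) (h : Metric m N) (f : M → N) (x : M) : ℝ :=
  traceMetric g (pullbackMetric h f) x

/-- The energy `E_U(f) = ½ ∫_U e(f) dv_g`. -/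
def energy [MeasurableSpace M] (g : Metric n M) (h : Metric m N) (U : Set M) (f : M → N) : ℝ :=
  (1 / 2) * ∫ x in U, energyDensity g h f x ∂(riemannianVolume g)

/-- `F` is a smooth variation `(fₜ)`, `-ε < t < ε`, of `f` with compact support in `U`. -/
structure IsVariation (n m : ℕ)
    {M : Type*} [TopologicalSpace M] [ChartedSpace (EuclideanSpace ℝ (Fin n)) M]
    {N : Type*} [TopologicalSpace N] [ChartedSpace (EuclideanSpace ℝ (Fin m)) N]
    (f : M → N) (U : Set M) (ε : ℝ) (F : ℝ → M → N) : Prop where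
  smooth : ContMDiffOn (𝓘(ℝ, ℝ).prod (𝓡 n)) (𝓡 m) ∞ (fun q : ℝ × M => F q.1 q.2)
    (Ioo (-ε) ε ×ˢ univ)
  initial : F 0 = f
  support : ∃ K : Set M, IsCompact K ∧ K ⊆ U ∧ ∀ t ∈ Ioo (-ε) ε, ∀ x ∉ K, F t x = f x

/-- A smooth map `f : (M, g) → (N, h)` is harmonic if, for every relatively compact open `U ⊆ M`, it
is a critical point of the energy `E_U` with respect to all smooth variations of `f` with compact
support in `U`. -/
def IsHarmonic [MeasurableSpace M] (g : Metric n M) (h : Metric m N) (f : M → N) : Prop :=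
  ContMDiff (𝓡 n) (𝓡 m) ∞ f ∧
  ∀ U : Set M, IsOpen U → IsCompact (closure U) → ∀ ε : ℝ, 0 < ε → ∀ F : ℝ → M → N,
    IsVariation n m f U ε F → HasDerivAt (fun t => energy g h U (F t)) 0 0

/-- The components `(Df_*)ᵅᵢⱼ = ∂ᵢ∂ⱼfᵅ - ∑ₖ Γᵏᵢⱼ ∂ₖfᵅ + ∑ Γ̄ᵅᵦᵧ(f) ∂ᵢfᵝ ∂ⱼfᵞ` at `x` of the second
fundamental form `(Df_*)(X, Y) = ∇̄_X (f_* Y) - f_* (∇_X Y)` in the charts at `x` and at `f x`. -/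
def secondFundamentalForm (g : Metric n M) (h : Metric m N) (f : M → N) (x : M)
    (a : Fin m) (i j : Fin n) : ℝ :=
  let y := extChartAt (𝓡 n) x x
  let fc : Fin m → EuclideanSpace ℝ (Fin n) → ℝ := fun b z =>
    writtenInExtChartAt (𝓡 n) (𝓡 m) x f z b
  pd i (pd j (fc a)) y - ∑ k, christoffel g x k i j y * pd k (fc a) y
    + ∑ b, ∑ c, christoffel h (f x) a b c (extChartAt (𝓡 m) (f x) (f x)) *
        pd i (fc b) y * pd j (fc c) y

/-- The tension field `τ(f) = trace_g (Df_*)`, a vector field along `f`. -/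
def tension (g : Metric n M) (h : Metric m N) (f : M → N) (x : M) : TangentSpace (𝓡 m) (f x) :=
  ∑ a, (∑ i, ∑ j, invCoeff g x (extChartAt (𝓡 n) x x) i j * secondFundamentalForm g h f x a i j) •
    (show TangentSpace (𝓡 m) (f x) from coordVec (f x) a (extChartAt (𝓡 m) (f x) (f x)))

/-- The identity `δ(f*h) = -½ d e(f)` of 1-forms on `M`. -/
def DivergenceIdentity (g : Metric n M) (h : Metric m N) (f : M → N) : Prop :=
  ∀ (x : M) (Y : TangentSpace (𝓡 n) x),
    divergence g (pullbackMetric h f) x Y = -(1 / 2) * mvfderiv (𝓡 n) (energyDensity g h f) x Y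

end Maps

end HarmonicMap

end

noncomputable section

namespace HarmonicMap

-- Everything is computed in charts. Let `uᵃ` be the coordinates of `f` and `H` the matrix of `h`,
-- so that the pullback metric has components `H_ab ∂ᵢuᵃ ∂ⱼuᵇ`.
--
-- The pointwise identity comes from expanding both sides in the chart at `x`, with `j` the free
-- index. In `δ(f*h)` the second-derivative terms `∂ₖ∂ⱼu` cancel against those of `½ de(f)`, because
-- second derivatives and `gᵏⁱ` are symmetric. The Christoffel terms `Γˡₖⱼ` cancel against half the
-- derivative of the inverse metric, which is compatibility of the connection with `g`. What
-- survives is `-h(τ, f_* ∂ⱼ)`, with `τ` lowered by `h` so that the inverse of `H` disappears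
-- (`divergence_algebra`, `sum_mul_tension`).
--
-- The other two claims rest on the first variation formula `dE/dt = -∫ h(τ, V) dv_g`, where `V` is
-- the variation field. By `volDensity_mul_energyVariation`, `√det g` times half the derivative of
-- the energy density is a coordinate divergence minus `√det g · h(τ, V)`, and the divergence
-- integrates to zero when `V` is supported in one chart domain. To localize, a family `F` is
-- replaced by `F (t ρ(x)) x` (`rescale`), whose variation field is `ρ V`. No exponential map is
-- needed, and a partition of unity reassembles the pieces because the derivative of the energy
-- density is linear in `V`.
--
-- If `f` is harmonic, take a family with prescribed velocity at `x` and let `ρ` range over all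
-- cutoffs: every lowered component of `τ` vanishes at `x`, and the identity gives `δ(f*h) = -½
-- de(f)`. Conversely, this equation makes `τ` orthogonal to the image of `f_*`. That image is the
-- whole tangent space for a diffeomorphism or a submersion, so `τ = 0`, and the first variation
-- formula makes `f` harmonic.

local notation "𝔼" k => EuclideanSpace ℝ (Fin k)

/-! ### Index algebra behind the divergence identity -/

section Algebra

variable {n m : ℕ}

/-- Lowering the index of the tension field. -/
theorem sum_mul_tension (Gi : Fin n → Fin n → ℝ) (Γ : Fin n → Fin n → Fin n → ℝ)
    (H Hi : Fin m → Fin m → ℝ) (dH : Fin m → Fin m → Fin m → ℝ)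
    (u1 : Fin n → Fin m → ℝ) (u2 : Fin n → Fin n → Fin m → ℝ)
    (hGi : ∀ i j, Gi i j = Gi j i) (hH : ∀ a b, H a b = H b a) 
    (hHi : ∀ a l, ∑ b, H a b * Hi b l = if a = l then 1 else 0) (d : Fin m) :
    ∑ a, H a d * (∑ i, ∑ j, Gi i j * (u2 i j a - ∑ k, Γ k i j * u1 k a
      + ∑ b, ∑ c, (1 / 2 * ∑ l, Hi a l * (dH b c l + dH c b l - dH l b c)) * u1 i b * u1 j c)) =
    ∑ i, ∑ j, Gi i j * (∑ a, H a d * u2 i j a - ∑ k, Γ k i j * ∑ a, H a d * u1 k a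
      + ∑ b, ∑ c, (dH b c d - 1 / 2 * dH d b c) * u1 i b * u1 j c) := by
  -- Lowering with `H` undoes the raising by its inverse `Hi` inside the Christoffel symbols of the
  -- target.
  have key : ∀ c : Fin m → ℝ, ∑ a, H a d * (1 / 2 * ∑ l, Hi a l * c l) = 1 / 2 * c d := by
    intro c
    have h1 : c d = ∑ l, (∑ a, H d a * Hi a l) * c l := by simp [hHi]
    conv_rhs => rw [h1]
    simp only [Finset.mul_sum, Finset.sum_mul]
    rw [Finset.sum_comm]
    refine Finset.sum_congr rfl fun l _ => Finset.sum_congr rfl fun a _ => ?_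
    rw [hH a d]; ring
  have step : ∀ i j, ∑ a, H a d * (u2 i j a - ∑ k, Γ k i j * u1 k a
      + ∑ b, ∑ c, (1 / 2 * ∑ l, Hi a l * (dH b c l + dH c b l - dH l b c)) * u1 i b * u1 j c) =
      ∑ a, H a d * u2 i j a - ∑ k, Γ k i j * ∑ a, H a d * u1 k a
      + ∑ b, ∑ c, (1 / 2 * (dH b c d + dH c b d - dH d b c)) * u1 i b * u1 j c := by
    intro i j
    have e : ∀ x y z : Fin m → ℝ, ∑ a, H a d * (x a - y a + z a) =
        ∑ a, H a d * x a - ∑ a, H a d * y a + ∑ a, H a d * z a := by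
      intro x y z
      simp only [mul_add, mul_sub, Finset.sum_add_distrib, Finset.sum_sub_distrib]
    rw [e]
    congr 1
    · congr 1
      simp only [Finset.mul_sum]
      rw [Finset.sum_comm]
      refine Finset.sum_congr rfl fun k _ => Finset.sum_congr rfl fun a _ => by ring
    · have key' : ∀ b c, 1 / 2 * (dH b c d + dH c b d - dH d b c) =
          ∑ a, H a d * (1 / 2 * ∑ l, Hi a l * (dH b c l + dH c b l - dH l b c)) :=
        fun b c => (key fun l => dH b c l + dH c b l - dH l b c).symm
      simp only [key']
      simp only [Finset.mul_sum, Finset.sum_mul]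
      rw [Finset.sum_comm]
      refine Finset.sum_congr rfl fun b _ => ?_
      rw [Finset.sum_comm]
      refine Finset.sum_congr rfl fun c _ => Finset.sum_congr rfl fun a _ =>
        Finset.sum_congr rfl fun l _ => by ring
  have hl : ∑ a, H a d * (∑ i, ∑ j, Gi i j * (u2 i j a - ∑ k, Γ k i j * u1 k a
      + ∑ b, ∑ c, (1 / 2 * ∑ l, Hi a l * (dH b c l + dH c b l - dH l b c)) * u1 i b * u1 j c)) =
      ∑ i, ∑ j, Gi i j * (∑ a, H a d * (u2 i j a - ∑ k, Γ k i j * u1 k a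
      + ∑ b, ∑ c, (1 / 2 * ∑ l, Hi a l * (dH b c l + dH c b l - dH l b c))
        * u1 i b * u1 j c)) := by
    have e : ∀ (f : Fin m → Fin n → Fin n → ℝ), ∑ a, H a d * ∑ i, ∑ j, Gi i j * f a i j =
        ∑ i, ∑ j, Gi i j * ∑ a, H a d * f a i j := by
      intro f
      simp only [Finset.mul_sum]
      rw [Finset.sum_comm]
      refine Finset.sum_congr rfl fun i _ => ?_
      rw [Finset.sum_comm]
      refine Finset.sum_congr rfl fun j _ => Finset.sum_congr rfl fun a _ => by ring
    exact e fun a i j => u2 i j a - ∑ k, Γ k i j * u1 k a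
      + ∑ b, ∑ c, (1 / 2 * ∑ l, Hi a l * (dH b c l + dH c b l - dH l b c)) * u1 i b * u1 j c
  -- Exchanging `i` with `j` and `b` with `c` is harmless because `Gi` is symmetric. Thus the two
  -- first derivatives of `H` that are symmetric partners contribute equally, which turns `½(dH b c
  -- d + dH c b d)` into `dH b c d`.
  have hsw : ∑ i, ∑ j, Gi i j * ∑ b, ∑ c, dH c b d * u1 i b * u1 j c =
      ∑ i, ∑ j, Gi i j * ∑ b, ∑ c, dH b c d * u1 i b * u1 j c := by
    rw [Finset.sum_comm]
    refine Finset.sum_congr rfl fun i _ => Finset.sum_congr rfl fun j _ => ?_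
    rw [hGi j i, Finset.sum_comm]
    congr 1
    refine Finset.sum_congr rfl fun b _ => Finset.sum_congr rfl fun c _ => by ring
  rw [hl]
  simp only [step]
  have e1 : ∀ i j, ∑ b, ∑ c, (1 / 2 * (dH b c d + dH c b d - dH d b c)) * u1 i b * u1 j c =
      ∑ b, ∑ c, (dH b c d - 1 / 2 * dH d b c) * u1 i b * u1 j c
      + (1 / 2 * (∑ b, ∑ c, dH c b d * u1 i b * u1 j c)
        - 1 / 2 * ∑ b, ∑ c, dH b c d * u1 i b * u1 j c) := by
    intro i j
    simp only [Finset.mul_sum, ← Finset.sum_add_distrib, ← Finset.sum_sub_distrib]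
    refine Finset.sum_congr rfl fun b _ => Finset.sum_congr rfl fun c _ => by ring
  simp only [e1]
  have e2 : ∀ i j, Gi i j * (∑ a, H a d * u2 i j a - ∑ k, Γ k i j * ∑ a, H a d * u1 k a
      + (∑ b, ∑ c, (dH b c d - 1 / 2 * dH d b c) * u1 i b * u1 j c
      + (1 / 2 * (∑ b, ∑ c, dH c b d * u1 i b * u1 j c)
        - 1 / 2 * ∑ b, ∑ c, dH b c d * u1 i b * u1 j c))) =
      Gi i j * (∑ a, H a d * u2 i j a - ∑ k, Γ k i j * ∑ a, H a d * u1 k a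
      + ∑ b, ∑ c, (dH b c d - 1 / 2 * dH d b c) * u1 i b * u1 j c)
      + (1 / 2 * (Gi i j * ∑ b, ∑ c, dH c b d * u1 i b * u1 j c)
        - 1 / 2 * (Gi i j * ∑ b, ∑ c, dH b c d * u1 i b * u1 j c)) := by
    intro i j; ring
  simp only [e2]
  simp only [Finset.sum_add_distrib, Finset.sum_sub_distrib]
  simp only [← Finset.mul_sum (a := (1 / 2 : ℝ))]
  rw [hsw]; ring

/-- Compatibility of the Levi-Civita connection with the inverse metric, contracted. -/
theorem sum_christoffel_contract (Gi : Fin n → Fin n → ℝ) (dG : Fin n → Fin n → Fin n → ℝ)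
    (P : Fin n → Fin n → ℝ) (hGi : ∀ i j, Gi i j = Gi j i)
    (hdG : ∀ k i j, dG k i j = dG k j i) (hP : ∀ i j, P i j = P j i) (j : Fin n) :
    ∑ k, ∑ i, Gi k i * ∑ l, (1 / 2 * ∑ r, Gi l r * (dG k j r + dG j k r - dG r k j)) * P i l =
    -(1 / 2) * ∑ k, ∑ i, (-∑ r, ∑ s, Gi k r * dG j r s * Gi s i) * P k i := by
  -- `Q` is `P` with both indices raised. Being symmetric, it annihilates the part of the
  -- Christoffel symbol that is antisymmetric in `k` and `r`, leaving only `dG j`.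
  set Q : Fin n → Fin n → ℝ := fun k r => ∑ i, ∑ l, Gi k i * P i l * Gi l r with hQ
  have hQs : ∀ k r, Q k r = Q r k := by
    intro k r
    simp only [hQ]
    rw [Finset.sum_comm]
    refine Finset.sum_congr rfl fun i _ => Finset.sum_congr rfl fun l _ => ?_
    rw [hGi k l, hGi i r, hP l i]; ring
  have h1 : ∑ k, ∑ i, Gi k i * ∑ l, (1 / 2 * ∑ r, Gi l r * (dG k j r + dG j k r - dG r k j)) * P i l
      = ∑ k, ∑ r, 1 / 2 * (Q k r * (dG k j r + dG j k r - dG r k j)) := by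
    refine Finset.sum_congr rfl fun k _ => ?_
    simp only [hQ, Finset.mul_sum, Finset.sum_mul]
    have : ∀ i, ∑ l, ∑ r, Gi k i * (1 / 2 * (Gi l r * (dG k j r + dG j k r - dG r k j)) * P i l)
      = ∑ r, ∑ l, Gi k i * (1 / 2 * (Gi l r * (dG k j r + dG j k r - dG r k j)) * P i l) :=
      fun i => Finset.sum_comm
    simp only [this]
    rw [Finset.sum_comm]
    refine Finset.sum_congr rfl fun r _ => Finset.sum_congr rfl fun i _ =>
      Finset.sum_congr rfl fun l _ => by ring
  have h2 : ∑ k, ∑ i, (-∑ r, ∑ s, Gi k r * dG j r s * Gi s i) * P k i =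
      -∑ r, ∑ s, Q r s * dG j r s := by
    simp only [hQ, Finset.sum_mul, neg_mul, Finset.sum_neg_distrib]
    congr 1
    have e : ∀ k, ∑ i, ∑ r, ∑ s, Gi k r * dG j r s * Gi s i * P k i =
        ∑ r, ∑ s, ∑ i, Gi k r * dG j r s * Gi s i * P k i := by
      intro k
      rw [Finset.sum_comm]
      exact Finset.sum_congr rfl fun r _ => Finset.sum_comm
    simp only [e]
    rw [Finset.sum_comm]
    refine Finset.sum_congr rfl fun r _ => ?_
    rw [Finset.sum_comm]
    refine Finset.sum_congr rfl fun s _ => Finset.sum_congr rfl fun i _ =>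
      Finset.sum_congr rfl fun l _ => ?_
    rw [hGi i r, hGi s l]; ring
  have h3 : ∑ k, ∑ r, Q k r * dG k j r = ∑ k, ∑ r, Q k r * dG r k j := by
    rw [Finset.sum_comm]
    refine Finset.sum_congr rfl fun r _ => Finset.sum_congr rfl fun k _ => ?_
    rw [hQs k r, hdG k j r]
  rw [h1, h2]
  simp only [mul_add, mul_sub, Finset.sum_add_distrib, Finset.sum_sub_distrib,
    ← Finset.mul_sum] at *
  rw [h3]; ring

/-- The algebraic content of the identity `δ(f*h) + ½ de(f) = -h(τ(f), f_* ·)`. -/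
theorem divergence_algebra (Gi : Fin n → Fin n → ℝ) (dG : Fin n → Fin n → Fin n → ℝ)
    (H : Fin m → Fin m → ℝ) (dH : Fin m → Fin m → Fin m → ℝ)
    (u1 : Fin n → Fin m → ℝ) (u2 : Fin n → Fin n → Fin m → ℝ)
    (Γ : Fin n → Fin n → Fin n → ℝ) (dGi : Fin n → Fin n → Fin n → ℝ)
    (P : Fin n → Fin n → ℝ) (dP : Fin n → Fin n → Fin n → ℝ)
    (hGi : ∀ i j, Gi i j = Gi j i) (hdG : ∀ k i j, dG k i j = dG k j i)
    (hH : ∀ a b, H a b = H b a)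
    (hu2 : ∀ i j, u2 i j = u2 j i)
    (hΓ : ∀ l k j, Γ l k j = 1 / 2 * ∑ r, Gi l r * (dG k j r + dG j k r - dG r k j))
    (hdGi : ∀ j k i, dGi j k i = -∑ r, ∑ s, Gi k r * dG j r s * Gi s i)
    (hP : ∀ i j, P i j = ∑ a, ∑ b, H a b * u1 i a * u1 j b)
    (hdP : ∀ k i j, dP k i j = ∑ a, ∑ b, ((∑ c, dH c a b * u1 k c) * u1 i a * u1 j b
      + H a b * u2 k i a * u1 j b + H a b * u1 i a * u2 k j b)) (j : Fin n) :
    -(∑ k, ∑ i, Gi k i * (dP k i j - ∑ l, Γ l k i * P l j - ∑ l, Γ l k j * P i l))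
      + 1 / 2 * ∑ k, ∑ i, (dGi j k i * P k i + Gi k i * dP j k i) =
    -∑ d, (∑ i, ∑ k, Gi i k * (∑ a, H a d * u2 i k a - ∑ l, Γ l i k * ∑ a, H a d * u1 l a
      + ∑ b, ∑ c, (dH b c d - 1 / 2 * dH d b c) * u1 i b * u1 k c)) * u1 j d := by
  have hPs : ∀ i j, P i j = P j i := by
    intro i j
    rw [hP, hP, Finset.sum_comm]
    refine Finset.sum_congr rfl fun a _ => Finset.sum_congr rfl fun b _ => ?_
    rw [hH b a]; ring
  have hc : ∑ k, ∑ i, Gi k i * ∑ l, Γ l k j * P i l =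
      -(1 / 2) * ∑ k, ∑ i, dGi j k i * P k i := by
    simp only [hΓ, hdGi]
    exact sum_christoffel_contract Gi dG P hGi hdG hPs j
  -- The derivative of the pullback splits into `T`, where the target metric is differentiated, and
  -- two copies of `S`, where a first derivative of the map is differentiated.
  set T : Fin n → Fin n → Fin n → ℝ := fun k i l => ∑ a, ∑ b, (∑ c, dH c a b * u1 k c) * u1 i a * u1 l b
  set S : Fin n → Fin n → Fin n → ℝ := fun k i l => ∑ a, ∑ b, H a b * u2 k i a * u1 l b with hS
  have hdP' : ∀ k i l, dP k i l = T k i l + S k i l + S k l i := by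
    intro k i l
    rw [hdP]
    simp only [Finset.sum_add_distrib]
    congr 1
    simp only [hS]
    rw [Finset.sum_comm]
    refine Finset.sum_congr rfl fun a _ => Finset.sum_congr rfl fun b _ => ?_
    rw [hH b a]; ring
  have hSs : ∀ k i l, S k i l = S i k l := by
    intro k i l; simp only [hS]; rw [hu2 k i]
  -- After the trace, `S k j i`, `S j k i` and `S j i k` all agree, so the copy of `S` with `j`
  -- differentiated in `dP k i j` cancels against the two halves from the energy density.
  have hsw : ∑ k, ∑ i, Gi k i * S k j i = ∑ k, ∑ i, Gi k i * S j i k := by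
    rw [Finset.sum_comm]
    refine Finset.sum_congr rfl fun a _ => Finset.sum_congr rfl fun b _ => ?_
    rw [hGi b a, hSs]
  have hsw2 : ∑ k, ∑ i, Gi k i * S j k i = ∑ k, ∑ i, Gi k i * S j i k := by
    rw [Finset.sum_comm]
    refine Finset.sum_congr rfl fun a _ => Finset.sum_congr rfl fun b _ => ?_
    rw [hGi b a]
  have hr : ∑ d, (∑ i, ∑ k, Gi i k * (∑ a, H a d * u2 i k a - ∑ l, Γ l i k * ∑ a, H a d * u1 l a
      + ∑ b, ∑ c, (dH b c d - 1 / 2 * dH d b c) * u1 i b * u1 k c)) * u1 j d =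
      ∑ k, ∑ i, Gi k i * (S k i j - ∑ l, Γ l k i * P l j + (T k i j - 1 / 2 * T j k i)) := by
    simp only [Finset.sum_mul (s := Finset.univ (α := Fin n))]
    rw [Finset.sum_comm]
    refine Finset.sum_congr rfl fun k _ => ?_
    rw [Finset.sum_comm]
    refine Finset.sum_congr rfl fun i _ => ?_
    simp only [mul_assoc (Gi k i)]
    rw [← Finset.mul_sum]
    congr 1
    simp only [add_mul, sub_mul, Finset.sum_add_distrib, Finset.sum_sub_distrib]
    congr 1
    · congr 1
      · simp only [hS, Finset.sum_mul]
        exact Finset.sum_comm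
      · simp only [hP, Finset.sum_mul, Finset.mul_sum]
        rw [Finset.sum_comm]
        refine Finset.sum_congr rfl fun l _ => ?_
        rw [Finset.sum_comm]
        refine Finset.sum_congr rfl fun a _ => Finset.sum_congr rfl fun b _ => ?_
        ring
    · congr 1
      · simp only [T, Finset.sum_mul]
        rw [Finset.sum_congr rfl fun d _ => Finset.sum_comm, Finset.sum_comm]
      · simp only [T, Finset.sum_mul, Finset.mul_sum]
        rw [Finset.sum_comm]
        refine Finset.sum_congr rfl fun a _ => ?_
        rw [Finset.sum_comm]
        refine Finset.sum_congr rfl fun b _ => Finset.sum_congr rfl fun c _ => ?_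
        ring
  rw [hr]
  simp only [hdP', mul_add, mul_sub, Finset.sum_add_distrib, Finset.sum_sub_distrib] at *
  rw [hc, hsw, hsw2]
  have : ∀ k i, Gi k i * (1 / 2 * T j k i) = 1 / 2 * (Gi k i * T j k i) := fun k i => by ring
  simp only [this, ← Finset.mul_sum]
  ring

end Algebra

/-! ### Derivatives of determinants and inverse matrices -/

section MatrixCalculus

variable {E : Type*} [NormedAddCommGroup E] [NormedSpace ℝ E] {r : ℕ∞ω}

theorem contDiffAt_det {k : ℕ} {A : E → Matrix (Fin k) (Fin k) ℝ} {y : E}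
    (hA : ∀ i j, ContDiffAt ℝ r (fun z => A z i j) y) : ContDiffAt ℝ r (fun z => (A z).det) y := by
  simp only [Matrix.det_apply']
  exact ContDiffAt.sum fun σ _ => contDiffAt_const.mul (contDiffAt_prod fun i _ => hA _ _)

theorem contDiffAt_inv_apply {k : ℕ} {A : E → Matrix (Fin k) (Fin k) ℝ} {y : E}
    (hA : ∀ i j, ContDiffAt ℝ r (fun z => A z i j) y) (hdet : (A y).det ≠ 0) (i j : Fin k) :
    ContDiffAt ℝ r (fun z => (A z)⁻¹ i j) y := by
  simp only [Matrix.inv_def, Ring.inverse_eq_inv', Matrix.smul_apply, smul_eq_mul]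
  refine ((contDiffAt_det hA).inv hdet).mul ?_
  simp only [Matrix.adjugate_apply]
  refine contDiffAt_det fun a b => ?_
  simp only [Matrix.updateRow_apply]
  split_ifs
  · exact contDiffAt_const
  · exact hA _ _

/-- Jacobi's formula. The product rule on the Leibniz expansion gives, for each column `i`, the
determinant with that column replaced by its derivative, and Cramer's rule expresses it through the
adjugate. -/
theorem fderiv_det_apply {k : ℕ} {A : E → Matrix (Fin k) (Fin k) ℝ} {y : E}
    (hA : ∀ i j, DifferentiableAt ℝ (fun z => A z i j) y) (hdet : (A y).det ≠ 0) (v : E) :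
    fderiv ℝ (fun z => (A z).det) y v =
      (A y).det * ∑ i, ∑ j, (A y)⁻¹ i j * fderiv ℝ (fun z => A z j i) y v := by
  have h1 : HasFDerivAt (fun z => (A z).det) (∑ σ : Equiv.Perm (Fin k),
      ((Equiv.Perm.sign σ : ℤ) : ℝ) • ∑ i, (∏ j ∈ Finset.univ.erase i, A y (σ j) j) •
        fderiv ℝ (fun z => A z (σ i) i) y) y := by
    simp only [Matrix.det_apply']
    refine HasFDerivAt.fun_sum fun σ _ => HasFDerivAt.const_mul ?_ _
    exact HasFDerivAt.finsetProd fun i _ => (hA _ _).hasFDerivAt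
  rw [h1.fderiv]
  simp only [sum_apply, smul_apply, smul_eq_mul,
    Finset.mul_sum]
  rw [Finset.sum_comm]
  refine Finset.sum_congr rfl fun i _ => ?_
  set b : Fin k → ℝ := fun j => fderiv ℝ (fun z => A z j i) y v with hb
  have h2 : (A y).cramer b i = ∑ j, (A y).det * ((A y)⁻¹ i j * b j) := by
    rw [Matrix.cramer_eq_adjugate_mulVec]
    simp only [Matrix.mulVec, dotProduct, Matrix.inv_def, Ring.inverse_eq_inv',
      Matrix.smul_apply, smul_eq_mul]
    refine Finset.sum_congr rfl fun j _ => ?_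
    field_simp
  rw [← h2, Matrix.cramer_apply, Matrix.det_apply']
  refine Finset.sum_congr rfl fun σ _ => ?_
  congr 1
  rw [← Finset.mul_prod_erase Finset.univ _ (Finset.mem_univ i), mul_comm]
  congr 1
  · simp [hb]
  · refine Finset.prod_congr rfl fun j hj => ?_
    rw [Matrix.updateCol_ne (Finset.ne_of_mem_erase hj)]

/-- Differentiate `A A⁻¹ = 1`, which holds throughout a neighbourhood of `y` because the determinant
stays nonzero there, and solve for the derivative of the inverse. -/
theorem fderiv_inv_apply {k : ℕ} {A : E → Matrix (Fin k) (Fin k) ℝ} {y : E}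
    (hA : ∀ i j, ContDiffAt ℝ 1 (fun z => A z i j) y) (hdet : (A y).det ≠ 0) (v : E)
    (i j : Fin k) :
    fderiv ℝ (fun z => (A z)⁻¹ i j) y v =
      -∑ p, ∑ q, (A y)⁻¹ i p * fderiv ℝ (fun z => A z p q) y v * (A y)⁻¹ q j := by
  have hA' : ∀ i j, DifferentiableAt ℝ (fun z => A z i j) y :=
    fun i j => (hA i j).differentiableAt one_ne_zero
  have hB' : ∀ i j, DifferentiableAt ℝ (fun z => (A z)⁻¹ i j) y :=
    fun i j => (contDiffAt_inv_apply hA hdet i j).differentiableAt one_ne_zero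
  have hne : ∀ᶠ z in 𝓝 y, (A z).det ≠ 0 :=
    ((contDiffAt_det hA).continuousAt).eventually_ne hdet
  set dA : Matrix (Fin k) (Fin k) ℝ := Matrix.of fun p q => fderiv ℝ (fun z => A z p q) y v
  set dB : Matrix (Fin k) (Fin k) ℝ := Matrix.of fun p q => fderiv ℝ (fun z => (A z)⁻¹ p q) y v
  have hu : IsUnit (A y).det := isUnit_iff_ne_zero.2 hdet
  have key : dA * (A y)⁻¹ + A y * dB = 0 := by
    ext p q
    have hc : (fun z => ∑ s, A z p s * (A z)⁻¹ s q) =ᶠ[𝓝 y]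
        fun _ => (1 : Matrix (Fin k) (Fin k) ℝ) p q := by
      filter_upwards [hne] with z hz
      rw [← Matrix.mul_nonsing_inv (A z) (isUnit_iff_ne_zero.2 hz), Matrix.mul_apply]
    have h1 := hc.fderiv_eq (𝕜 := ℝ)
    rw [fderiv_fun_const, fderiv_fun_sum fun s _ => (hA' p s).fun_mul (hB' s q)] at h1
    have h2 := congrArg (fun L : E →L[ℝ] ℝ => L v) h1
    simp only [sum_apply] at h2
    simp only [Matrix.add_apply, Matrix.mul_apply, ← Finset.sum_add_distrib, Matrix.zero_apply]
    simp only [Pi.zero_apply, zero_apply] at h2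
    rw [← h2]
    refine Finset.sum_congr rfl fun s _ => ?_
    rw [fderiv_fun_mul (hA' p s) (hB' s q)]
    simp [dA, dB]; ring
  have hdB : dB = -((A y)⁻¹ * dA * (A y)⁻¹) := by
    have h3 : A y * dB = -(dA * (A y)⁻¹) := eq_neg_of_add_eq_zero_right key
    calc dB = (A y)⁻¹ * (A y * dB) := by rw [← Matrix.mul_assoc, Matrix.nonsing_inv_mul _ hu, one_mul]
      _ = _ := by rw [h3, Matrix.mul_neg, Matrix.mul_assoc]
  have h4 := congrFun (congrFun hdB i) j
  simp only [dB, Matrix.of_apply] at h4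
  rw [h4, Matrix.neg_apply, Matrix.mul_apply]
  simp only [Matrix.mul_apply, Finset.sum_mul]
  rw [Finset.sum_comm]
  rfl

end MatrixCalculus

/-! ### Calculus of coordinate derivatives -/

section PartialDerivatives

variable {n m : ℕ}

theorem fderiv_apply_eq_sum_pd (F : (𝔼 n) → ℝ) (y v : 𝔼 n) :
    fderiv ℝ F y v = ∑ i, pd i F y * v i := by
  conv_lhs => rw [← (EuclideanSpace.basisFun (Fin n) ℝ).sum_repr v]
  simp [pd, mul_comm]

theorem pd_congr {F F' : (𝔼 n) → ℝ} {y : 𝔼 n} (h : F =ᶠ[𝓝 y] F') (i : Fin n) :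
    pd i F y = pd i F' y := by
  simp only [pd, h.fderiv_eq]

theorem pd_mul {F F' : (𝔼 n) → ℝ} {y : 𝔼 n} (i : Fin n) (h : DifferentiableAt ℝ F y)
    (h' : DifferentiableAt ℝ F' y) :
    pd i (fun z => F z * F' z) y = pd i F y * F' y + F y * pd i F' y := by
  simp only [pd]
  rw [fderiv_fun_mul h h']
  simp; ring

theorem pd_sum {ι : Type*} (s : Finset ι) {F : ι → (𝔼 n) → ℝ} {y : 𝔼 n} (i : Fin n)
    (h : ∀ k ∈ s, DifferentiableAt ℝ (F k) y) :
    pd i (fun z => ∑ k ∈ s, F k z) y = ∑ k ∈ s, pd i (F k) y := by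
  simp only [pd]
  rw [fderiv_fun_sum h]
  simp

theorem pd_comp {φ : (𝔼 m) → ℝ} {u : (𝔼 n) → 𝔼 m} {y : 𝔼 n} (i : Fin n)
    (hφ : DifferentiableAt ℝ φ (u y)) (hu : DifferentiableAt ℝ u y) :
    pd i (fun z => φ (u z)) y = ∑ c, pd c φ (u y) * pd i (fun z => u z c) y := by
  have h1 : fderiv ℝ (fun z => φ (u z)) y = (fderiv ℝ φ (u y)).comp (fderiv ℝ u y) :=
    fderiv_comp y hφ hu
  simp only [pd] at *
  rw [h1, ContinuousLinearMap.comp_apply, fderiv_apply_eq_sum_pd]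
  refine Finset.sum_congr rfl fun c _ => ?_
  congr 1
  have h2 : HasFDerivAt (fun z => u z c)
      ((EuclideanSpace.proj c : (𝔼 m) →L[ℝ] ℝ).comp (fderiv ℝ u y)) y :=
    (EuclideanSpace.proj c : (𝔼 m) →L[ℝ] ℝ).hasFDerivAt.comp y hu.hasFDerivAt
  rw [h2.fderiv]; rfl

theorem contDiffAt_coord {E : Type*} [NormedAddCommGroup E] [NormedSpace ℝ E] {r : ℕ∞ω}
    {u : E → 𝔼 m} {y : E} (hu : ContDiffAt ℝ r u y) (a : Fin m) :
    ContDiffAt ℝ r (fun z => u z a) y :=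
  contDiffAt_euclidean.1 hu a

theorem contDiffAt_pd {F : (𝔼 n) → ℝ} {y : 𝔼 n} (hF : ContDiffAt ℝ ∞ F y) (i : Fin n) :
    ContDiffAt ℝ ∞ (pd i F) y :=
  (hF.fderiv_right (m := ∞) (by simp)).clm_apply contDiffAt_const

theorem pd_comm {F : (𝔼 n) → ℝ} {y : 𝔼 n} (hF : ContDiffAt ℝ ∞ F y) (i j : Fin n) :
    pd i (pd j F) y = pd j (pd i F) y := by
  have hd : DifferentiableAt ℝ (fderiv ℝ F) y :=
    (hF.fderiv_right (m := ∞) (by simp)).differentiableAt (by simp)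
  have h : ∀ i j : Fin n, pd i (pd j F) y =
      fderiv ℝ (fderiv ℝ F) y (EuclideanSpace.single i 1) (EuclideanSpace.single j 1) := by
    intro i j
    have : fderiv ℝ (pd j F) y = (fderiv ℝ (fun z => fderiv ℝ F z (EuclideanSpace.single j 1)) y) :=
      rfl
    rw [pd, this, fderiv_clm_apply hd (differentiableAt_const _)]
    simp
  rw [h, h]
  exact (hF.isSymmSndFDerivAt (by simpa using WithTop.coe_le_coe.2 (le_top : (2 : ℕ∞) ≤ ⊤))).eq _ _

end PartialDerivatives

/-! ### Tensors in coordinates and their change under charts -/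

section Charts

set_option linter.unusedSectionVars false

variable {n m : ℕ} {M : Type*} [TopologicalSpace M] [ChartedSpace (EuclideanSpace ℝ (Fin n)) M]
  [IsManifold (𝓡 n) ∞ M]
  {N : Type*} [TopologicalSpace N] [ChartedSpace (EuclideanSpace ℝ (Fin m)) N]
  [IsManifold (𝓡 m) ∞ N]

theorem contMDiffAt_chart_symm (p : M) {y : 𝔼 n} (hy : y ∈ (extChartAt (𝓡 n) p).target) :
    ContMDiffAt 𝓘(ℝ, 𝔼 n) (𝓡 n) ∞ (extChartAt (𝓡 n) p).symm y :=
  (contMDiffOn_extChartAt_symm p).contMDiffAt ((isOpen_extChartAt_target p).mem_nhds hy)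

theorem contMDiffAt_chart (p : M) {x : M} (hx : x ∈ (extChartAt (𝓡 n) p).source) :
    ContMDiffAt (𝓡 n) 𝓘(ℝ, 𝔼 n) ∞ (extChartAt (𝓡 n) p) x :=
  contMDiffAt_extChartAt' (by rwa [extChartAt_source] at hx)

/-- The expression of a map in the charts at `p` and `q`. -/
def localRep (p : M) (q : N) (f : M → N) (y : 𝔼 n) : 𝔼 m :=
  extChartAt (𝓡 m) q (f ((extChartAt (𝓡 n) p).symm y))

theorem contDiffAt_localRep {p : M} {q : N} {f : M → N} {y : 𝔼 n}
    (hy : y ∈ (extChartAt (𝓡 n) p).target)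
    (hf : ContMDiffAt (𝓡 n) (𝓡 m) ∞ f ((extChartAt (𝓡 n) p).symm y))
    (hq : f ((extChartAt (𝓡 n) p).symm y) ∈ (extChartAt (𝓡 m) q).source) :
    ContDiffAt ℝ ∞ (localRep p q f : (𝔼 n) → 𝔼 m) y := by
  rw [← contMDiffAt_iff_contDiffAt]
  exact (contMDiffAt_chart q hq).comp y (hf.comp y (contMDiffAt_chart_symm p hy))

theorem fderiv_apply_single_eq_sum {u : (𝔼 n) → 𝔼 m} {y : 𝔼 n} (hu : DifferentiableAt ℝ u y)
    (i : Fin n) :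
    fderiv ℝ u y (EuclideanSpace.single i 1) =
      ∑ a, pd i (fun z => u z a) y • (EuclideanSpace.single a (1 : ℝ) : 𝔼 m) := by
  have h2 : ∀ c, HasFDerivAt (fun z => u z c)
      ((EuclideanSpace.proj c : (𝔼 m) →L[ℝ] ℝ).comp (fderiv ℝ u y)) y := fun c =>
    (EuclideanSpace.proj c : (𝔼 m) →L[ℝ] ℝ).hasFDerivAt.comp y hu.hasFDerivAt
  ext b
  have h3 : pd i (fun z => u z b) y = fderiv ℝ u y (EuclideanSpace.single i 1) b := by
    rw [pd, (h2 b).fderiv]; rfl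
  simp [Pi.single_apply, h3]

/-- Near `y`, `f` composed with the inverse chart at `p` equals the inverse chart at `q` composed
with `localRep`. The chain rule applied to the two factorizations gives the formula. -/
theorem mfderiv_coordVec {p : M} {q : N} {f : M → N} {y : 𝔼 n}
    (hy : y ∈ (extChartAt (𝓡 n) p).target)
    (hf : ContMDiffAt (𝓡 n) (𝓡 m) ∞ f ((extChartAt (𝓡 n) p).symm y))
    (hq : f ((extChartAt (𝓡 n) p).symm y) ∈ (extChartAt (𝓡 m) q).source) (i : Fin n) :
    (mfderiv (𝓡 n) (𝓡 m) f ((extChartAt (𝓡 n) p).symm y) (coordVec p i y) : 𝔼 m) =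
      ∑ a, pd i (fun z => localRep p q f z a) y •
        (coordVec q a (localRep p q f y) : 𝔼 m) := by
  have hu := contDiffAt_localRep hy hf hq
  have hs := contMDiffAt_chart_symm p hy
  have hut : localRep p q f y ∈ (extChartAt (𝓡 m) q).target :=
    (extChartAt (𝓡 m) q).map_source hq
  have hev : (fun z => f ((extChartAt (𝓡 n) p).symm z)) =ᶠ[𝓝 y]
      fun z => (extChartAt (𝓡 m) q).symm (localRep p q f z) := by
    have hc : ContinuousAt (fun z => f ((extChartAt (𝓡 n) p).symm z)) y :=
      (hf.comp y hs).continuousAt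
    filter_upwards [hc.preimage_mem_nhds ((isOpen_extChartAt_source q).mem_nhds hq)] with z hz
    exact ((extChartAt (𝓡 m) q).left_inv hz).symm
  have h1 : mfderiv 𝓘(ℝ, 𝔼 n) (𝓡 m) (fun z => f ((extChartAt (𝓡 n) p).symm z)) y =
      (mfderiv (𝓡 n) (𝓡 m) f ((extChartAt (𝓡 n) p).symm y)).comp
        (mfderiv 𝓘(ℝ, 𝔼 n) (𝓡 n) (extChartAt (𝓡 n) p).symm y) :=
    mfderiv_comp y (hf.mdifferentiableAt (by simp)) (hs.mdifferentiableAt (by simp))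
  have h2 : mfderiv 𝓘(ℝ, 𝔼 n) (𝓡 m) (fun z => (extChartAt (𝓡 m) q).symm (localRep p q f z)) y =
      (mfderiv 𝓘(ℝ, 𝔼 m) (𝓡 m) (extChartAt (𝓡 m) q).symm (localRep p q f y)).comp
        (mfderiv 𝓘(ℝ, 𝔼 n) 𝓘(ℝ, 𝔼 m) (localRep p q f) y) :=
    mfderiv_comp y ((contMDiffAt_chart_symm q hut).mdifferentiableAt (by simp))
      (hu.contMDiffAt.mdifferentiableAt (by simp))
  have h3 : (mfderiv 𝓘(ℝ, 𝔼 n) (𝓡 m) (fun z => f ((extChartAt (𝓡 n) p).symm z)) y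
      (EuclideanSpace.single i (1 : ℝ) : 𝔼 n) : 𝔼 m) =
      mfderiv 𝓘(ℝ, 𝔼 n) (𝓡 m) (fun z => (extChartAt (𝓡 m) q).symm (localRep p q f z)) y
      (EuclideanSpace.single i (1 : ℝ) : 𝔼 n) := by
    exact congrArg (fun L : (𝔼 n) →L[ℝ] 𝔼 m => L (EuclideanSpace.single i (1 : ℝ))) hev.mfderiv_eq
  rw [h1, h2, mfderiv_eq_fderiv] at h3
  refine h3.trans ?_
  refine (congrArg (mfderiv 𝓘(ℝ, 𝔼 m) (𝓡 m) (extChartAt (𝓡 m) q).symm (localRep p q f y))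
    (fderiv_apply_single_eq_sum (hu.differentiableAt (by simp)) i)).trans ?_
  refine (map_sum (mfderiv 𝓘(ℝ, 𝔼 m) (𝓡 m) (extChartAt (𝓡 m) q).symm (localRep p q f y)) _ _).trans ?_
  refine Finset.sum_congr rfl fun a _ => ?_
  exact map_smul (mfderiv 𝓘(ℝ, 𝔼 m) (𝓡 m) (extChartAt (𝓡 m) q).symm (localRep p q f y)) _ _

/-- Transports a tensor along a propositional equality of base points, such as a point and its image
under chart and inverse chart. The vectors stay the same in the model space `𝔼 n`. -/
theorem tensor2_congr (φ : Tensor2 n M) {x x' : M} (h : x = x') (v w : 𝔼 n) :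
    φ x (show TangentSpace (𝓡 n) x from v) (show TangentSpace (𝓡 n) x from w) =
      φ x' (show TangentSpace (𝓡 n) x' from v) (show TangentSpace (𝓡 n) x' from w) := by
  subst h; rfl

theorem tensor2_sum_sum (φ : Tensor2 m N) (x : N) (s t : Fin m → ℝ) (v : Fin m → TangentSpace (𝓡 m) x) :
    φ x (∑ a, s a • v a) (∑ b, t b • v b) = ∑ a, ∑ b, φ x (v a) (v b) * s a * t b := by
  simp only [map_sum, LinearMap.sum_apply, map_smul, LinearMap.smul_apply, smul_eq_mul, Finset.mul_sum]
  rw [Finset.sum_comm]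
  refine Finset.sum_congr rfl fun a _ => Finset.sum_congr rfl fun b _ => by ring

/-- Stated for an arbitrary tensor so that it serves twice: for the pullback metric, and with `f =
id` for the change of charts. -/
theorem coeff_pullback {p : M} {q : N} {f : M → N} {y : 𝔼 n} (φ : Tensor2 m N)
    (hy : y ∈ (extChartAt (𝓡 n) p).target)
    (hf : ContMDiffAt (𝓡 n) (𝓡 m) ∞ f ((extChartAt (𝓡 n) p).symm y))
    (hq : f ((extChartAt (𝓡 n) p).symm y) ∈ (extChartAt (𝓡 m) q).source) (i j : Fin n) :
    φ (f ((extChartAt (𝓡 n) p).symm y))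
      (mfderiv (𝓡 n) (𝓡 m) f ((extChartAt (𝓡 n) p).symm y) (coordVec p i y))
      (mfderiv (𝓡 n) (𝓡 m) f ((extChartAt (𝓡 n) p).symm y) (coordVec p j y)) =
    ∑ a, ∑ b, coeff φ q (localRep p q f y) a b * pd i (fun z => localRep p q f z a) y *
      pd j (fun z => localRep p q f z b) y := by
  have hx : f ((extChartAt (𝓡 n) p).symm y) =
      (extChartAt (𝓡 m) q).symm (localRep p q f y) := ((extChartAt (𝓡 m) q).left_inv hq).symm
  refine (tensor2_congr φ hx _ _).trans ?_
  refine Eq.trans ?_ (tensor2_sum_sum φ _ (fun a => pd i (fun z => localRep p q f z a) y)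
    (fun a => pd j (fun z => localRep p q f z a) y) (fun a => coordVec q a (localRep p q f y)))
  exact congrArg₂ (fun v w => φ ((extChartAt (𝓡 m) q).symm (localRep p q f y)) v w)
    (mfderiv_coordVec hy hf hq i) (mfderiv_coordVec hy hf hq j)

theorem coeff_pullbackMetric (h : Metric m N) {p : M} {q : N} {f : M → N} {y : 𝔼 n}
    (hy : y ∈ (extChartAt (𝓡 n) p).target)
    (hf : ContMDiffAt (𝓡 n) (𝓡 m) ∞ f ((extChartAt (𝓡 n) p).symm y))
    (hq : f ((extChartAt (𝓡 n) p).symm y) ∈ (extChartAt (𝓡 m) q).source) (i j : Fin n) :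
    coeff (pullbackMetric h f) p y i j =
    ∑ a, ∑ b, coeff (metricTensor h) q (localRep p q f y) a b *
      pd i (fun z => localRep p q f z a) y * pd j (fun z => localRep p q f z b) y :=
  coeff_pullback (metricTensor h) hy hf hq i j

/-- The Jacobian matrix of the change of charts from `p` to `q`. -/
def transitionJacobian (p q : M) (y : 𝔼 n) : Matrix (Fin n) (Fin n) ℝ :=
  Matrix.of fun a i => pd i (fun z => localRep p q (id : M → M) z a) y

theorem coeff_change_chart (φ : Tensor2 n M) {p q : M} {y : 𝔼 n}
    (hy : y ∈ (extChartAt (𝓡 n) p).target)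
    (hq : (extChartAt (𝓡 n) p).symm y ∈ (extChartAt (𝓡 n) q).source) :
    coeff φ p y = (transitionJacobian p q y).transpose *
      coeff φ q (localRep p q (id : M → M) y) * transitionJacobian p q y := by
  ext i j
  have h1 := coeff_pullback (f := (id : M → M)) (q := q) φ hy contMDiffAt_id hq i j
  rw [mfderiv_id] at h1
  refine Eq.trans h1 ?_
  simp only [Matrix.mul_apply, Finset.sum_mul, Matrix.transpose_apply, transitionJacobian,
    Matrix.of_apply]
  rw [Finset.sum_comm]
  refine Finset.sum_congr rfl fun a _ => Finset.sum_congr rfl fun b _ => by ring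

theorem metricTensor_apply (g : Metric n M) (x : M) (v w : TangentSpace (𝓡 n) x) :
    metricTensor g x v w = g.inner x v w := rfl

theorem mfderiv_chart_coordVec (p : M) {y : 𝔼 n} (hy : y ∈ (extChartAt (𝓡 n) p).target)
    (i : Fin n) :
    (mfderiv (𝓡 n) 𝓘(ℝ, 𝔼 n) (extChartAt (𝓡 n) p) ((extChartAt (𝓡 n) p).symm y)
      (coordVec p i y) : 𝔼 n) = EuclideanSpace.single i 1 := by
  have hs := contMDiffAt_chart_symm p hy
  have hc := contMDiffAt_chart p ((extChartAt (𝓡 n) p).map_target hy)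
  have h1 : mfderiv 𝓘(ℝ, 𝔼 n) 𝓘(ℝ, 𝔼 n)
      (fun z => extChartAt (𝓡 n) p ((extChartAt (𝓡 n) p).symm z)) y =
      (mfderiv (𝓡 n) 𝓘(ℝ, 𝔼 n) (extChartAt (𝓡 n) p) ((extChartAt (𝓡 n) p).symm y)).comp
        (mfderiv 𝓘(ℝ, 𝔼 n) (𝓡 n) (extChartAt (𝓡 n) p).symm y) :=
    mfderiv_comp y (hc.mdifferentiableAt (by simp)) (hs.mdifferentiableAt (by simp))
  have hev : (fun z => extChartAt (𝓡 n) p ((extChartAt (𝓡 n) p).symm z)) =ᶠ[𝓝 y] id := by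
    filter_upwards [(isOpen_extChartAt_target p).mem_nhds hy] with z hz
    exact (extChartAt (𝓡 n) p).right_inv hz
  have h3 : (mfderiv 𝓘(ℝ, 𝔼 n) 𝓘(ℝ, 𝔼 n)
      (fun z => extChartAt (𝓡 n) p ((extChartAt (𝓡 n) p).symm z)) y
      (EuclideanSpace.single i (1 : ℝ) : 𝔼 n) : 𝔼 n) = EuclideanSpace.single i 1 := by
    rw [hev.mfderiv_eq, mfderiv_id]; rfl
  rw [h1] at h3
  exact h3

theorem coordVec_sum_ne_zero (p : M) {y : 𝔼 n} (hy : y ∈ (extChartAt (𝓡 n) p).target)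
    {s : Fin n → ℝ} (hs : s ≠ 0) : ∑ i, s i • coordVec p i y ≠ 0 := by
  intro h0
  apply hs
  have h1 : (mfderiv (𝓡 n) 𝓘(ℝ, 𝔼 n) (extChartAt (𝓡 n) p) ((extChartAt (𝓡 n) p).symm y)
      (∑ i, s i • coordVec p i y) : 𝔼 n) = ∑ i, s i • (EuclideanSpace.single i (1 : ℝ) : 𝔼 n) := by
    refine (map_sum _ _ _).trans (Finset.sum_congr rfl fun i _ => ?_)
    refine (map_smul _ _ _).trans ?_
    exact congrArg (fun v : 𝔼 n => s i • v) (mfderiv_chart_coordVec p hy i)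
  rw [h0] at h1
  have h2 : (0 : 𝔼 n) = ∑ i, s i • (EuclideanSpace.single i (1 : ℝ) : 𝔼 n) :=
    (map_zero _).symm.trans h1
  ext j
  have h3 := congrArg (fun v : 𝔼 n => v j) h2
  simpa [Pi.single_apply] using h3.symm

/-- The coordinate vectors are independent, so the quadratic form of the matrix is `g` evaluated on
a nonzero vector. The resulting positive determinant makes the inverse metric and the volume density
smooth. -/
theorem coeff_metric_posDef (g : Metric n M) (p : M) {y : 𝔼 n}
    (hy : y ∈ (extChartAt (𝓡 n) p).target) : (coeff (metricTensor g) p y).PosDef := by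
  refine Matrix.PosDef.of_dotProduct_mulVec_pos ?_ ?_
  · ext i j
    simp only [Matrix.conjTranspose_apply, star_trivial]
    exact g.symm _ _ _
  · intro s hs
    have h1 := g.pos _ _ (coordVec_sum_ne_zero p hy hs)
    have h2 := tensor2_sum_sum (metricTensor g) _ s s (fun i => coordVec p i y)
    rw [metricTensor_apply] at h2
    rw [h2] at h1
    refine lt_of_lt_of_eq h1 ?_
    simp only [dotProduct, Matrix.mulVec, Finset.mul_sum, star_trivial]
    refine Finset.sum_congr rfl fun a _ => Finset.sum_congr rfl fun b _ => ?_
    change _ = s a * (metricTensor g _ (coordVec p a y) (coordVec p b y) * s b)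
    ring

theorem coeff_metric_symm (g : Metric n M) (p : M) (y : 𝔼 n) (i j : Fin n) :
    coeff (metricTensor g) p y i j = coeff (metricTensor g) p y j i :=
  g.symm _ _ _

theorem coeff_metric_det_pos (g : Metric n M) (p : M) {y : 𝔼 n}
    (hy : y ∈ (extChartAt (𝓡 n) p).target) : 0 < (coeff (metricTensor g) p y).det :=
  (coeff_metric_posDef g p hy).det_pos

theorem invCoeff_symm (g : Metric n M) (p : M) (y : 𝔼 n) (i j : Fin n) :
    invCoeff g p y i j = invCoeff g p y j i := by
  have h : (coeff (metricTensor g) p y).transpose = coeff (metricTensor g) p y := by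
    ext i j; exact coeff_metric_symm g p y j i
  have h2 : (invCoeff g p y).transpose = invCoeff g p y := by
    rw [invCoeff, Matrix.transpose_nonsing_inv, h]
  exact congrFun (congrFun h2 j) i

/-- Smoothness of `g` is given for a section of a bundle of bilinear forms. The field `∂ᵢ` is the
tangent map of the inverse chart applied to a constant vector, hence smooth along that map, and
evaluating the section on two such fields stays smooth. -/
theorem contDiffAt_coeff_metric (g : Metric n M) (p : M) {y : 𝔼 n}
    (hy : y ∈ (extChartAt (𝓡 n) p).target) (i j : Fin n) :
    ContDiffAt ℝ ∞ (fun z => coeff (metricTensor g) p z i j) y := by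
  rw [← contMDiffAt_iff_contDiffAt]
  have hT := isOpen_extChartAt_target (I := 𝓡 n) p
  have hv : ∀ i : Fin n, ContMDiffAt 𝓘(ℝ, 𝔼 n) ((𝓡 n).prod 𝓘(ℝ, 𝔼 n)) ∞
      (fun z => TotalSpace.mk' (𝔼 n) (E := fun x : M => TangentSpace (𝓡 n) x)
        ((extChartAt (𝓡 n) p).symm z) (coordVec p i z)) y := by
    intro i
    have h1 := (contMDiffOn_extChartAt_symm (I := 𝓡 n) (n := ∞) p).contMDiffOn_tangentMapWithin
      (m := ∞) (by simp) hT.uniqueMDiffOn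
    have h2 := (contMDiffAt_vectorSpace_iff_contDiffAt (𝕜 := ℝ) (n := ∞) (x := y)
      (V := fun _ : 𝔼 n => (EuclideanSpace.single i 1 : 𝔼 n))).2 contDiffAt_const
    have h3 : ContMDiffWithinAt 𝓘(ℝ, 𝔼 n) ((𝓡 n).tangent) ∞
        (fun z => tangentMapWithin 𝓘(ℝ, 𝔼 n) (𝓡 n) (extChartAt (𝓡 n) p).symm
          (extChartAt (𝓡 n) p).target
          (⟨z, EuclideanSpace.single i 1⟩ : TangentBundle 𝓘(ℝ, 𝔼 n) (𝔼 n)))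
        (extChartAt (𝓡 n) p).target y :=
      (h1 ⟨y, EuclideanSpace.single i 1⟩ hy).comp y h2.contMDiffWithinAt fun z hz => hz
    refine (h3.contMDiffAt (hT.mem_nhds hy)).congr_of_eventuallyEq ?_
    filter_upwards [hT.mem_nhds hy] with z hz
    simp only [tangentMapWithin, coordVec, mfderivWithin_of_isOpen hT hz]
  have hg := (g.contMDiff ((extChartAt (𝓡 n) p).symm y)).comp y (contMDiffAt_chart_symm p hy)
  have : ContMDiffAt 𝓘(ℝ, 𝔼 n) ((𝓡 n).prod 𝓘(ℝ)) ∞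
      (fun z ↦ TotalSpace.mk' ℝ (E := Bundle.Trivial M ℝ) ((extChartAt (𝓡 n) p).symm z)
        (g.inner ((extChartAt (𝓡 n) p).symm z) (coordVec p i z) (coordVec p j z))) y := by
    apply ContMDiffAt.clm_bundle_apply₂ (F₁ := 𝔼 n) (F₂ := 𝔼 n)
    · exact hg
    · exact hv i
    · exact hv j
  simp only [contMDiffAt_totalSpace] at this
  exact this.2

theorem contDiffAt_invCoeff (g : Metric n M) (p : M) {y : 𝔼 n}
    (hy : y ∈ (extChartAt (𝓡 n) p).target) (i j : Fin n) :
    ContDiffAt ℝ ∞ (fun z => invCoeff g p z i j) y :=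
  contDiffAt_inv_apply (contDiffAt_coeff_metric g p hy) (coeff_metric_det_pos g p hy).ne' i j

/-- `traceMetric` uses at each point the chart centred there, whereas differentiating it needs one
fixed chart. Under a change of charts with Jacobian `J` the inverse metric becomes `J⁻¹ G⁻¹ J⁻ᵀ` and
the tensor `Jᵀ Φ J`, so the trace of the product is invariant by cyclicity. -/
theorem traceMetric_eq (g : Metric n M) (φ : Tensor2 n M) (p : M) {y : 𝔼 n}
    (hy : y ∈ (extChartAt (𝓡 n) p).target) :
    traceMetric g φ ((extChartAt (𝓡 n) p).symm y) =
      ∑ i, ∑ j, invCoeff g p y i j * coeff φ p y i j := by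
  have htr : ∀ A B : Matrix (Fin n) (Fin n) ℝ, ∑ i, ∑ j, A i j * B i j = (A * B.transpose).trace := by
    intro A B
    simp [Matrix.trace, Matrix.mul_apply]
  set x := (extChartAt (𝓡 n) p).symm y with hx
  have hq : x ∈ (extChartAt (𝓡 n) x).source := mem_extChartAt_source x
  have hk : localRep p x (id : M → M) y = extChartAt (𝓡 n) x x := rfl
  rw [traceMetric, htr, htr]
  rw [invCoeff, invCoeff, coeff_change_chart (metricTensor g) hy hq,
    coeff_change_chart φ hy hq, hk]
  set J := transitionJacobian p x y
  set G := coeff (metricTensor g) x (extChartAt (𝓡 n) x x)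
  set Φ := coeff φ x (extChartAt (𝓡 n) x x)
  -- Invertibility of the Jacobian is read off from the nonzero determinant of the metric in the
  -- chart at `p`.
  have hdet : J.transpose.det * G.det * J.det ≠ 0 := by
    have := (coeff_metric_det_pos g p hy).ne'
    rwa [coeff_change_chart (metricTensor g) hy hq, hk, Matrix.det_mul, Matrix.det_mul] at this
  have hJ : IsUnit J.det := isUnit_iff_ne_zero.2 (right_ne_zero_of_mul hdet)
  have hJt : IsUnit J.transpose.det := by rwa [Matrix.det_transpose]
  rw [Matrix.mul_inv_rev, Matrix.mul_inv_rev, Matrix.transpose_mul, Matrix.transpose_mul,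
    Matrix.transpose_transpose]
  have : J⁻¹ * (G⁻¹ * J.transpose⁻¹) * (J.transpose * (Φ.transpose * J)) =
      J⁻¹ * (G⁻¹ * Φ.transpose * J) := by
    calc _ = J⁻¹ * (G⁻¹ * ((J.transpose⁻¹ * J.transpose) * (Φ.transpose * J))) := by
          simp only [Matrix.mul_assoc]
      _ = _ := by rw [Matrix.nonsing_inv_mul _ hJt, Matrix.one_mul, Matrix.mul_assoc]
  rw [this, Matrix.trace_mul_comm J⁻¹, Matrix.mul_assoc, Matrix.mul_nonsing_inv _ hJ, Matrix.mul_one]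

theorem energyDensity_eq (g : Metric n M) (h : Metric m N) {p : M} {q : N} {f : M → N} {y : 𝔼 n}
    (hy : y ∈ (extChartAt (𝓡 n) p).target)
    (hf : ContMDiffAt (𝓡 n) (𝓡 m) ∞ f ((extChartAt (𝓡 n) p).symm y))
    (hq : f ((extChartAt (𝓡 n) p).symm y) ∈ (extChartAt (𝓡 m) q).source) :
    energyDensity g h f ((extChartAt (𝓡 n) p).symm y) =
      ∑ i, ∑ j, invCoeff g p y i j * ∑ a, ∑ b, coeff (metricTensor h) q (localRep p q f y) a b *
      pd i (fun z => localRep p q f z a) y * pd j (fun z => localRep p q f z b) y := by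
  rw [energyDensity, traceMetric_eq g _ p hy]
  refine Finset.sum_congr rfl fun i _ => Finset.sum_congr rfl fun j _ => ?_
  rw [coeff_pullbackMetric h hy hf hq]

end Charts

/-! ### The tension field in coordinates and the divergence identity -/

section Tension

set_option linter.unusedSectionVars false

variable {n m : ℕ} {M : Type*} [TopologicalSpace M] [ChartedSpace (EuclideanSpace ℝ (Fin n)) M]
  [IsManifold (𝓡 n) ∞ M]
  {N : Type*} [TopologicalSpace N] [ChartedSpace (EuclideanSpace ℝ (Fin m)) N]
  [IsManifold (𝓡 m) ∞ N]

/-- The components of the tension field of a map with coordinate expression `u` in the charts at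
`p` and `q`. -/
def tensionCoord (g : Metric n M) (h : Metric m N) (p : M) (q : N) (u : (𝔼 n) → 𝔼 m)
    (y : 𝔼 n) (a : Fin m) : ℝ :=
  ∑ i, ∑ j, invCoeff g p y i j * (pd i (pd j (fun z => u z a)) y
    - ∑ k, christoffel g p k i j y * pd k (fun z => u z a) y
    + ∑ b, ∑ c, christoffel h q a b c (u y) * pd i (fun z => u z b) y * pd j (fun z => u z c) y)

/-- The tension field with its index lowered by the metric `h`. -/
def tensionLower (g : Metric n M) (h : Metric m N) (p : M) (q : N) (u : (𝔼 n) → 𝔼 m)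
    (y : 𝔼 n) (d : Fin m) : ℝ :=
  ∑ a, coeff (metricTensor h) q (u y) a d * tensionCoord g h p q u y a

theorem sum_coeff_mul_invCoeff (g : Metric n M) (p : M) {y : 𝔼 n}
    (hy : y ∈ (extChartAt (𝓡 n) p).target) (i j : Fin n) :
    ∑ k, coeff (metricTensor g) p y i k * invCoeff g p y k j = if i = j then 1 else 0 := by
  have h := Matrix.mul_nonsing_inv (coeff (metricTensor g) p y)
    (isUnit_iff_ne_zero.2 (coeff_metric_det_pos g p hy).ne')
  have h2 := congrFun (congrFun h i) j
  rw [Matrix.mul_apply, Matrix.one_apply] at h2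
  exact h2

theorem tensionLower_eq (g : Metric n M) (h : Metric m N) (p : M) (q : N) (u : (𝔼 n) → 𝔼 m)
    (y : 𝔼 n) (hu : u y ∈ (extChartAt (𝓡 m) q).target) (d : Fin m) :
    tensionLower g h p q u y d =
    ∑ i, ∑ j, invCoeff g p y i j * (∑ a, coeff (metricTensor h) q (u y) a d *
        pd i (pd j (fun z => u z a)) y
      - ∑ k, christoffel g p k i j y * ∑ a, coeff (metricTensor h) q (u y) a d *
        pd k (fun z => u z a) y
      + ∑ b, ∑ c, (pd b (fun z => coeff (metricTensor h) q z c d) (u y)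
          - 1 / 2 * pd d (fun z => coeff (metricTensor h) q z b c) (u y)) *
          pd i (fun z => u z b) y * pd j (fun z => u z c) y) :=
  sum_mul_tension (invCoeff g p y) (fun k i j => christoffel g p k i j y)
    (coeff (metricTensor h) q (u y)) (invCoeff h q (u y))
    (fun c a b => pd c (fun z => coeff (metricTensor h) q z a b) (u y))
    (fun i a => pd i (fun z => u z a) y) (fun i j a => pd i (pd j (fun z => u z a)) y)
    (invCoeff_symm g p y) (coeff_metric_symm h q (u y)) (sum_coeff_mul_invCoeff h q hu) d

theorem pd_invCoeff (g : Metric n M) (p : M) {y : 𝔼 n} (hy : y ∈ (extChartAt (𝓡 n) p).target)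
    (k i j : Fin n) :
    pd k (fun z => invCoeff g p z i j) y = -∑ r, ∑ s, invCoeff g p y i r *
      pd k (fun z => coeff (metricTensor g) p z r s) y * invCoeff g p y s j :=
  fderiv_inv_apply (fun i j => (contDiffAt_coeff_metric g p hy i j).of_le (by simp))
    (coeff_metric_det_pos g p hy).ne' _ i j

theorem pd_firstFundamentalForm (h : Metric m N) {q : N} {u : (𝔼 n) → 𝔼 m} {y : 𝔼 n}
    (hu : ContDiffAt ℝ ∞ u y) (hq : u y ∈ (extChartAt (𝓡 m) q).target) (k i j : Fin n) :
    pd k (fun z => ∑ a, ∑ b, coeff (metricTensor h) q (u z) a b *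
      pd i (fun z => u z a) z * pd j (fun z => u z b) z) y =
    ∑ a, ∑ b, ((∑ c, pd c (fun z => coeff (metricTensor h) q z a b) (u y) *
        pd k (fun z => u z c) y) * pd i (fun z => u z a) y * pd j (fun z => u z b) y
      + coeff (metricTensor h) q (u y) a b * pd k (pd i (fun z => u z a)) y *
        pd j (fun z => u z b) y
      + coeff (metricTensor h) q (u y) a b * pd i (fun z => u z a) y *
        pd k (pd j (fun z => u z b)) y) := by
  have hH : ∀ a b, DifferentiableAt ℝ (fun z => coeff (metricTensor h) q z a b) (u y) :=
    fun a b => (contDiffAt_coeff_metric h q hq a b).differentiableAt (by simp)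
  have hud : DifferentiableAt ℝ u y := hu.differentiableAt (by simp)
  have hHu : ∀ a b, DifferentiableAt ℝ (fun z => coeff (metricTensor h) q (u z) a b) y :=
    fun a b => (hH a b).comp y hud
  have hp : ∀ i a, DifferentiableAt ℝ (pd i (fun z => u z a)) y :=
    fun i a => (contDiffAt_pd (contDiffAt_coord hu a) i).differentiableAt (by simp)
  have h1 : ∀ a b, DifferentiableAt ℝ (fun z => coeff (metricTensor h) q (u z) a b *
      pd i (fun z => u z a) z) y := fun a b => (hHu a b).fun_mul (hp i a)
  rw [pd_sum _ _ fun a _ => DifferentiableAt.fun_sum fun b _ => (h1 a b).fun_mul (hp j b)]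
  refine Finset.sum_congr rfl fun a _ => ?_
  rw [pd_sum _ _ fun b _ => (h1 a b).fun_mul (hp j b)]
  refine Finset.sum_congr rfl fun b _ => ?_
  rw [pd_mul k (h1 a b) (hp j b), pd_mul k (hHu a b) (hp i a), pd_comp k (hH a b) hud]
  ring

theorem contDiffAt_firstFundamentalForm (h : Metric m N) {q : N} {u : (𝔼 n) → 𝔼 m} {y : 𝔼 n}
    (hu : ContDiffAt ℝ ∞ u y) (hq : u y ∈ (extChartAt (𝓡 m) q).target) (i j : Fin n) :
    ContDiffAt ℝ ∞ (fun z => ∑ a, ∑ b, coeff (metricTensor h) q (u z) a b *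
      pd i (fun z => u z a) z * pd j (fun z => u z b) z) y :=
  ContDiffAt.sum fun a _ => ContDiffAt.sum fun b _ =>
    (((contDiffAt_coeff_metric h q hq a b).comp y hu).mul
      (contDiffAt_pd (contDiffAt_coord hu a) i)).mul (contDiffAt_pd (contDiffAt_coord hu b) j)

theorem sum_component_smul_coordVec (x : M) (Y : TangentSpace (𝓡 n) x) :
    (∑ j, component x Y j • (coordVec x j (extChartAt (𝓡 n) x x) : 𝔼 n)) = (Y : 𝔼 n) := by
  have hy : extChartAt (𝓡 n) x x ∈ (extChartAt (𝓡 n) x).target := mem_extChartAt_target x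
  have hs := contMDiffAt_chart_symm x hy
  have hc := contMDiffAt_chart x (mem_extChartAt_source (I := 𝓡 n) x)
  have h1 : mfderiv (𝓡 n) (𝓡 n)
      (fun z => (extChartAt (𝓡 n) x).symm (extChartAt (𝓡 n) x z)) x =
      (mfderiv 𝓘(ℝ, 𝔼 n) (𝓡 n) (extChartAt (𝓡 n) x).symm (extChartAt (𝓡 n) x x)).comp
      (mfderiv (𝓡 n) 𝓘(ℝ, 𝔼 n) (extChartAt (𝓡 n) x) x) :=
    mfderiv_comp x (hs.mdifferentiableAt (by simp)) (hc.mdifferentiableAt (by simp))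
  have hev : (fun z => (extChartAt (𝓡 n) x).symm (extChartAt (𝓡 n) x z)) =ᶠ[𝓝 x] id := by
    filter_upwards [(isOpen_extChartAt_source (I := 𝓡 n) x).mem_nhds
      (mem_extChartAt_source (I := 𝓡 n) x)] with z hz
    exact (extChartAt (𝓡 n) x).left_inv hz
  have h3 : (mfderiv (𝓡 n) (𝓡 n)
      (fun z => (extChartAt (𝓡 n) x).symm (extChartAt (𝓡 n) x z)) x Y : 𝔼 n) = Y := by
    have := congrArg (fun L : (𝔼 n) →L[ℝ] 𝔼 n => L Y) (hev.mfderiv_eq (I := 𝓡 n) (I' := 𝓡 n))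
    refine this.trans ?_
    exact congrArg (fun L : (𝔼 n) →L[ℝ] 𝔼 n => L Y) (mfderiv_id (I := 𝓡 n) (x := x))
  rw [h1] at h3
  refine Eq.trans ?_ h3
  set v : 𝔼 n := mfderiv (𝓡 n) 𝓘(ℝ, 𝔼 n) (extChartAt (𝓡 n) x) x Y with hv
  have hvs : v = ∑ j, v j • (EuclideanSpace.single j (1 : ℝ) : 𝔼 n) := by
    ext b; simp [Pi.single_apply]
  set L : (𝔼 n) →L[ℝ] 𝔼 n :=
    mfderiv 𝓘(ℝ, 𝔼 n) (𝓡 n) (extChartAt (𝓡 n) x).symm (extChartAt (𝓡 n) x x) with hL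
  change ∑ j, v j • L (EuclideanSpace.single j (1 : ℝ) : 𝔼 n) = L v
  conv_rhs => rw [hvs]
  simp only [map_sum, map_smul]

theorem clm_sum_smul (L : (𝔼 n) →L[ℝ] 𝔼 m) (s : Fin n → ℝ) (v : Fin n → 𝔼 n) :
    L (∑ j, s j • v j) = ∑ j, s j • L (v j) := by
  simp only [map_sum, map_smul]

theorem sum_smul_sum_smul {E : Type*} [AddCommGroup E] [Module ℝ E] (c : Fin n → ℝ)
    (P : Fin n → Fin m → ℝ) (w : Fin m → E) :
    ∑ j, c j • ∑ a, P j a • w a = ∑ a, (∑ j, c j * P j a) • w a := by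
  simp only [Finset.smul_sum, smul_smul, Finset.sum_smul]
  exact Finset.sum_comm

theorem mfderiv_congr_point (f : M → N) {x x' : M} (h : x = x') (v : 𝔼 n) :
    (mfderiv (𝓡 n) (𝓡 m) f x (show TangentSpace (𝓡 n) x from v) : 𝔼 m) =
      mfderiv (𝓡 n) (𝓡 m) f x' (show TangentSpace (𝓡 n) x' from v) := by
  subst h; rfl

theorem mfderiv_apply_eq_sum {f : M → N} (x : M) (hf : ContMDiffAt (𝓡 n) (𝓡 m) ∞ f x)
    (Y : TangentSpace (𝓡 n) x) :
    (mfderiv (𝓡 n) (𝓡 m) f x Y : 𝔼 m) = ∑ d, (∑ j, component x Y j *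
      pd j (fun z => localRep x (f x) f z d) (extChartAt (𝓡 n) x x)) •
        (coordVec (f x) d (extChartAt (𝓡 m) (f x) (f x)) : 𝔼 m) := by
  set y := extChartAt (𝓡 n) x x with hydef
  have hy : y ∈ (extChartAt (𝓡 n) x).target := mem_extChartAt_target x
  have hx : (extChartAt (𝓡 n) x).symm y = x := extChartAt_to_inv x
  have hf' : ContMDiffAt (𝓡 n) (𝓡 m) ∞ f ((extChartAt (𝓡 n) x).symm y) := by rwa [hx]
  have hq : f ((extChartAt (𝓡 n) x).symm y) ∈ (extChartAt (𝓡 m) (f x)).source := by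
    rw [hx]; exact mem_extChartAt_source _
  have hu : localRep x (f x) f y = extChartAt (𝓡 m) (f x) (f x) := by
    rw [localRep, hx]
  have h1 : ∀ j, (mfderiv (𝓡 n) (𝓡 m) f x (show TangentSpace (𝓡 n) x from coordVec x j y) : 𝔼 m) =
      ∑ a, pd j (fun z => localRep x (f x) f z a) y •
        (coordVec (f x) a (extChartAt (𝓡 m) (f x) (f x)) : 𝔼 m) := by
    intro j
    refine (mfderiv_congr_point f hx.symm _).trans ?_
    refine (mfderiv_coordVec hy hf' hq j).trans ?_
    rw [hu]
  set L : (𝔼 n) →L[ℝ] 𝔼 m := mfderiv (𝓡 n) (𝓡 m) f x with hL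
  have h2 : L Y = ∑ j, component x Y j • L (coordVec x j y : 𝔼 n) := by
    refine (congrArg L (sum_component_smul_coordVec x Y).symm).trans ?_
    exact clm_sum_smul L _ _
  refine h2.trans ?_
  have h1' : ∀ j, L (coordVec x j y : 𝔼 n) = ∑ a, pd j (fun z => localRep x (f x) f z a) y •
        (coordVec (f x) a (extChartAt (𝓡 m) (f x) (f x)) : 𝔼 m) := h1
  simp only [h1']
  exact sum_smul_sum_smul _ _ _

theorem tension_eq (g : Metric n M) (h : Metric m N) (f : M → N) (x : M) :
    tension g h f x = ∑ a, tensionCoord g h x (f x) (localRep x (f x) f) (extChartAt (𝓡 n) x x) a •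
      (show TangentSpace (𝓡 m) (f x) from
        coordVec (f x) a (extChartAt (𝓡 m) (f x) (f x))) := by
  have hu : localRep x (f x) f (extChartAt (𝓡 n) x x) = extChartAt (𝓡 m) (f x) (f x) := by
    rw [localRep, extChartAt_to_inv]
  simp only [tensionCoord, hu]
  rfl

/-- Justifies the name `tensionLower`: its components are the pairings of `τ` with the coordinate
vectors of the target. -/
theorem inner_tension (g : Metric n M) (h : Metric m N) (f : M → N) (x : M) (s : Fin m → ℝ) :
    h.inner (f x) (tension g h f x) (∑ d, s d • (show TangentSpace (𝓡 m) (f x) from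
        coordVec (f x) d (extChartAt (𝓡 m) (f x) (f x)))) =
    ∑ d, tensionLower g h x (f x) (localRep x (f x) f) (extChartAt (𝓡 n) x x) d * s d := by
  have hu : localRep x (f x) f (extChartAt (𝓡 n) x x) = extChartAt (𝓡 m) (f x) (f x) := by
    rw [localRep, extChartAt_to_inv]
  rw [tension_eq, ← metricTensor_apply]
  rw [tensor2_sum_sum, Finset.sum_comm]
  refine Finset.sum_congr rfl fun d _ => ?_
  rw [tensionLower, Finset.sum_mul]
  refine Finset.sum_congr rfl fun a _ => ?_
  rw [hu]
  congr 2
  exact tensor2_congr (metricTensor h) (extChartAt_to_inv (f x)).symm _ _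

/-- The energy density is smooth, and its differential is computed in the chart at `x`. -/
theorem mvfderiv_eq_sum_pd {F : M → ℝ} (x : M) {Fc : (𝔼 n) → ℝ}
    (hF : ∀ᶠ z in 𝓝 (extChartAt (𝓡 n) x x), F ((extChartAt (𝓡 n) x).symm z) = Fc z)
    (hd : DifferentiableAt ℝ Fc (extChartAt (𝓡 n) x x)) (Y : TangentSpace (𝓡 n) x) :
    mvfderiv (𝓡 n) F x Y = ∑ j, pd j Fc (extChartAt (𝓡 n) x x) * component x Y j := by
  have hc := contMDiffAt_chart x (mem_extChartAt_source (I := 𝓡 n) x)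
  have hev : F =ᶠ[𝓝 x] fun z => Fc (extChartAt (𝓡 n) x z) := by
    filter_upwards [hc.continuousAt.eventually hF, (isOpen_extChartAt_source (I := 𝓡 n) x).mem_nhds
      (mem_extChartAt_source (I := 𝓡 n) x)] with z hz hzs
    rw [← hz, (extChartAt (𝓡 n) x).left_inv hzs]
  have h1 : mfderiv (𝓡 n) 𝓘(ℝ, ℝ) (fun z => Fc (extChartAt (𝓡 n) x z)) x =
      (mfderiv 𝓘(ℝ, 𝔼 n) 𝓘(ℝ, ℝ) Fc (extChartAt (𝓡 n) x x)).comp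
      (mfderiv (𝓡 n) 𝓘(ℝ, 𝔼 n) (extChartAt (𝓡 n) x) x) :=
    mfderiv_comp x hd.mdifferentiableAt (hc.mdifferentiableAt (by simp))
  have h2 : mvfderiv (𝓡 n) F x Y = (mfderiv (𝓡 n) 𝓘(ℝ, ℝ) F x Y : ℝ) := rfl
  rw [h2]
  refine (congrArg (fun L : (𝔼 n) →L[ℝ] ℝ => L Y) hev.mfderiv_eq).trans ?_
  refine (congrArg (fun L : (𝔼 n) →L[ℝ] ℝ => L Y) h1).trans ?_
  rw [mfderiv_eq_fderiv]
  exact fderiv_apply_eq_sum_pd Fc _ _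

theorem divergence_add_half_mvfderiv (g : Metric n M) (h : Metric m N) {f : M → N}
    (hf : ContMDiff (𝓡 n) (𝓡 m) ∞ f) (x : M) (Y : TangentSpace (𝓡 n) x) :
    divergence g (pullbackMetric h f) x Y + (1 / 2) * mvfderiv (𝓡 n) (energyDensity g h f) x Y
      = -(h.inner (f x) (tension g h f x) (mfderiv (𝓡 n) (𝓡 m) f x Y)) := by
  set y := extChartAt (𝓡 n) x x with hydef
  set u : (𝔼 n) → 𝔼 m := localRep x (f x) f with hudef
  have hy : y ∈ (extChartAt (𝓡 n) x).target := mem_extChartAt_target x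
  have hx : (extChartAt (𝓡 n) x).symm y = x := extChartAt_to_inv x
  have hq : f ((extChartAt (𝓡 n) x).symm y) ∈ (extChartAt (𝓡 m) (f x)).source := by
    rw [hx]; exact mem_extChartAt_source _
  have huy : u y ∈ (extChartAt (𝓡 m) (f x)).target := (extChartAt (𝓡 m) (f x)).map_source hq
  have hu : ContDiffAt ℝ ∞ u y := contDiffAt_localRep hy (hf _) hq
  have hnear : ∀ᶠ z in 𝓝 y, z ∈ (extChartAt (𝓡 n) x).target ∧
      f ((extChartAt (𝓡 n) x).symm z) ∈ (extChartAt (𝓡 m) (f x)).source := by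
    refine ((isOpen_extChartAt_target (I := 𝓡 n) x).eventually_mem hy).and ?_
    exact ((hf _).continuousAt.comp (contMDiffAt_chart_symm x hy).continuousAt).preimage_mem_nhds
      ((isOpen_extChartAt_source (f x)).mem_nhds hq)
  -- The equality is needed on a neighbourhood of `y`, since both sides are differentiated.
  have hcoef : ∀ i j, (fun z => coeff (pullbackMetric h f) x z i j) =ᶠ[𝓝 y] fun z =>
      ∑ a, ∑ b, coeff (metricTensor h) (f x) (u z) a b *
      pd i (fun z => u z a) z * pd j (fun z => u z b) z := by
    intro i j
    filter_upwards [hnear] with z hz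
    exact coeff_pullbackMetric h hz.1 (hf _) hz.2 i j
  have hde := mvfderiv_eq_sum_pd (F := energyDensity g h f) x
    (Fc := fun z => ∑ i, ∑ j, invCoeff g x z i j * ∑ a, ∑ b,
      coeff (metricTensor h) (f x) (u z) a b * pd i (fun z => u z a) z * pd j (fun z => u z b) z)
    (by
      filter_upwards [hnear] with z hz
      exact energyDensity_eq g h hz.1 (hf _) hz.2)
    (by
      refine DifferentiableAt.fun_sum fun i _ => DifferentiableAt.fun_sum fun j _ => ?_
      exact ((contDiffAt_invCoeff g x hy i j).mul
        (contDiffAt_firstFundamentalForm h hu huy i j)).differentiableAt (by simp)) Y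
  have hG : ∀ i j, DifferentiableAt ℝ (fun z => invCoeff g x z i j) y := fun i j =>
    (contDiffAt_invCoeff g x hy i j).differentiableAt (by simp)
  have hP : ∀ i j, DifferentiableAt ℝ (fun z => ∑ a, ∑ b,
      coeff (metricTensor h) (f x) (u z) a b * pd i (fun z => u z a) z *
        pd j (fun z => u z b) z) y := fun i j =>
    (contDiffAt_firstFundamentalForm h hu huy i j).differentiableAt (by simp)
  have hrhs : h.inner (f x) (tension g h f x) (mfderiv (𝓡 n) (𝓡 m) f x Y) =
      ∑ d, tensionLower g h x (f x) u y d * ∑ j, component x Y j * pd j (fun z => u z d) y := by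
    rw [← inner_tension]
    exact congrArg (fun v => h.inner (f x) (tension g h f x) v) (mfderiv_apply_eq_sum x (hf x) Y)
  have hpdE : ∀ j, pd j (fun z => ∑ k, ∑ i, invCoeff g x z k i * ∑ a, ∑ b,
      coeff (metricTensor h) (f x) (u z) a b * pd k (fun z => u z a) z *
        pd i (fun z => u z b) z) y =
      ∑ k, ∑ i, (pd j (fun z => invCoeff g x z k i) y * coeff (pullbackMetric h f) x y k i +
        invCoeff g x y k i * pd j (fun z => coeff (pullbackMetric h f) x z k i) y) := by
    intro j
    rw [pd_sum _ _ fun k _ => DifferentiableAt.fun_sum fun i _ => (hG k i).fun_mul (hP k i)]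
    refine Finset.sum_congr rfl fun k _ => ?_
    rw [pd_sum _ _ fun i _ => (hG k i).fun_mul (hP k i)]
    refine Finset.sum_congr rfl fun i _ => ?_
    rw [pd_mul j (hG k i) (hP k i), pd_congr (hcoef k i) j, (hcoef k i).eq_of_nhds]
  have key := fun j => divergence_algebra (invCoeff g x y)
    (fun k i j => pd k (fun z => coeff (metricTensor g) x z i j) y)
    (coeff (metricTensor h) (f x) (u y))
    (fun c a b => pd c (fun z => coeff (metricTensor h) (f x) z a b) (u y))
    (fun i a => pd i (fun z => u z a) y) (fun i j a => pd i (pd j (fun z => u z a)) y)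
    (fun k i j => christoffel g x k i j y) (fun j k i => pd j (fun z => invCoeff g x z k i) y)
    (coeff (pullbackMetric h f) x y)
    (fun k i j => pd k (fun z => coeff (pullbackMetric h f) x z i j) y)
    (invCoeff_symm g x y)
    (fun k i j => by simp only [coeff_metric_symm g x _ i j])
    (coeff_metric_symm h (f x) (u y))
    (fun i j => funext fun a => pd_comm (contDiffAt_coord hu a) i j)
    (fun l k j => rfl) (fun j k i => pd_invCoeff g x hy j k i)
    (fun i j => (hcoef i j).eq_of_nhds)
    (fun k i j => by
      rw [pd_congr (hcoef i j) k]
      exact pd_firstFundamentalForm h hu huy k i j) j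
  rw [hrhs, hde, divergence]
  simp only [← hydef, hpdE]
  have hl : -∑ j, (∑ k, ∑ i, invCoeff g x y k i * covDeriv g (pullbackMetric h f) x k i j y) *
      component x Y j + 1 / 2 * ∑ j, (∑ k, ∑ i, (pd j (fun z => invCoeff g x z k i) y *
        coeff (pullbackMetric h f) x y k i +
        invCoeff g x y k i * pd j (fun z => coeff (pullbackMetric h f) x z k i) y)) *
        component x Y j = ∑ j, (-(∑ d, tensionLower g h x (f x) u y d *
          pd j (fun z => u z d) y)) * component x Y j := by
    rw [Finset.mul_sum, ← Finset.sum_neg_distrib, ← Finset.sum_add_distrib]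
    refine Finset.sum_congr rfl fun j _ => ?_
    simp only [tensionLower_eq g h x (f x) u y huy]
    rw [← key j]
    simp only [covDeriv]
    ring
  refine hl.trans ?_
  simp only [neg_mul, Finset.sum_neg_distrib, Finset.sum_mul, Finset.mul_sum]
  rw [Finset.sum_comm]
  congr 1
  refine Finset.sum_congr rfl fun d _ => Finset.sum_congr rfl fun j _ => by ring

end Tension

/-! ### The Riemannian measure in charts -/

section Volume

set_option linter.unusedSectionVars false

variable {n : ℕ} {M : Type*} [TopologicalSpace M] [ChartedSpace (EuclideanSpace ℝ (Fin n)) M]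
  [IsManifold (𝓡 n) ∞ M]

/-- The density `√(det gᵢⱼ)` of the Riemannian volume in the chart at `p`. -/
def volDensity (g : Metric n M) (p : M) (y : 𝔼 n) : ℝ :=
  Real.sqrt (coeff (metricTensor g) p y).det

theorem contDiffAt_volDensity (g : Metric n M) (p : M) {y : 𝔼 n}
    (hy : y ∈ (extChartAt (𝓡 n) p).target) : ContDiffAt ℝ ∞ (volDensity g p) y :=
  (contDiffAt_det (contDiffAt_coeff_metric g p hy)).sqrt (coeff_metric_det_pos g p hy).ne'

theorem volDensity_pos (g : Metric n M) (p : M) {y : 𝔼 n}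
    (hy : y ∈ (extChartAt (𝓡 n) p).target) : 0 < volDensity g p y :=
  Real.sqrt_pos.2 (coeff_metric_det_pos g p hy)

theorem continuousOn_volDensity (g : Metric n M) (p : M) :
    ContinuousOn (volDensity g p) (extChartAt (𝓡 n) p).target :=
  fun _ hy => (contDiffAt_volDensity g p hy).continuousAt.continuousWithinAt

theorem det_fderiv_transition {p q : M} {y : 𝔼 n}
    (hd : DifferentiableAt ℝ (localRep p q (id : M → M) : (𝔼 n) → 𝔼 n) y) :
    (fderiv ℝ (localRep p q (id : M → M) : (𝔼 n) → 𝔼 n) y).det = (transitionJacobian p q y).det := by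
  rw [ContinuousLinearMap.det,
    ← LinearMap.det_toMatrix (EuclideanSpace.basisFun (Fin n) ℝ).toBasis]
  congr 1
  ext a i
  rw [LinearMap.toMatrix_apply]
  have := fderiv_apply_single_eq_sum hd i
  simp [transitionJacobian, this]

/-- The Gram determinant picks up the square of the Jacobian determinant. Its root supplies exactly
the absolute value in the change of variables formula. -/
theorem volDensity_change_chart (g : Metric n M) {p q : M} {y : 𝔼 n}
    (hy : y ∈ (extChartAt (𝓡 n) p).target)
    (hq : (extChartAt (𝓡 n) p).symm y ∈ (extChartAt (𝓡 n) q).source) :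
    volDensity g p y = |(fderiv ℝ (localRep p q (id : M → M) : (𝔼 n) → 𝔼 n) y).det| *
      volDensity g q (localRep p q (id : M → M) y) := by
  have hd : DifferentiableAt ℝ (localRep p q (id : M → M) : (𝔼 n) → 𝔼 n) y :=
    (contDiffAt_localRep hy contMDiffAt_id hq).differentiableAt (by simp)
  rw [det_fderiv_transition hd, volDensity, volDensity,
    coeff_change_chart (metricTensor g) hy hq, Matrix.det_mul, Matrix.det_mul,
    Matrix.det_transpose, ← Real.sqrt_sq_eq_abs, ← Real.sqrt_mul (sq_nonneg _)]
  congr 1; ring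

variable [MeasurableSpace M] [BorelSpace M]

theorem measurableSet_target (p : M) : MeasurableSet (extChartAt (𝓡 n) p).target :=
  (isOpen_extChartAt_target p).measurableSet

theorem measurableSet_source (p : M) : MeasurableSet (extChartAt (𝓡 n) p).source :=
  (isOpen_extChartAt_source p).measurableSet

theorem aemeasurable_chart_symm (g : Metric n M) (p : M) :
    AEMeasurable (extChartAt (𝓡 n) p).symm
      ((volume.restrict (extChartAt (𝓡 n) p).target).withDensity
        (fun y => ENNReal.ofReal (volDensity g p y))) :=
  ((continuousOn_extChartAt_symm p).aemeasurable (measurableSet_target p)).mono_ac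
    (withDensity_absolutelyContinuous _ _)

/-- The inverse chart is controlled only on its target, so it is first replaced off the target by
the constant `p`, which gives a measurable function. -/
theorem measurableSet_chart_preimage (p : M) {s : Set M} (hs : MeasurableSet s) :
    MeasurableSet ((extChartAt (𝓡 n) p).target ∩ (extChartAt (𝓡 n) p).symm ⁻¹' s) := by
  classical
  have h := (continuousOn_extChartAt_symm (I := 𝓡 n) p).measurable_piecewise
    (continuousOn_const (c := p)) (measurableSet_target p)
  convert (measurableSet_target p).inter (h hs) using 1
  ext y
  simp only [mem_inter_iff, mem_preimage]
  refine and_congr_right fun hy => ?_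
  rw [Set.piecewise_eq_of_mem _ _ _ hy]

theorem chartVolume_apply (g : Metric n M) (p : M) {s : Set M} (hs : MeasurableSet s) :
    chartVolume g p s = ∫⁻ y in (extChartAt (𝓡 n) p).target ∩ (extChartAt (𝓡 n) p).symm ⁻¹' s,
      ENNReal.ofReal (volDensity g p y) := by
  have h1 : chartVolume g p s = ((volume.restrict (extChartAt (𝓡 n) p).target).withDensity
        (fun y => ENNReal.ofReal (volDensity g p y))) ((extChartAt (𝓡 n) p).symm ⁻¹' s) :=
    Measure.map_apply_of_aemeasurable (aemeasurable_chart_symm g p) hs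
  rw [h1, withDensity_apply', Measure.restrict_restrict₀', inter_comm]
  exact (measurableSet_target p).nullMeasurableSet

theorem chartVolume_eq_of_subset (g : Metric n M) {p q : M} {s : Set M} (hs : MeasurableSet s)
    (hp : s ⊆ (extChartAt (𝓡 n) p).source) (hq : s ⊆ (extChartAt (𝓡 n) q).source) :
    chartVolume g p s = chartVolume g q s := by
  rw [chartVolume_apply g p hs, chartVolume_apply g q hs]
  set κ : (𝔼 n) → 𝔼 n := localRep p q (id : M → M) with hκ
  set A := (extChartAt (𝓡 n) p).target ∩ (extChartAt (𝓡 n) p).symm ⁻¹' s with hA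
  have himg : (extChartAt (𝓡 n) q).target ∩ (extChartAt (𝓡 n) q).symm ⁻¹' s = κ '' A := by
    ext z
    constructor
    · rintro ⟨hz, hzs⟩
      refine ⟨extChartAt (𝓡 n) p ((extChartAt (𝓡 n) q).symm z),
        ⟨(extChartAt (𝓡 n) p).map_source (hp hzs), ?_⟩, ?_⟩
      · rw [mem_preimage, (extChartAt (𝓡 n) p).left_inv (hp hzs)]; exact hzs
      · simp only [hκ, localRep, id]
        rw [(extChartAt (𝓡 n) p).left_inv (hp hzs), (extChartAt (𝓡 n) q).right_inv hz]
    · rintro ⟨y, ⟨hy, hys⟩, rfl⟩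
      refine ⟨(extChartAt (𝓡 n) q).map_source (hq hys), ?_⟩
      simp only [hκ, localRep, id, mem_preimage]
      rw [(extChartAt (𝓡 n) q).left_inv (hq hys)]; exact hys
  have hinj : InjOn κ A := by
    rintro y ⟨hy, hys⟩ z ⟨hz, hzs⟩ hyz
    have h1 := (extChartAt (𝓡 n) q).injOn (hq hys) (hq hzs) hyz
    exact (extChartAt (𝓡 n) p).symm.injOn hy hz h1
  have hder : ∀ y ∈ A, HasFDerivWithinAt κ (fderiv ℝ κ y) A y := by
    rintro y ⟨hy, hys⟩
    exact ((contDiffAt_localRep hy contMDiffAt_id (hq hys)).differentiableAt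
      (by simp)).hasFDerivAt.hasFDerivWithinAt
  have hAm : MeasurableSet A := measurableSet_chart_preimage p hs
  rw [himg, lintegral_image_eq_lintegral_abs_det_fderiv_mul volume hAm hder hinj]
  refine setLIntegral_congr_fun hAm fun y hy => ?_
  rw [← ENNReal.ofReal_mul (abs_nonneg _), volDensity_change_chart g hy.1 (hq hy.2)]

theorem chartVolume_inter_source (g : Metric n M) (p : M) {s : Set M} (hs : MeasurableSet s) :
    chartVolume g p (s ∩ (extChartAt (𝓡 n) p).source) = chartVolume g p s := by
  rw [chartVolume_apply g p hs, chartVolume_apply g p (hs.inter (measurableSet_source p))]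
  congr 2
  ext y
  simp only [mem_inter_iff, mem_preimage]
  constructor
  · rintro ⟨h1, h2, _⟩; exact ⟨h1, h2⟩
  · rintro ⟨h1, h2⟩; exact ⟨h1, h2, (extChartAt (𝓡 n) p).map_target h1⟩

/-- A supremum of measures could a priori exceed each of them on `s`. This is excluded by exhibiting
one measure that dominates every chart measure and equals `chartVolume g p` inside the chart domain.
-/
theorem riemannianVolume_apply (g : Metric n M) (p : M) {s : Set M} (hs : MeasurableSet s)
    (hp : s ⊆ (extChartAt (𝓡 n) p).source) : riemannianVolume g s = chartVolume g p s := by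
  refine le_antisymm ?_ (le_iSup (fun p => chartVolume g p) p s)
  set S := (extChartAt (𝓡 n) p).source
  -- Inside the domain all chart measures agree where their domains overlap. Outside it the top
  -- measure dominates anything.
  set ν : Measure M := chartVolume g p + ((⊤ : Measure M).restrict Sᶜ) with hν
  have hle : riemannianVolume g ≤ ν := by
    refine iSup_le fun q => Measure.le_iff.2 fun t ht => ?_
    rw [← measure_inter_add_sdiff t (measurableSet_source (n := n) p)]
    rw [hν, Measure.add_apply]
    gcongr ?_ + ?_
    · have h1 : MeasurableSet (t ∩ S) := ht.inter (measurableSet_source p)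
      rw [← chartVolume_inter_source g q h1, chartVolume_eq_of_subset g (q := p)
        (h1.inter (measurableSet_source q)) inter_subset_right
        (inter_subset_left.trans inter_subset_right)]
      exact measure_mono (inter_subset_left.trans inter_subset_left)
    · rw [Measure.restrict_apply ht, ← sdiff_eq]
      exact le_top (a := chartVolume g q) _
  refine (hle s).trans ?_
  rw [hν, Measure.add_apply, Measure.restrict_apply hs]
  have : s ∩ Sᶜ = ∅ := by
    rw [← sdiff_eq]; exact sdiff_eq_empty.2 hp
  rw [this]; simp

theorem riemannianVolume_restrict_source (g : Metric n M) (p : M) :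
    (riemannianVolume g).restrict (extChartAt (𝓡 n) p).source = chartVolume g p := by
  ext s hs
  rw [Measure.restrict_apply hs, riemannianVolume_apply g p (hs.inter (measurableSet_source p))
    inter_subset_right, chartVolume_inter_source g p hs]

theorem integral_riemannianVolume_eq (g : Metric n M) (p : M) {w : M → ℝ}
    (hw : ContinuousOn w (extChartAt (𝓡 n) p).source)
    (h0 : ∀ x ∉ (extChartAt (𝓡 n) p).source, w x = 0) :
    ∫ x, w x ∂(riemannianVolume g) =
      ∫ y in (extChartAt (𝓡 n) p).target, volDensity g p y * w ((extChartAt (𝓡 n) p).symm y) := by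
  rw [← setIntegral_eq_integral_of_forall_compl_eq_zero h0]
  have hm := hw.aestronglyMeasurable (μ := riemannianVolume g) (measurableSet_source p)
  rw [riemannianVolume_restrict_source] at hm ⊢
  have h1 : ∫ x, w x ∂(chartVolume g p) = ∫ y, w ((extChartAt (𝓡 n) p).symm y)
      ∂((volume.restrict (extChartAt (𝓡 n) p).target).withDensity
        (fun y => ENNReal.ofReal (volDensity g p y))) :=
    integral_map (aemeasurable_chart_symm g p) hm
  rw [h1, integral_withDensity_eq_integral_toReal_smul₀]
  · refine setIntegral_congr_fun (measurableSet_target p) fun y hy => ?_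
    rw [ENNReal.toReal_ofReal (volDensity_pos g p hy).le, smul_eq_mul]
  · exact ((continuousOn_volDensity g p).aemeasurable (measurableSet_target p)).ennreal_ofReal
  · simp

/-- The density is bounded on a compact neighbourhood in the chart. On compact `M` this makes
continuous functions integrable. -/
instance isLocallyFiniteMeasure_riemannianVolume (g : Metric n M) :
    IsLocallyFiniteMeasure (riemannianVolume g) := by
  refine ⟨fun x => ?_⟩
  have hT := (isOpen_extChartAt_target (I := 𝓡 n) x).mem_nhds (mem_extChartAt_target (I := 𝓡 n) x)
  obtain ⟨C, hCn, hCT, hC⟩ := LocallyCompactSpace.local_compact_nhds _ _ hT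
  set U := (extChartAt (𝓡 n) x).source ∩ (extChartAt (𝓡 n) x) ⁻¹' (interior C)
  have hU : IsOpen U :=
    (continuousOn_extChartAt x).isOpen_inter_preimage (isOpen_extChartAt_source x) isOpen_interior
  refine ⟨U, hU.mem_nhds ⟨mem_extChartAt_source x, mem_interior_iff_mem_nhds.2 hCn⟩, ?_⟩
  rw [riemannianVolume_apply g x hU.measurableSet inter_subset_left,
    chartVolume_apply g x hU.measurableSet]
  obtain ⟨B, hB⟩ := hC.exists_bound_of_continuousOn ((continuousOn_volDensity g x).mono hCT)
  calc ∫⁻ y in (extChartAt (𝓡 n) x).target ∩ (extChartAt (𝓡 n) x).symm ⁻¹' U,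
        ENNReal.ofReal (volDensity g x y)
      ≤ ∫⁻ y in C, ENNReal.ofReal (volDensity g x y) := by
        refine lintegral_mono_set ?_
        rintro y ⟨hy, hyU⟩
        have := hyU.2
        rw [mem_preimage, (extChartAt (𝓡 n) x).right_inv hy] at this
        exact interior_subset this
    _ ≤ ∫⁻ _ in C, ENNReal.ofReal B := by
        refine setLIntegral_mono' hC.measurableSet fun y hy => ?_
        exact ENNReal.ofReal_le_ofReal ((le_abs_self _).trans (hB y hy))
    _ < ⊤ := by
        rw [setLIntegral_const]
        exact ENNReal.mul_lt_top ENNReal.ofReal_lt_top hC.measure_lt_top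

/-- The density is positive and Lebesgue measure charges nonempty open sets. This is what upgrades
vanishing almost everywhere to vanishing everywhere for continuous functions. -/
instance isOpenPosMeasure_riemannianVolume (g : Metric n M) :
    (riemannianVolume g).IsOpenPosMeasure := by
  refine ⟨fun U hU hne h0 => ?_⟩
  obtain ⟨x, hx⟩ := hne
  set V := U ∩ (extChartAt (𝓡 n) x).source
  have hV : IsOpen V := hU.inter (isOpen_extChartAt_source x)
  have h1 : riemannianVolume g V = 0 := measure_mono_null inter_subset_left h0
  rw [riemannianVolume_apply g x hV.measurableSet inter_subset_right,
    chartVolume_apply g x hV.measurableSet] at h1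
  set W := (extChartAt (𝓡 n) x).target ∩ (extChartAt (𝓡 n) x).symm ⁻¹' V with hW
  have hWo : IsOpen W := (continuousOn_extChartAt_symm x).isOpen_inter_preimage
    (isOpen_extChartAt_target x) hV
  have hWne : W.Nonempty := ⟨extChartAt (𝓡 n) x x, mem_extChartAt_target x, by
    rw [mem_preimage, extChartAt_to_inv]; exact ⟨hx, mem_extChartAt_source x⟩⟩
  have hWpos := hWo.measure_pos volume hWne
  have hm : AEMeasurable (fun y => ENNReal.ofReal (volDensity g x y)) (volume.restrict W) :=
    (((continuousOn_volDensity g x).mono inter_subset_left).aemeasurable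
      hWo.measurableSet).ennreal_ofReal
  rw [lintegral_eq_zero_iff' hm, Filter.EventuallyEq, ae_restrict_iff' hWo.measurableSet] at h1
  refine hWpos.ne' (measure_mono_null ?_ h1)
  intro y hy
  simp only [mem_compl_iff, mem_ofPred_eq, Pi.zero_apply, ENNReal.ofReal_eq_zero, not_forall, not_le]
  exact ⟨hy, volDensity_pos g x hy.1⟩

end Volume

/-! ### Index algebra behind the first variation formula -/

section VariationAlgebra

variable {n m : ℕ}

/-- The contracted Christoffel symbols as a divergence of the densitized inverse metric. -/
theorem sum_density_algebra (Gi : Fin n → Fin n → ℝ) (dG : Fin n → Fin n → Fin n → ℝ)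
    (hGi : ∀ i j, Gi i j = Gi j i) (hdG : ∀ k i j, dG k i j = dG k j i) (i : Fin n) :
    ∑ j, ((1 / 2 * ∑ k, ∑ l, Gi k l * dG j l k) * Gi i j
      + -∑ r, ∑ s, Gi i r * dG j r s * Gi s j) =
    -∑ k, ∑ l, Gi k l * (1 / 2 * ∑ r, Gi i r * (dG k l r + dG l k r - dG r k l)) := by
  set Z : ℝ := ∑ r, ∑ k, ∑ l, Gi i r * Gi k l * dG r k l with hZ
  set Y : ℝ := ∑ r, ∑ k, ∑ l, Gi i r * Gi k l * dG k l r with hY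
  have h1 : ∑ j, (1 / 2 * ∑ k, ∑ l, Gi k l * dG j l k) * Gi i j = 1 / 2 * Z := by
    rw [hZ, Finset.mul_sum]
    refine Finset.sum_congr rfl fun j _ => ?_
    simp only [Finset.mul_sum, Finset.sum_mul]
    refine Finset.sum_congr rfl fun k _ => Finset.sum_congr rfl fun l _ => ?_
    rw [hdG j l k]; ring
  have h2 : ∑ j, ∑ r, ∑ s, Gi i r * dG j r s * Gi s j = Y := by
    rw [hY, Finset.sum_comm]
    refine Finset.sum_congr rfl fun r _ => Finset.sum_congr rfl fun j _ =>
      Finset.sum_congr rfl fun s _ => ?_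
    rw [hdG j r s, hGi s j]; ring
  have h3 : ∑ k, ∑ l, Gi k l * (1 / 2 * ∑ r, Gi i r * (dG k l r + dG l k r - dG r k l)) =
      1 / 2 * (∑ r, ∑ k, ∑ l, Gi i r * Gi k l * (dG k l r + dG l k r - dG r k l)) := by
    simp only [Finset.mul_sum]
    rw [Finset.sum_congr rfl fun k _ => Finset.sum_comm, Finset.sum_comm]
    refine Finset.sum_congr rfl fun r _ => Finset.sum_congr rfl fun k _ =>
      Finset.sum_congr rfl fun l _ => by ring
  have h4 : ∑ r, ∑ k, ∑ l, Gi i r * Gi k l * dG l k r = Y := by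
    rw [hY]
    refine Finset.sum_congr rfl fun r _ => ?_
    rw [Finset.sum_comm]
    refine Finset.sum_congr rfl fun k _ => Finset.sum_congr rfl fun l _ => ?_
    rw [hGi l k]
  rw [Finset.sum_add_distrib, Finset.sum_neg_distrib, h1, h2, h3]
  simp only [mul_add, mul_sub, Finset.sum_add_distrib, Finset.sum_sub_distrib, h4]
  rw [← hZ, ← hY]
  ring

/-- The algebraic content of the first variation formula. -/
theorem first_variation_algebra (Gi : Fin n → Fin n → ℝ) (H : Fin m → Fin m → ℝ)
    (dH : Fin m → Fin m → Fin m → ℝ) (u1 : Fin n → Fin m → ℝ) (u2 : Fin n → Fin n → Fin m → ℝ)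
    (Γ : Fin n → Fin n → Fin n → ℝ) (V : Fin m → ℝ) (V1 : Fin n → Fin m → ℝ)
    (hGi : ∀ i j, Gi i j = Gi j i) (hH : ∀ a b, H a b = H b a)
    (hu2 : ∀ i j, u2 i j = u2 j i) :
    1 / 2 * ∑ i, ∑ j, Gi i j * ∑ a, ∑ b, ((∑ c, dH c a b * V c) * u1 i a * u1 j b
      + H a b * V1 i a * u1 j b + H a b * u1 i a * V1 j b) =
    ∑ i, ((-∑ k, ∑ l, Gi k l * Γ i k l) * ∑ a, ∑ b, H a b * u1 i a * V b
      + ∑ j, Gi i j * ∑ a, ∑ b, ((∑ c, dH c a b * u1 j c) * u1 i a * V b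
        + H a b * u2 j i a * V b + H a b * u1 i a * V1 j b))
    - ∑ d, (∑ i, ∑ j, Gi i j * (∑ a, H a d * u2 i j a - ∑ k, Γ k i j * ∑ a, H a d * u1 k a
      + ∑ b, ∑ c, (dH b c d - 1 / 2 * dH d b c) * u1 i b * u1 j c)) * V d := by
  -- `A` collects the terms where the variation moves the target metric, `B` the derivative of the
  -- variation field, `T` and `S` the derivatives of target metric and map in the divergence, and
  -- `W` is the covector `h(V, f_* ·)`.
  set A : Fin n → Fin n → ℝ := fun i j => ∑ a, ∑ b, (∑ c, dH c a b * V c) * u1 i a * u1 j b with hA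
  set B : Fin n → Fin n → ℝ := fun i j => ∑ a, ∑ b, H a b * u1 i a * V1 j b with hB
  set T : Fin n → Fin n → ℝ := fun j i => ∑ a, ∑ b, (∑ c, dH c a b * u1 j c) * u1 i a * V b with hT
  set S : Fin n → Fin n → ℝ := fun i j => ∑ a, ∑ b, H a b * u2 i j a * V b with hS
  set W : Fin n → ℝ := fun i => ∑ a, ∑ b, H a b * u1 i a * V b with hW
  have sw : ∀ X : Fin n → Fin n → ℝ, ∑ i, ∑ j, Gi i j * X i j = ∑ i, ∑ j, Gi i j * X j i := by
    intro X
    rw [Finset.sum_comm]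
    refine Finset.sum_congr rfl fun i _ => Finset.sum_congr rfl fun j _ => by rw [hGi j i]
  have hB' : ∀ i j, ∑ a, ∑ b, H a b * V1 i a * u1 j b = B j i := by
    intro i j
    rw [hB, Finset.sum_comm]
    refine Finset.sum_congr rfl fun a _ => Finset.sum_congr rfl fun b _ => ?_
    rw [hH b a]; ring
  have hl : ∀ i j, ∑ a, ∑ b, ((∑ c, dH c a b * V c) * u1 i a * u1 j b
      + H a b * V1 i a * u1 j b + H a b * u1 i a * V1 j b) = A i j + B j i + B i j := by
    intro i j
    simp only [Finset.sum_add_distrib]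
    rw [hB' i j]
  have hm : ∀ i j, ∑ a, ∑ b, ((∑ c, dH c a b * u1 j c) * u1 i a * V b
        + H a b * u2 j i a * V b + H a b * u1 i a * V1 j b) = T j i + S i j + B i j := by
    intro i j
    simp only [Finset.sum_add_distrib, hS, hu2 i j]
    rfl
  have hr : ∑ d, (∑ i, ∑ j, Gi i j * (∑ a, H a d * u2 i j a - ∑ k, Γ k i j * ∑ a, H a d * u1 k a
      + ∑ b, ∑ c, (dH b c d - 1 / 2 * dH d b c) * u1 i b * u1 j c)) * V d =
      ∑ i, ∑ j, Gi i j * (S i j - ∑ k, Γ k i j * W k + (T i j - 1 / 2 * A i j)) := by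
    simp only [Finset.sum_mul (s := Finset.univ (α := Fin n))]
    rw [Finset.sum_comm]
    refine Finset.sum_congr rfl fun i _ => ?_
    rw [Finset.sum_comm]
    refine Finset.sum_congr rfl fun j _ => ?_
    simp only [mul_assoc (Gi i j)]
    rw [← Finset.mul_sum]
    congr 1
    simp only [add_mul, sub_mul, Finset.sum_add_distrib, Finset.sum_sub_distrib]
    congr 1
    · congr 1
      · simp only [hS, Finset.sum_mul]
        exact Finset.sum_comm
      · simp only [hW, Finset.sum_mul, Finset.mul_sum]
        rw [Finset.sum_comm]
        refine Finset.sum_congr rfl fun l _ => ?_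
        rw [Finset.sum_comm]
        refine Finset.sum_congr rfl fun a _ => Finset.sum_congr rfl fun b _ => ?_
        ring
    · congr 1
      · simp only [hT, Finset.sum_mul]
        rw [Finset.sum_congr rfl fun d _ => Finset.sum_comm, Finset.sum_comm]
      · simp only [hA, Finset.sum_mul, Finset.mul_sum]
        rw [Finset.sum_comm]
        refine Finset.sum_congr rfl fun a _ => ?_
        rw [Finset.sum_comm]
        refine Finset.sum_congr rfl fun b _ => Finset.sum_congr rfl fun c _ => ?_
        ring
  have hΓ : ∑ i, (-∑ k, ∑ l, Gi k l * Γ i k l) * W i = -∑ i, ∑ j, Gi i j * ∑ k, Γ k i j * W k := by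
    simp only [neg_mul, Finset.sum_neg_distrib, Finset.sum_mul, Finset.mul_sum]
    congr 1
    rw [Finset.sum_comm]
    refine Finset.sum_congr rfl fun i _ => ?_
    rw [Finset.sum_comm]
    refine Finset.sum_congr rfl fun a _ => Finset.sum_congr rfl fun b _ => by ring
  have hWi : ∀ i, ∑ a, ∑ b, H a b * u1 i a * V b = W i := fun _ => rfl
  simp only [hl, hm, hr, hWi]
  rw [Finset.sum_add_distrib, hΓ]
  simp only [mul_add, mul_sub, Finset.sum_add_distrib, Finset.sum_sub_distrib]
  rw [sw fun i j => B j i, sw fun i j => T j i]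
  have : ∀ k i, Gi k i * (1 / 2 * A k i) = 1 / 2 * (Gi k i * A k i) := fun k i => by ring
  simp only [this, ← Finset.mul_sum]
  ring

end VariationAlgebra

/-! ### Pointwise first variation as a divergence -/

section LocalVariation

set_option linter.unusedSectionVars false

variable {n m : ℕ} {M : Type*} [TopologicalSpace M] [ChartedSpace (EuclideanSpace ℝ (Fin n)) M]
  [IsManifold (𝓡 n) ∞ M]
  {N : Type*} [TopologicalSpace N] [ChartedSpace (EuclideanSpace ℝ (Fin m)) N]
  [IsManifold (𝓡 m) ∞ N]

/-- The derivative of the energy density along a variation, in terms of the coordinate expressions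
`u` of the map and `V` of the variation field. -/
def energyVariation (g : Metric n M) (h : Metric m N) (p : M) (q : N) (u V : (𝔼 n) → 𝔼 m)
    (y : 𝔼 n) : ℝ :=
  ∑ i, ∑ j, invCoeff g p y i j * ∑ a, ∑ b,
    ((∑ c, pd c (fun z => coeff (metricTensor h) q z a b) (u y) * V y c) *
        pd i (fun z => u z a) y * pd j (fun z => u z b) y
      + coeff (metricTensor h) q (u y) a b * pd i (fun z => V z a) y * pd j (fun z => u z b) y
      + coeff (metricTensor h) q (u y) a b * pd i (fun z => u z a) y * pd j (fun z => V z b) y)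

/-- The vector field dual to `h(V, f_* ·)`, multiplied by the volume density. -/
def fluxCoord (g : Metric n M) (h : Metric m N) (p : M) (q : N) (u V : (𝔼 n) → 𝔼 m)
    (j : Fin n) (y : 𝔼 n) : ℝ :=
  ∑ i, volDensity g p y * invCoeff g p y i j * ∑ a, ∑ b, coeff (metricTensor h) q (u y) a b *
    pd i (fun z => u z a) y * V y b

/-- Jacobi's formula for the determinant, combined with the derivative of the square root. -/
theorem pd_volDensity (g : Metric n M) (p : M) {y : 𝔼 n} (hy : y ∈ (extChartAt (𝓡 n) p).target)
    (j : Fin n) :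
    pd j (volDensity g p) y = volDensity g p y * (1 / 2 * ∑ k, ∑ l, invCoeff g p y k l *
      pd j (fun z => coeff (metricTensor g) p z l k) y) := by
  have hpos := coeff_metric_det_pos g p hy
  have hd : ∀ i j, DifferentiableAt ℝ (fun z => coeff (metricTensor g) p z i j) y :=
    fun i j => (contDiffAt_coeff_metric g p hy i j).differentiableAt (by simp)
  have hdet : DifferentiableAt ℝ (fun z => (coeff (metricTensor g) p z).det) y :=
    (contDiffAt_det (contDiffAt_coeff_metric g p hy)).differentiableAt (by simp)
  have h1 := fderiv_det_apply hd hpos.ne' (EuclideanSpace.single j 1)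
  have h2 : fderiv ℝ (volDensity g p) y = (1 / (2 * volDensity g p y)) •
      fderiv ℝ (fun z => (coeff (metricTensor g) p z).det) y :=
    (hdet.hasFDerivAt.sqrt hpos.ne').fderiv
  have hv := volDensity_pos g p hy
  have hsq : (coeff (metricTensor g) p y).det = volDensity g p y * volDensity g p y :=
    (Real.mul_self_sqrt hpos.le).symm
  rw [pd, h2, smul_apply, h1, hsq, smul_eq_mul]
  simp only [pd, invCoeff]
  field_simp

theorem contDiffAt_flux_summand (h : Metric m N) {q : N} {u V : (𝔼 n) → 𝔼 m} {y : 𝔼 n}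
    (hu : ContDiffAt ℝ ∞ u y) (hV : ContDiffAt ℝ ∞ V y)
    (hq : u y ∈ (extChartAt (𝓡 m) q).target) (i : Fin n) :
    ContDiffAt ℝ ∞ (fun z => ∑ a, ∑ b, coeff (metricTensor h) q (u z) a b *
      pd i (fun z => u z a) z * V z b) y :=
  ContDiffAt.sum fun a _ => ContDiffAt.sum fun b _ =>
    (((contDiffAt_coeff_metric h q hq a b).comp y hu).mul
      (contDiffAt_pd (contDiffAt_coord hu a) i)).mul (contDiffAt_coord hV b)

theorem contDiffAt_fluxCoord (g : Metric n M) (h : Metric m N) {p : M} {q : N}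
    {u V : (𝔼 n) → 𝔼 m} {y : 𝔼 n} (hy : y ∈ (extChartAt (𝓡 n) p).target)
    (hu : ContDiffAt ℝ ∞ u y) (hV : ContDiffAt ℝ ∞ V y)
    (hq : u y ∈ (extChartAt (𝓡 m) q).target) (j : Fin n) :
    ContDiffAt ℝ ∞ (fluxCoord g h p q u V j) y :=
  ContDiffAt.sum fun i _ => ((contDiffAt_volDensity g p hy).mul
    (contDiffAt_invCoeff g p hy i j)).mul (contDiffAt_flux_summand h hu hV hq i)

theorem pd_flux_summand (h : Metric m N) {q : N} {u V : (𝔼 n) → 𝔼 m} {y : 𝔼 n}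
    (hu : ContDiffAt ℝ ∞ u y) (hV : ContDiffAt ℝ ∞ V y)
    (hq : u y ∈ (extChartAt (𝓡 m) q).target) (j i : Fin n) :
    pd j (fun z => ∑ a, ∑ b, coeff (metricTensor h) q (u z) a b *
      pd i (fun z => u z a) z * V z b) y =
    ∑ a, ∑ b, ((∑ c, pd c (fun z => coeff (metricTensor h) q z a b) (u y) *
        pd j (fun z => u z c) y) * pd i (fun z => u z a) y * V y b
      + coeff (metricTensor h) q (u y) a b * pd j (pd i (fun z => u z a)) y * V y b
      + coeff (metricTensor h) q (u y) a b * pd i (fun z => u z a) y *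
        pd j (fun z => V z b) y) := by
  have hH : ∀ a b, DifferentiableAt ℝ (fun z => coeff (metricTensor h) q z a b) (u y) :=
    fun a b => (contDiffAt_coeff_metric h q hq a b).differentiableAt (by simp)
  have hud : DifferentiableAt ℝ u y := hu.differentiableAt (by simp)
  have hHu : ∀ a b, DifferentiableAt ℝ (fun z => coeff (metricTensor h) q (u z) a b) y :=
    fun a b => (hH a b).comp y hud
  have hp : ∀ i a, DifferentiableAt ℝ (pd i (fun z => u z a)) y :=
    fun i a => (contDiffAt_pd (contDiffAt_coord hu a) i).differentiableAt (by simp)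
  have hVd : ∀ b, DifferentiableAt ℝ (fun z => V z b) y :=
    fun b => (contDiffAt_coord hV b).differentiableAt (by simp)
  have h1 : ∀ a b, DifferentiableAt ℝ (fun z => coeff (metricTensor h) q (u z) a b *
      pd i (fun z => u z a) z) y := fun a b => (hHu a b).fun_mul (hp i a)
  rw [pd_sum _ _ fun a _ => DifferentiableAt.fun_sum fun b _ => (h1 a b).fun_mul (hVd b)]
  refine Finset.sum_congr rfl fun a _ => ?_
  rw [pd_sum _ _ fun b _ => (h1 a b).fun_mul (hVd b)]
  refine Finset.sum_congr rfl fun b _ => ?_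
  rw [pd_mul j (h1 a b) (hVd b), pd_mul j (hHu a b) (hp i a), pd_comp j (hH a b) hud]
  ring

/-- The first variation of the energy density is a divergence minus the pairing of the variation
field with the tension field. -/
theorem volDensity_mul_energyVariation (g : Metric n M) (h : Metric m N) {p : M} {q : N}
    {u V : (𝔼 n) → 𝔼 m} {y : 𝔼 n} (hy : y ∈ (extChartAt (𝓡 n) p).target)
    (hu : ContDiffAt ℝ ∞ u y) (hV : ContDiffAt ℝ ∞ V y)
    (hq : u y ∈ (extChartAt (𝓡 m) q).target) :
    volDensity g p y * (1 / 2 * energyVariation g h p q u V y) =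
      ∑ j, pd j (fluxCoord g h p q u V j) y
        - volDensity g p y * ∑ d, tensionLower g h p q u y d * V y d := by
  have hvol : DifferentiableAt ℝ (volDensity g p) y :=
    (contDiffAt_volDensity g p hy).differentiableAt (by simp)
  have hG : ∀ i j, DifferentiableAt ℝ (fun z => invCoeff g p z i j) y := fun i j =>
    (contDiffAt_invCoeff g p hy i j).differentiableAt (by simp)
  have hW : ∀ i, DifferentiableAt ℝ (fun z => ∑ a, ∑ b, coeff (metricTensor h) q (u z) a b *
      pd i (fun z => u z a) z * V z b) y := fun i =>
    (contDiffAt_flux_summand h hu hV hq i).differentiableAt (by simp)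
  have hdens := fun i => sum_density_algebra (invCoeff g p y)
    (fun k i j => pd k (fun z => coeff (metricTensor g) p z i j) y) (invCoeff_symm g p y)
    (fun k i j => by simp only [coeff_metric_symm g p _ i j]) i
  -- Differentiating the densitized inverse metric produces the contracted Christoffel symbols, by
  -- `sum_density_algebra`. This is why the coordinate divergence involves the same `Γ` as the
  -- tension field.
  have hflux : ∑ j, pd j (fluxCoord g h p q u V j) y = volDensity g p y * ∑ i,
      ((-∑ k, ∑ l, invCoeff g p y k l * christoffel g p i k l y) *
        (∑ a, ∑ b, coeff (metricTensor h) q (u y) a b * pd i (fun z => u z a) y * V y b)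
      + ∑ j, invCoeff g p y i j * pd j (fun z => ∑ a, ∑ b, coeff (metricTensor h) q (u z) a b *
      pd i (fun z => u z a) z * V z b) y) := by
    have h1 : ∀ j, pd j (fluxCoord g h p q u V j) y = ∑ i, volDensity g p y *
        (((1 / 2 * ∑ k, ∑ l, invCoeff g p y k l *
          pd j (fun z => coeff (metricTensor g) p z l k) y) * invCoeff g p y i j
        + -∑ r, ∑ s, invCoeff g p y i r *
          pd j (fun z => coeff (metricTensor g) p z r s) y * invCoeff g p y s j) *
        (∑ a, ∑ b, coeff (metricTensor h) q (u y) a b * pd i (fun z => u z a) y * V y b)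
        + invCoeff g p y i j * pd j (fun z => ∑ a, ∑ b, coeff (metricTensor h) q (u z) a b *
          pd i (fun z => u z a) z * V z b) y) := by
      intro j
      have hfl : fluxCoord g h p q u V j = fun z => ∑ i, volDensity g p z * invCoeff g p z i j *
        ∑ a, ∑ b, coeff (metricTensor h) q (u z) a b * pd i (fun z => u z a) z * V z b := rfl
      rw [hfl, pd_sum _ _ fun i _ => (hvol.fun_mul (hG i j)).fun_mul (hW i)]
      refine Finset.sum_congr rfl fun i _ => ?_
      rw [pd_mul j (hvol.fun_mul (hG i j)) (hW i), pd_mul j hvol (hG i j), pd_volDensity g p hy,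
        pd_invCoeff g p hy]
      ring
    simp only [h1]
    rw [Finset.sum_comm, Finset.mul_sum]
    refine Finset.sum_congr rfl fun i _ => ?_
    rw [← Finset.mul_sum, Finset.sum_add_distrib, ← Finset.sum_mul]
    congr 3
    exact hdens i
  have halg := first_variation_algebra (invCoeff g p y) (coeff (metricTensor h) q (u y))
    (fun c a b => pd c (fun z => coeff (metricTensor h) q z a b) (u y))
    (fun i a => pd i (fun z => u z a) y) (fun i j a => pd i (pd j (fun z => u z a)) y)
    (fun k i j => christoffel g p k i j y) (fun a => V y a) (fun i a => pd i (fun z => V z a) y)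
    (invCoeff_symm g p y) (coeff_metric_symm h q (u y))
    (fun i j => funext fun a => pd_comm (contDiffAt_coord hu a) i j)
  rw [hflux, ← mul_sub]
  congr 1
  simp only [pd_flux_summand h hu hV hq, tensionLower_eq g h p q u y hq]
  exact halg

theorem contDiffAt_christoffel (g : Metric n M) (p : M) {y : 𝔼 n}
    (hy : y ∈ (extChartAt (𝓡 n) p).target) (k i j : Fin n) :
    ContDiffAt ℝ ∞ (christoffel g p k i j) y := by
  have hc := fun i j => contDiffAt_coeff_metric g p hy i j
  exact contDiffAt_const.mul (ContDiffAt.sum fun l _ => (contDiffAt_invCoeff g p hy k l).mul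
    (((contDiffAt_pd (hc j l) i).add (contDiffAt_pd (hc i l) j)).sub (contDiffAt_pd (hc i j) l)))

theorem contDiffAt_tensionLower (g : Metric n M) (h : Metric m N) {p : M} {q : N}
    {u : (𝔼 n) → 𝔼 m} {y : 𝔼 n} (hy : y ∈ (extChartAt (𝓡 n) p).target)
    (hu : ContDiffAt ℝ ∞ u y) (hq : u y ∈ (extChartAt (𝓡 m) q).target) (d : Fin m) :
    ContDiffAt ℝ ∞ (fun y => tensionLower g h p q u y d) y := by
  have hua := fun a => contDiffAt_coord hu a
  refine ContDiffAt.sum fun a _ => ((contDiffAt_coeff_metric h q hq a d).comp y hu).mul ?_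
  refine ContDiffAt.sum fun i _ => ContDiffAt.sum fun j _ =>
    (contDiffAt_invCoeff g p hy i j).mul ?_
  refine ContDiffAt.add (ContDiffAt.sub (contDiffAt_pd (contDiffAt_pd (hua a) j) i) ?_) ?_
  · exact ContDiffAt.sum fun k _ =>
      (contDiffAt_christoffel g p hy k i j).mul (contDiffAt_pd (hua a) k)
  · exact ContDiffAt.sum fun b _ => ContDiffAt.sum fun c _ =>
      (((contDiffAt_christoffel h q hq a b c).comp y hu).mul (contDiffAt_pd (hua b) i)).mul
        (contDiffAt_pd (hua c) j)

end LocalVariation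

/-! ### Functions of time and position -/

section Slices

variable {n m : ℕ}

theorem pd_slice {Φ : ℝ × (𝔼 n) → ℝ} {t : ℝ} {y : 𝔼 n} (h : DifferentiableAt ℝ Φ (t, y))
    (i : Fin n) :
    pd i (fun z => Φ (t, z)) y = fderiv ℝ Φ (t, y) (0, EuclideanSpace.single i 1) := by
  have h1 : HasFDerivAt (fun z => Φ (t, z))
      ((fderiv ℝ Φ (t, y)).comp (ContinuousLinearMap.inr ℝ ℝ (𝔼 n))) y :=
    h.hasFDerivAt.comp y (hasFDerivAt_prodMk_right t y)
  rw [pd, h1.fderiv]; rfl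

theorem hasDerivAt_slice {E : Type*} [NormedAddCommGroup E] [NormedSpace ℝ E]
    {Φ : ℝ × (𝔼 n) → E} {t : ℝ} {y : 𝔼 n}
    (h : DifferentiableAt ℝ Φ (t, y)) :
    HasDerivAt (fun s => Φ (s, y)) (fderiv ℝ Φ (t, y) (1, 0)) t := by
  have h1 : HasFDerivAt (fun s => Φ (s, y))
      ((fderiv ℝ Φ (t, y)).comp (ContinuousLinearMap.inl ℝ ℝ (𝔼 n))) t :=
    h.hasFDerivAt.comp t (hasFDerivAt_prodMk_left t y)
  exact h1.hasDerivAt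

theorem eventually_differentiableAt {E F : Type*} [NormedAddCommGroup E] [NormedSpace ℝ E]
    [NormedAddCommGroup F] [NormedSpace ℝ F] {Φ : E → F} {w : E} (h : ContDiffAt ℝ ∞ Φ w) :
    ∀ᶠ w' in 𝓝 w, DifferentiableAt ℝ Φ w' := by
  have h1 : ContDiffAt ℝ 1 Φ w := h.of_le (by simp)
  filter_upwards [h1.eventually (by simp)] with w' hw'
  exact hw'.differentiableAt one_ne_zero

theorem contDiffAt_pd_slice {Φ : ℝ × (𝔼 n) → ℝ} {w : ℝ × (𝔼 n)} (h : ContDiffAt ℝ ∞ Φ w)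
    (i : Fin n) : ContDiffAt ℝ ∞ (fun w : ℝ × (𝔼 n) => pd i (fun z => Φ (w.1, z)) w.2) w := by
  have h1 : ContDiffAt ℝ ∞ (fun w => fderiv ℝ Φ w (0, EuclideanSpace.single i 1)) w :=
    (h.fderiv_right (m := ∞) (by simp)).clm_apply contDiffAt_const
  refine h1.congr_of_eventuallyEq ?_
  filter_upwards [eventually_differentiableAt h] with w' hw'
  exact pd_slice hw' i

/-- Exchange of time and space derivatives, from symmetry of the second derivative of `Φ` in the
directions `(1, 0)` and `(0, eᵢ)`. -/
theorem hasDerivAt_pd_slice {Φ : ℝ × (𝔼 n) → ℝ} {t : ℝ} {y : 𝔼 n}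
    (h : ContDiffAt ℝ ∞ Φ (t, y)) (i : Fin n) :
    HasDerivAt (fun s => pd i (fun z => Φ (s, z)) y)
      (pd i (fun z => deriv (fun s => Φ (s, z)) t) y) t := by
  have hd : DifferentiableAt ℝ (fderiv ℝ Φ) (t, y) :=
    (h.fderiv_right (m := ∞) (by simp)).differentiableAt (by simp)
  have hev := eventually_differentiableAt h
  have hsym := (h.isSymmSndFDerivAt
    (by simpa using WithTop.coe_le_coe.2 (le_top : (2 : ℕ∞) ≤ ⊤))).eq
    (1, 0) (0, EuclideanSpace.single i (1 : ℝ))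
  have happ : ∀ v v' : ℝ × (𝔼 n), fderiv ℝ (fun w => fderiv ℝ Φ w v') (t, y) v =
      fderiv ℝ (fderiv ℝ Φ) (t, y) v v' := by
    intro v v'
    rw [fderiv_clm_apply hd (differentiableAt_const _)]
    simp
  have hda : ∀ v' : ℝ × (𝔼 n), DifferentiableAt ℝ (fun w => fderiv ℝ Φ w v') (t, y) :=
    fun v' => hd.clm_apply (differentiableAt_const _)
  have h1 : HasDerivAt (fun s => fderiv ℝ Φ (s, y) (0, EuclideanSpace.single i 1))
      (fderiv ℝ (fderiv ℝ Φ) (t, y) (1, 0) (0, EuclideanSpace.single i 1)) t := by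
    rw [← happ]
    exact hasDerivAt_slice (hda _)
  have h2 : pd i (fun z => deriv (fun s => Φ (s, z)) t) y =
      fderiv ℝ (fderiv ℝ Φ) (t, y) (0, EuclideanSpace.single i 1) (1, 0) := by
    have he : (fun z => deriv (fun s => Φ (s, z)) t) =ᶠ[𝓝 y] fun z => fderiv ℝ Φ (t, z) (1, 0) := by
      have hc : ContinuousAt (fun z : 𝔼 n => (t, z)) y := by fun_prop
      filter_upwards [hc.eventually hev] with z hz
      exact (hasDerivAt_slice hz).deriv
    rw [pd_congr he i, ← happ]
    exact pd_slice (hda _) i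
  rw [h2, ← hsym]
  refine h1.congr_of_eventuallyEq ?_
  have hc : ContinuousAt (fun s : ℝ => (s, y)) t := by fun_prop
  filter_upwards [hc.eventually hev] with s hs
  exact pd_slice hs i

/-- The velocity at time `0` of a family of maps. -/
def velocity (U : ℝ → (𝔼 n) → 𝔼 m) (z : 𝔼 n) : 𝔼 m := deriv (fun s => U s z) 0

theorem contDiffAt_velocity {U : ℝ → (𝔼 n) → 𝔼 m} {y : 𝔼 n}
    (h : ContDiffAt ℝ ∞ (fun w : ℝ × (𝔼 n) => U w.1 w.2) (0, y)) :
    ContDiffAt ℝ ∞ (velocity U) y := by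
  have h1 : ContDiffAt ℝ ∞ (fun z : 𝔼 n =>
      fderiv ℝ (fun w : ℝ × (𝔼 n) => U w.1 w.2) (0, z) (1, 0)) y := by
    have h2 : ContDiffAt ℝ ∞ (fun z : 𝔼 n => ((0 : ℝ), z)) y :=
      contDiffAt_const.prodMk contDiffAt_id
    have h3 := (h.fderiv_right (m := ∞) (by simp)).comp y h2
    exact h3.clm_apply contDiffAt_const
  refine h1.congr_of_eventuallyEq ?_
  have hc : ContinuousAt (fun z : 𝔼 n => ((0 : ℝ), z)) y := by fun_prop
  filter_upwards [hc.eventually (eventually_differentiableAt h)] with z hz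
  exact (hasDerivAt_slice hz).deriv

theorem velocity_apply {U : ℝ → (𝔼 n) → 𝔼 m} {y : 𝔼 n}
    (h : DifferentiableAt ℝ (fun w : ℝ × (𝔼 n) => U w.1 w.2) (0, y)) (a : Fin m) :
    velocity U y a = deriv (fun s => U s y a) 0 := by
  have h1 := hasDerivAt_slice h
  have h2 : HasDerivAt (fun s => U s y a) ((fderiv ℝ (fun w : ℝ × (𝔼 n) => U w.1 w.2) (0, y)
      (1, 0)) a) 0 :=
    (EuclideanSpace.proj a : (𝔼 m) →L[ℝ] ℝ).hasFDerivAt.comp_hasDerivAt 0 h1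
  rw [h2.deriv, velocity, h1.deriv]

end Slices

/-! ### Smooth families of maps and their energy density -/

section Variations

set_option linter.unusedSectionVars false

variable {n m : ℕ} {M : Type*} [TopologicalSpace M] [ChartedSpace (EuclideanSpace ℝ (Fin n)) M]
  [IsManifold (𝓡 n) ∞ M]
  {N : Type*} [TopologicalSpace N] [ChartedSpace (EuclideanSpace ℝ (Fin m)) N]
  [IsManifold (𝓡 m) ∞ N]

/-- The energy density of a map with coordinate expression `u`. -/
def energyCoord (g : Metric n M) (h : Metric m N) (p : M) (q : N) (u : (𝔼 n) → 𝔼 m)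
    (y : 𝔼 n) : ℝ :=
  ∑ i, ∑ j, invCoeff g p y i j * ∑ a, ∑ b, coeff (metricTensor h) q (u y) a b *
      pd i (fun z => u z a) y * pd j (fun z => u z b) y

theorem contDiffAt_energyCoord (g : Metric n M) (h : Metric m N) {p : M} {q : N}
    {U : ℝ → (𝔼 n) → 𝔼 m} {t : ℝ} {y : 𝔼 n} (hy : y ∈ (extChartAt (𝓡 n) p).target)
    (hU : ContDiffAt ℝ ∞ (fun w : ℝ × (𝔼 n) => U w.1 w.2) (t, y))
    (hq : U t y ∈ (extChartAt (𝓡 m) q).target) :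
    ContDiffAt ℝ ∞ (fun w : ℝ × (𝔼 n) => energyCoord g h p q (U w.1) w.2) (t, y) := by
  refine ContDiffAt.sum fun i _ => ContDiffAt.sum fun j _ => ContDiffAt.mul ?_ ?_
  · exact (contDiffAt_invCoeff g p hy i j).comp (t, y) contDiffAt_snd
  · refine ContDiffAt.sum fun a _ => ContDiffAt.sum fun b _ =>
      ContDiffAt.mul (ContDiffAt.mul ?_ ?_) ?_
    · exact (contDiffAt_coeff_metric h q hq a b).comp (t, y) hU
    · exact contDiffAt_pd_slice (contDiffAt_coord hU a) i
    · exact contDiffAt_pd_slice (contDiffAt_coord hU b) j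

/-- The inverse metric of the source does not depend on time. The target metric is differentiated by
the chain rule, and the time derivative passes under `∂ᵢ`. -/
theorem hasDerivAt_energyCoord (g : Metric n M) (h : Metric m N) {p : M} {q : N}
    {U : ℝ → (𝔼 n) → 𝔼 m} {y : 𝔼 n}
    (hU : ContDiffAt ℝ ∞ (fun w : ℝ × (𝔼 n) => U w.1 w.2) (0, y))
    (hq : U 0 y ∈ (extChartAt (𝓡 m) q).target) :
    HasDerivAt (fun t => energyCoord g h p q (U t) y)
      (energyVariation g h p q (U 0) (velocity U) y) 0 := by
  have hUd : HasDerivAt (fun s => U s y) (velocity U y) 0 := by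
    have := hasDerivAt_slice (hU.differentiableAt (by simp))
    rwa [velocity, this.deriv]
  have hH : ∀ a b, HasDerivAt (fun s => coeff (metricTensor h) q (U s y) a b)
      (∑ c, pd c (fun z => coeff (metricTensor h) q z a b) (U 0 y) * velocity U y c) 0 := by
    intro a b
    have h1 : DifferentiableAt ℝ (fun z => coeff (metricTensor h) q z a b) (U 0 y) :=
      (contDiffAt_coeff_metric h q hq a b).differentiableAt (by simp)
    rw [← fderiv_apply_eq_sum_pd]
    exact h1.hasFDerivAt.comp_hasDerivAt 0 hUd
  have hp : ∀ i a, HasDerivAt (fun s => pd i (fun z => U s z a) y)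
      (pd i (fun z => velocity U z a) y) 0 := by
    intro i a
    have h1 := hasDerivAt_pd_slice (contDiffAt_coord hU a) i
    have he : (fun z => velocity U z a) =ᶠ[𝓝 y] fun z => deriv (fun s => U s z a) 0 := by
      have hc : ContinuousAt (fun z : 𝔼 n => ((0 : ℝ), z)) y := by fun_prop
      filter_upwards [hc.eventually (eventually_differentiableAt hU)] with z hz
      exact velocity_apply hz a
    rw [pd_congr he i]
    exact h1
  refine HasDerivAt.fun_sum fun i _ => HasDerivAt.fun_sum fun j _ => HasDerivAt.const_mul _ ?_
  refine HasDerivAt.fun_sum fun a _ => HasDerivAt.fun_sum fun b _ => ?_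
  refine (((hH a b).fun_mul (hp i a)).fun_mul (hp j b)).congr_deriv ?_
  ring

/-- `F` is a smooth family of maps `M → N` parametrized by `(-ε, ε)`. -/
def IsSmoothFamily (n m : ℕ) {M : Type*} [TopologicalSpace M]
    [ChartedSpace (EuclideanSpace ℝ (Fin n)) M]
    {N : Type*} [TopologicalSpace N] [ChartedSpace (EuclideanSpace ℝ (Fin m)) N]
    (ε : ℝ) (F : ℝ → M → N) : Prop :=
  ∀ t ∈ Ioo (-ε) ε, ∀ x, ContMDiffAt (𝓘(ℝ, ℝ).prod (𝓡 n)) (𝓡 m) ∞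
    (fun w : ℝ × M => F w.1 w.2) (t, x)

theorem isSmoothFamily_iff {ε : ℝ} {F : ℝ → M → N} : IsSmoothFamily n m ε F ↔
    ContMDiffOn (𝓘(ℝ, ℝ).prod (𝓡 n)) (𝓡 m) ∞ (fun w : ℝ × M => F w.1 w.2)
      (Ioo (-ε) ε ×ˢ univ) := by
  have ho : IsOpen (Ioo (-ε) ε ×ˢ (univ : Set M)) := isOpen_Ioo.prod isOpen_univ
  constructor
  · rintro h ⟨t, x⟩ ⟨ht, -⟩
    exact (h t ht x).contMDiffWithinAt
  · intro h t ht x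
    exact h.contMDiffAt (ho.mem_nhds ⟨ht, mem_univ x⟩)

theorem IsSmoothFamily.contMDiff {ε : ℝ} {F : ℝ → M → N} (hF : IsSmoothFamily n m ε F) {t : ℝ}
    (ht : t ∈ Ioo (-ε) ε) : ContMDiff (𝓡 n) (𝓡 m) ∞ (F t) := fun x =>
  ContMDiffAt.comp (I' := 𝓘(ℝ, ℝ).prod (𝓡 n)) (g := fun w : ℝ × M => F w.1 w.2)
    (f := fun x : M => (t, x)) x (hF t ht x) (contMDiffAt_const.prodMk contMDiffAt_id)

theorem contDiffAt_localRep_family {p : M} {q : N} {F : ℝ → M → N} {t : ℝ} {y : 𝔼 n}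
    (hy : y ∈ (extChartAt (𝓡 n) p).target)
    (hF : ContMDiffAt (𝓘(ℝ, ℝ).prod (𝓡 n)) (𝓡 m) ∞ (fun w : ℝ × M => F w.1 w.2)
      (t, (extChartAt (𝓡 n) p).symm y))
    (hq : F t ((extChartAt (𝓡 n) p).symm y) ∈ (extChartAt (𝓡 m) q).source) :
    ContDiffAt ℝ ∞ (fun w : ℝ × (𝔼 n) => (localRep p q (F w.1) w.2 : 𝔼 m)) (t, y) := by
  have h1 : ContMDiffAt (𝓘(ℝ, ℝ).prod 𝓘(ℝ, 𝔼 n)) (𝓘(ℝ, ℝ).prod (𝓡 n)) ∞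
      (fun w : ℝ × (𝔼 n) => (w.1, (extChartAt (𝓡 n) p).symm w.2)) (t, y) :=
    contMDiffAt_fst.prodMk
      (ContMDiffAt.comp (t, y) (contMDiffAt_chart_symm p hy) contMDiffAt_snd)
  have h2 : ContMDiffAt (𝓘(ℝ, ℝ).prod 𝓘(ℝ, 𝔼 n)) (𝓡 m) ∞
      (fun w : ℝ × (𝔼 n) => F w.1 ((extChartAt (𝓡 n) p).symm w.2)) (t, y) :=
    ContMDiffAt.comp (I' := 𝓘(ℝ, ℝ).prod (𝓡 n))
      (g := fun w : ℝ × M => F w.1 w.2) (t, y) hF h1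
  have h3 : ContMDiffAt (𝓘(ℝ, ℝ).prod 𝓘(ℝ, 𝔼 n)) 𝓘(ℝ, 𝔼 m) ∞
      (fun w : ℝ × (𝔼 n) => (localRep p q (F w.1) w.2 : 𝔼 m)) (t, y) :=
    ContMDiffAt.comp (t, y) (contMDiffAt_chart q hq) h2
  rw [← contMDiffAt_iff_contDiffAt]
  rw [← modelWithCornersSelf_prod, chartedSpaceSelf_prod] at h3
  exact h3

/-- Near each point, the energy density of a smooth family is a smooth function of time and of the
coordinates. -/
theorem IsSmoothFamily.exists_energyDensity_eq (g : Metric n M) (h : Metric m N) {ε : ℝ}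
    {F : ℝ → M → N} (hF : IsSmoothFamily n m ε F) {t : ℝ} (ht : t ∈ Ioo (-ε) ε) (x : M) :
    ∃ e : ℝ × (𝔼 n) → ℝ, ContDiffAt ℝ ∞ e (t, extChartAt (𝓡 n) x x) ∧
      ∀ᶠ w : ℝ × M in 𝓝 (t, x), energyDensity g h (F w.1) w.2 = e (w.1, extChartAt (𝓡 n) x w.2) := by
  have hx := extChartAt_to_inv (I := 𝓡 n) x
  have hy := mem_extChartAt_target (I := 𝓡 n) x
  have hq : F t ((extChartAt (𝓡 n) x).symm (extChartAt (𝓡 n) x x)) ∈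
      (extChartAt (𝓡 m) (F t x)).source := by
    rw [hx]; exact mem_extChartAt_source _
  refine ⟨fun w => energyCoord g h x (F t x) (localRep x (F t x) (F w.1)) w.2, ?_, ?_⟩
  · refine contDiffAt_energyCoord g h (U := fun s => localRep x (F t x) (F s)) hy ?_ ?_
    · exact contDiffAt_localRep_family hy (by rw [hx]; exact hF t ht x) hq
    · exact (extChartAt (𝓡 m) (F t x)).map_source hq
  · have h1 : ∀ᶠ w : ℝ × M in 𝓝 (t, x), w.1 ∈ Ioo (-ε) ε :=
      continuousAt_fst.eventually (isOpen_Ioo.eventually_mem ht)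
    have h2 : ∀ᶠ w : ℝ × M in 𝓝 (t, x), w.2 ∈ (extChartAt (𝓡 n) x).source :=
      continuousAt_snd.eventually
        ((isOpen_extChartAt_source (I := 𝓡 n) x).eventually_mem (mem_extChartAt_source x))
    have h3 : ∀ᶠ w : ℝ × M in 𝓝 (t, x), F w.1 w.2 ∈ (extChartAt (𝓡 m) (F t x)).source :=
      (hF t ht x).continuousAt.eventually
        ((isOpen_extChartAt_source (I := 𝓡 m) (F t x)).eventually_mem (mem_extChartAt_source _))
    filter_upwards [h1, h2, h3] with w hw1 hw2 hw3
    have hl := (extChartAt (𝓡 n) x).left_inv hw2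
    have := energyDensity_eq g h (q := F t x) (f := F w.1) ((extChartAt (𝓡 n) x).map_source hw2)
      (hF.contMDiff hw1 _) (by rwa [hl])
    rw [hl] at this
    exact this

theorem IsSmoothFamily.continuousAt_energyDensity (g : Metric n M) (h : Metric m N) {ε : ℝ}
    {F : ℝ → M → N} (hF : IsSmoothFamily n m ε F) {t : ℝ} (ht : t ∈ Ioo (-ε) ε) (x : M) :
    ContinuousAt (fun w : ℝ × M => energyDensity g h (F w.1) w.2) (t, x) := by
  obtain ⟨e, he, hev⟩ := hF.exists_energyDensity_eq g h ht x
  refine ContinuousAt.congr_of_eventuallyEq ?_ hev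
  have hc : ContinuousAt (fun w : ℝ × M => (w.1, extChartAt (𝓡 n) x w.2)) (t, x) :=
    continuousAt_fst.prodMk (ContinuousAt.comp (g := extChartAt (𝓡 n) x) (f := Prod.snd) (x := (t, x))
      (continuousAt_extChartAt x) continuousAt_snd)
  exact ContinuousAt.comp (g := e)
    (f := fun w : ℝ × M => (w.1, extChartAt (𝓡 n) x w.2)) (x := (t, x)) he.continuousAt hc

theorem IsSmoothFamily.hasDerivAt_energyDensity (g : Metric n M) (h : Metric m N) {ε : ℝ}
    {F : ℝ → M → N} (hF : IsSmoothFamily n m ε F) {t : ℝ} (ht : t ∈ Ioo (-ε) ε) (x : M) :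
    HasDerivAt (fun s => energyDensity g h (F s) x)
      (deriv (fun s => energyDensity g h (F s) x) t) t := by
  obtain ⟨e, he, hev⟩ := hF.exists_energyDensity_eq g h ht x
  have hc : ContinuousAt (fun s : ℝ => (s, x)) t := by fun_prop
  have h1 := hasDerivAt_slice (he.differentiableAt (by simp))
  exact (h1.congr_of_eventuallyEq (hc.eventually hev)).differentiableAt.hasDerivAt

/-- Joint continuity in time and position provides, on compact sets, the uniform bound needed to
differentiate the energy under the integral. -/
theorem IsSmoothFamily.continuousAt_deriv_energyDensity (g : Metric n M) (h : Metric m N) {ε : ℝ}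
    {F : ℝ → M → N} (hF : IsSmoothFamily n m ε F) {t : ℝ} (ht : t ∈ Ioo (-ε) ε) (x : M) :
    ContinuousAt (fun w : ℝ × M => deriv (fun s => energyDensity g h (F s) w.2) w.1) (t, x) := by
  obtain ⟨e, he, hev⟩ := hF.exists_energyDensity_eq g h ht x
  have hc : ContinuousAt (fun w : ℝ × M => (w.1, extChartAt (𝓡 n) x w.2)) (t, x) :=
    continuousAt_fst.prodMk (ContinuousAt.comp (g := extChartAt (𝓡 n) x) (f := Prod.snd) (x := (t, x))
      (continuousAt_extChartAt x) continuousAt_snd)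
  have h1 : ContinuousAt (fun w => fderiv ℝ e w (1, 0)) (t, extChartAt (𝓡 n) x x) :=
    ((he.fderiv_right (m := ∞) (by simp)).clm_apply contDiffAt_const).continuousAt
  refine (ContinuousAt.comp (g := fun w => fderiv ℝ e w (1, 0))
    (f := fun w : ℝ × M => (w.1, extChartAt (𝓡 n) x w.2)) (x := (t, x)) h1 hc).congr_of_eventuallyEq ?_
  -- The coordinate formula must hold on a neighbourhood of each nearby `w`, since the time
  -- derivative is taken at `w`.
  filter_upwards [hev.eventually_nhds, hc.eventually (eventually_differentiableAt he)] with w hw hwd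
  have hcw : ContinuousAt (fun s : ℝ => (s, w.2)) w.1 := by fun_prop
  have h2 := hasDerivAt_slice hwd
  exact (h2.congr_of_eventuallyEq (hcw.eventually hw)).deriv

/-- The derivative of the energy density at time `0`, in the charts at `p` and `q`. -/
theorem IsSmoothFamily.deriv_energyDensity_eq (g : Metric n M) (h : Metric m N) {ε : ℝ}
    (hε : 0 < ε) {F : ℝ → M → N} (hF : IsSmoothFamily n m ε F) {p : M} {q : N} {y : 𝔼 n}
    (hy : y ∈ (extChartAt (𝓡 n) p).target)
    (hq : F 0 ((extChartAt (𝓡 n) p).symm y) ∈ (extChartAt (𝓡 m) q).source) :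
    deriv (fun s => energyDensity g h (F s) ((extChartAt (𝓡 n) p).symm y)) 0 =
      energyVariation g h p q (localRep p q (F 0))
        (velocity fun s => (localRep p q (F s) : (𝔼 n) → 𝔼 m)) y := by
  have h0 : (0 : ℝ) ∈ Ioo (-ε) ε := ⟨by linarith, hε⟩
  have hU := contDiffAt_localRep_family hy (hF 0 h0 _) hq
  have h1 := hasDerivAt_energyCoord g h (p := p) (q := q) (y := y)
    (U := fun s => localRep p q (F s)) hU ((extChartAt (𝓡 m) q).map_source hq)
  refine (h1.congr_of_eventuallyEq ?_).deriv
  have hc : ContinuousAt (fun s : ℝ => F s ((extChartAt (𝓡 n) p).symm y)) 0 :=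
    ContinuousAt.comp (g := fun w : ℝ × M => F w.1 w.2)
      (f := fun s : ℝ => (s, (extChartAt (𝓡 n) p).symm y)) (hF 0 h0 _).continuousAt (by fun_prop)
  filter_upwards [isOpen_Ioo.eventually_mem h0,
    hc.eventually ((isOpen_extChartAt_source (I := 𝓡 m) q).eventually_mem hq)] with s hs hsq
  exact energyDensity_eq g h hy (hF.contMDiff hs _) hsq

end Variations

/-! ### The divergence theorem for compactly supported fields -/

section EuclideanIntegral

variable {n : ℕ}

/-- Integration by parts against the constant function `1`. -/
theorem integral_pd_eq_zero {X : (𝔼 n) → ℝ} (hX : ContDiff ℝ 1 X) (hc : HasCompactSupport X)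
    (j : Fin n) : ∫ y, pd j X y = 0 := by
  have hcont : Continuous (fun y => fderiv ℝ X y (EuclideanSpace.single j 1)) :=
    (hX.continuous_fderiv one_ne_zero).clm_apply continuous_const
  have hcs : HasCompactSupport (fun y => fderiv ℝ X y (EuclideanSpace.single j 1)) :=
    (hc.fderiv ℝ).comp_left (g := fun L : (𝔼 n) →L[ℝ] ℝ => L (EuclideanSpace.single j 1)) (by simp)
  have h := integral_mul_fderiv_eq_neg_fderiv_mul_of_integrable (μ := (volume : Measure (𝔼 n)))
    (f := fun _ : 𝔼 n => (1 : ℝ)) (g := X) (v := EuclideanSpace.single j (1 : ℝ))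
    (by simp) (by simpa using hcont.integrable_of_hasCompactSupport hcs)
    (by simpa using hX.continuous.integrable_of_hasCompactSupport hc)
    (fun x _ => differentiableAt_const _) (fun x _ => hX.differentiable one_ne_zero x)
  simpa [pd] using h

theorem integrable_pd {X : (𝔼 n) → ℝ} (hX : ContDiff ℝ 1 X) (hc : HasCompactSupport X)
    (j : Fin n) : Integrable (pd j X) := by
  have hcont : Continuous (fun y => fderiv ℝ X y (EuclideanSpace.single j 1)) :=
    (hX.continuous_fderiv one_ne_zero).clm_apply continuous_const
  have hcs : HasCompactSupport (fun y => fderiv ℝ X y (EuclideanSpace.single j 1)) :=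
    (hc.fderiv ℝ).comp_left (g := fun L : (𝔼 n) →L[ℝ] ℝ => L (EuclideanSpace.single j 1)) (by simp)
  exact hcont.integrable_of_hasCompactSupport hcs

end EuclideanIntegral

/-! ### Localization of variations and the first variation formula -/

section Global

set_option linter.unusedSectionVars false

variable {n m : ℕ} {M : Type*} [TopologicalSpace M] [ChartedSpace (EuclideanSpace ℝ (Fin n)) M]
  [IsManifold (𝓡 n) ∞ M]
  {N : Type*} [TopologicalSpace N] [ChartedSpace (EuclideanSpace ℝ (Fin m)) N]
  [IsManifold (𝓡 m) ∞ N]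

theorem energyDensity_congr (g : Metric n M) (h : Metric m N) {f f' : M → N} {x : M}
    (hff : f =ᶠ[𝓝 x] f') : energyDensity g h f x = energyDensity g h f' x := by
  have hx := extChartAt_to_inv (I := 𝓡 n) x
  have key : pullbackMetric h f ((extChartAt (𝓡 n) x).symm (extChartAt (𝓡 n) x x)) =
      pullbackMetric (n := n) h f' ((extChartAt (𝓡 n) x).symm (extChartAt (𝓡 n) x x)) := by
    -- The coefficients live at a point that equals `x` only propositionally. Naming it as a
    -- variable allows substitution inside the dependent types.
    generalize (extChartAt (𝓡 n) x).symm (extChartAt (𝓡 n) x x) = x' at hx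
    subst hx
    ext v w
    have h1 : ∀ v : 𝔼 n, (mfderiv (𝓡 n) (𝓡 m) f x' v : 𝔼 m) = mfderiv (𝓡 n) (𝓡 m) f' x' v :=
      fun v => congrArg (fun L : (𝔼 n) →L[ℝ] 𝔼 m => L v) hff.mfderiv_eq
    have h2 := tensor2_congr (metricTensor h) hff.eq_of_nhds
      (mfderiv (𝓡 n) (𝓡 m) f x' v) (mfderiv (𝓡 n) (𝓡 m) f x' w)
    refine Eq.trans h2 ?_
    exact congrArg₂ (fun v w : 𝔼 m => metricTensor h (f' x')
      (show TangentSpace (𝓡 m) (f' x') from v) (show TangentSpace (𝓡 m) (f' x') from w)) (h1 v) (h1 w)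
  simp only [energyDensity, traceMetric, coeff, key]

/-- The family `F` reparametrized in time by the factor `ρ`, which multiplies the variation field
by `ρ`. -/
def rescale (ρ : M → ℝ) (F : ℝ → M → N) (t : ℝ) (x : M) : N := F (t * ρ x) x

theorem rescale_zero (ρ : M → ℝ) (F : ℝ → M → N) : rescale ρ F 0 = F 0 := by
  ext x; simp [rescale]

/-- Shrinking the time interval by the bound `C` keeps `t ρ(x)` inside the original one. -/
theorem IsSmoothFamily.smooth_rescale {ε : ℝ} {F : ℝ → M → N} (hF : IsSmoothFamily n m ε F)
    {ρ : M → ℝ} (hρ : ContMDiff (𝓡 n) 𝓘(ℝ, ℝ) ∞ ρ) {C : ℝ} (hC : 0 < C) (hρC : ∀ x, |ρ x| ≤ C) :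
    IsSmoothFamily n m (ε / C) (rescale ρ F) := by
  intro t ht x
  have hmem : t * ρ x ∈ Ioo (-ε) ε := by
    have h1 : |t| < ε / C := abs_lt.2 ht
    have h2 : |t * ρ x| < ε := by
      rw [abs_mul]
      calc |t| * |ρ x| ≤ |t| * C := by gcongr; exact hρC x
        _ < ε / C * C := by gcongr
        _ = ε := by field_simp
    exact abs_lt.1 h2
  have h1 : ContMDiffAt (𝓘(ℝ, ℝ).prod (𝓡 n)) (𝓘(ℝ, ℝ).prod (𝓡 n)) ∞
      (fun w : ℝ × M => (w.1 * ρ w.2, w.2)) (t, x) := by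
    refine ContMDiffAt.prodMk ?_ contMDiffAt_snd
    exact contMDiffAt_fst.mul (ContMDiffAt.comp (g := ρ) (t, x) (hρ x) contMDiffAt_snd)
  exact ContMDiffAt.comp (I' := 𝓘(ℝ, ℝ).prod (𝓡 n)) (g := fun w : ℝ × M => F w.1 w.2)
    (f := fun w : ℝ × M => (w.1 * ρ w.2, w.2)) (t, x) (hF _ hmem x) h1

/-- The coordinate expression of the variation field of the family `F`. -/
def velocityCoord (p : M) (q : N) (F : ℝ → M → N) : (𝔼 n) → 𝔼 m :=
  velocity fun s => localRep p q (F s)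

theorem velocityCoord_rescale (p : M) (q : N) (ρ : M → ℝ) (F : ℝ → M → N) (z : 𝔼 n) :
    (velocityCoord p q (rescale ρ F) z : 𝔼 m) =
      ρ ((extChartAt (𝓡 n) p).symm z) • velocityCoord p q F z := by
  set c := ρ ((extChartAt (𝓡 n) p).symm z)
  have h := deriv_comp_mul_left c (fun s => (localRep p q (F s) z : 𝔼 m)) 0
  rw [mul_zero] at h
  rw [velocityCoord, velocityCoord, velocity, velocity, ← h]
  congr 1
  ext s
  simp only [localRep, rescale, c, mul_comm]

/-- The pairing of the tension field of `F 0` with the variation field of `F`, in the charts at `p`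
and `q`. -/
def pairing (g : Metric n M) (h : Metric m N) (p : M) (q : N) (F : ℝ → M → N) (x : M) : ℝ :=
  ∑ d, tensionLower g h p q (localRep p q (F 0)) (extChartAt (𝓡 n) p x) d *
    velocityCoord p q F (extChartAt (𝓡 n) p x) d

/-- The points that are in the domain of the chart at `p` and that are mapped by `f` to the
domain of the chart at `q`. -/
def chartDomain (n m : ℕ) {M : Type*} [TopologicalSpace M]
    [ChartedSpace (EuclideanSpace ℝ (Fin n)) M]
    {N : Type*} [TopologicalSpace N] [ChartedSpace (EuclideanSpace ℝ (Fin m)) N]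
    (p : M) (q : N) (f : M → N) : Set M :=
  (extChartAt (𝓡 n) p).source ∩ f ⁻¹' (extChartAt (𝓡 m) q).source

theorem isOpen_chartDomain (p : M) (q : N) {f : M → N} (hf : Continuous f) :
    IsOpen (chartDomain n m p q f) :=
  (isOpen_extChartAt_source p).inter ((isOpen_extChartAt_source q).preimage hf)

theorem mem_chartDomain_self (x : M) (f : M → N) : x ∈ chartDomain n m x (f x) f :=
  ⟨mem_extChartAt_source x, mem_extChartAt_source (f x)⟩

theorem IsSmoothFamily.contDiffAt_velocityCoord {ε : ℝ} (hε : 0 < ε) {F : ℝ → M → N}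
    (hF : IsSmoothFamily n m ε F) {p : M} {q : N} {y : 𝔼 n}
    (hy : y ∈ (extChartAt (𝓡 n) p).target)
    (hq : F 0 ((extChartAt (𝓡 n) p).symm y) ∈ (extChartAt (𝓡 m) q).source) :
    ContDiffAt ℝ ∞ (velocityCoord p q F : (𝔼 n) → 𝔼 m) y :=
  contDiffAt_velocity (contDiffAt_localRep_family hy (hF 0 ⟨by linarith, hε⟩ _) hq)

theorem IsSmoothFamily.continuousOn_pairing (g : Metric n M) (h : Metric m N) {ε : ℝ}
    (hε : 0 < ε) {F : ℝ → M → N} (hF : IsSmoothFamily n m ε F) (p : M) (q : N) :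
    ContinuousOn (pairing g h p q F) (chartDomain n m p q (F 0)) := by
  intro x hx
  refine ContinuousAt.continuousWithinAt ?_
  have hy := (extChartAt (𝓡 n) p).map_source hx.1
  have hl := (extChartAt (𝓡 n) p).left_inv hx.1
  have hq : F 0 ((extChartAt (𝓡 n) p).symm (extChartAt (𝓡 n) p x)) ∈
      (extChartAt (𝓡 m) q).source := by rw [hl]; exact hx.2
  have hf : ContMDiff (𝓡 n) (𝓡 m) ∞ (F 0) := hF.contMDiff ⟨by linarith, hε⟩
  have hu := contDiffAt_localRep hy (hf _) hq
  have hV := hF.contDiffAt_velocityCoord hε hy hq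
  have hc : ContinuousAt (fun y => ∑ d, tensionLower g h p q (localRep p q (F 0)) y d *
      velocityCoord p q F y d) (extChartAt (𝓡 n) p x) := by
    have : ContDiffAt ℝ ∞ (fun y => ∑ d, tensionLower g h p q (localRep p q (F 0)) y d *
      velocityCoord p q F y d) (extChartAt (𝓡 n) p x) :=
      ContDiffAt.sum fun d _ => (contDiffAt_tensionLower g h hy hu
        ((extChartAt (𝓡 m) q).map_source hq) d).mul (contDiffAt_coord hV d)
    exact this.continuousAt
  exact ContinuousAt.comp (f := extChartAt (𝓡 n) p) hc (contMDiffAt_chart p hx.1).continuousAt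

/-- `pairing` is meaningful only on the chart domain. Elsewhere its values are harmless, because `ρ`
vanishes near every point outside its support. -/
theorem IsSmoothFamily.continuous_mul_pairing (g : Metric n M) (h : Metric m N) {ε : ℝ}
    (hε : 0 < ε) {F : ℝ → M → N} (hF : IsSmoothFamily n m ε F) {p : M} {q : N}
    {ρ : M → ℝ} (hρ : Continuous ρ) (hsupp : tsupport ρ ⊆ chartDomain n m p q (F 0)) :
    Continuous (fun x => ρ x * pairing g h p q F x) := by
  have hf : ContMDiff (𝓡 n) (𝓡 m) ∞ (F 0) := hF.contMDiff ⟨by linarith, hε⟩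
  refine continuous_iff_continuousAt.2 fun x => ?_
  by_cases hx : x ∈ tsupport ρ
  · exact hρ.continuousAt.mul ((hF.continuousOn_pairing g h hε p q).continuousAt
      ((isOpen_chartDomain p q hf.continuous).mem_nhds (hsupp hx)))
  · have : (fun x => ρ x * pairing g h p q F x) =ᶠ[𝓝 x] fun _ => 0 := by
      filter_upwards [notMem_tsupport_iff_eventuallyEq.1 hx] with z hz
      simp [hz]
    exact continuousAt_const.congr_of_eventuallyEq this

theorem IsSmoothFamily.continuous_deriv_energyDensity (g : Metric n M) (h : Metric m N) {ε : ℝ}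
    {F : ℝ → M → N} (hF : IsSmoothFamily n m ε F) {t : ℝ} (ht : t ∈ Ioo (-ε) ε) :
    Continuous (fun x => deriv (fun s => energyDensity g h (F s) x) t) :=
  continuous_iff_continuousAt.2 fun x =>
    ContinuousAt.comp (g := fun w : ℝ × M => deriv (fun s => energyDensity g h (F s) w.2) w.1)
      (f := fun x : M => (t, x)) (x := x) (hF.continuousAt_deriv_energyDensity g h ht x)
      (by fun_prop)

theorem IsSmoothFamily.continuous_energyDensity (g : Metric n M) (h : Metric m N) {ε : ℝ}
    {F : ℝ → M → N} (hF : IsSmoothFamily n m ε F) {t : ℝ} (ht : t ∈ Ioo (-ε) ε) :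
    Continuous (fun x => energyDensity g h (F t) x) :=
  continuous_iff_continuousAt.2 fun x =>
    ContinuousAt.comp (g := fun w : ℝ × M => energyDensity g h (F w.1) w.2)
      (f := fun x : M => (t, x)) (x := x) (hF.continuousAt_energyDensity g h ht x)
      (by fun_prop)

theorem deriv_energyDensity_eq_zero (g : Metric n M) (h : Metric m N) {F : ℝ → M → N} {x : M}
    {O : Set M} (hO : O ∈ 𝓝 x) {ε : ℝ} (hε : 0 < ε)
    (hF : ∀ t ∈ Ioo (-ε) ε, ∀ z ∈ O, F t z = F 0 z) :
    deriv (fun s => energyDensity g h (F s) x) 0 = 0 := by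
  have h0 : (0 : ℝ) ∈ Ioo (-ε) ε := ⟨by linarith, hε⟩
  have : (fun s => energyDensity g h (F s) x) =ᶠ[𝓝 0] fun _ => energyDensity g h (F 0) x := by
    filter_upwards [isOpen_Ioo.eventually_mem h0] with s hs
    refine energyDensity_congr g h ?_
    filter_upwards [hO] with z hz
    exact hF s hs z hz
  rw [this.deriv_eq, deriv_const]

theorem deriv_energyDensity_rescale_eq_zero (g : Metric n M) (h : Metric m N) {F : ℝ → M → N}
    {ρ : M → ℝ} {x : M} (hx : x ∉ tsupport ρ) :
    deriv (fun s => energyDensity g h (rescale ρ F s) x) 0 = 0 := by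
  refine deriv_energyDensity_eq_zero g h
    (notMem_tsupport_iff_eventuallyEq.1 hx) one_pos fun t _ z hz => ?_
  have : ρ z = 0 := hz
  simp [rescale, this]

variable [T2Space M] [CompactSpace M] [MeasurableSpace M] [BorelSpace M]

/-- Differentiation under the integral: on a closed time interval times the compact `M`, the
derivative of the energy density has a constant bound, integrable since the measure is finite. -/
theorem IsSmoothFamily.hasDerivAt_energy (g : Metric n M) (h : Metric m N) {ε : ℝ} (hε : 0 < ε)
    {F : ℝ → M → N} (hF : IsSmoothFamily n m ε F) (U : Set M) :
    HasDerivAt (fun t => energy g h U (F t)) ((1 / 2) *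
      ∫ x in U, deriv (fun s => energyDensity g h (F s) x) 0 ∂(riemannianVolume g)) 0 := by
  have hsub : Icc (-(ε / 2)) (ε / 2) ⊆ Ioo (-ε) ε := fun t ht =>
    ⟨by linarith [ht.1], by linarith [ht.2]⟩
  have h0 : (0 : ℝ) ∈ Ioo (-ε) ε := ⟨by linarith, hε⟩
  have hcomp : IsCompact (Icc (-(ε / 2)) (ε / 2) ×ˢ (univ : Set M)) := isCompact_Icc.prod isCompact_univ
  obtain ⟨B, hB⟩ := hcomp.exists_bound_of_continuousOn
    (f := fun w : ℝ × M => deriv (fun s => energyDensity g h (F s) w.2) w.1)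
    (fun w hw => (hF.continuousAt_deriv_energyDensity g h (hsub hw.1) w.2).continuousWithinAt)
  refine HasDerivAt.const_mul _ ?_
  refine (hasDerivAt_integral_of_dominated_loc_of_deriv_le
    (μ := (riemannianVolume g).restrict U) (s := Icc (-(ε / 2)) (ε / 2)) (bound := fun _ => B)
    (F := fun t x => energyDensity g h (F t) x)
    (F' := fun t x => deriv (fun s => energyDensity g h (F s) x) t)
    (Icc_mem_nhds (by linarith) (by linarith)) ?_ ?_ ?_ ?_ ?_ ?_).2
  · filter_upwards [isOpen_Ioo.eventually_mem h0] with t ht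
    exact (hF.continuous_energyDensity g h ht).aestronglyMeasurable
  · exact ((hF.continuous_energyDensity g h h0).integrable_of_hasCompactSupport
      (HasCompactSupport.of_compactSpace _)).restrict
  · exact (hF.continuous_deriv_energyDensity g h h0).aestronglyMeasurable
  · exact Filter.Eventually.of_forall fun x t ht => hB (t, x) ⟨ht, mem_univ x⟩
  · exact integrable_const _
  · exact Filter.Eventually.of_forall fun x t ht =>
      hF.hasDerivAt_energyDensity g h (hsub ht) x

/-- The first variation formula for variations supported in a chart domain. -/
theorem IsSmoothFamily.integral_deriv_energyDensity_rescale (g : Metric n M) (h : Metric m N)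
    {ε : ℝ} (hε : 0 < ε) {F : ℝ → M → N} (hF : IsSmoothFamily n m ε F) {p : M} {q : N}
    {ρ : M → ℝ} (hρ : ContMDiff (𝓡 n) 𝓘(ℝ, ℝ) ∞ ρ)
    (hsupp : tsupport ρ ⊆ chartDomain n m p q (F 0)) :
    ∫ x, deriv (fun s => energyDensity g h (rescale ρ F s) x) 0 ∂(riemannianVolume g) =
      -2 * ∫ x, ρ x * pairing g h p q F x ∂(riemannianVolume g) := by
  obtain ⟨C, hC0, hC⟩ : ∃ C, 0 < C ∧ ∀ x, |ρ x| ≤ C := by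
    obtain ⟨C, hC⟩ := (isCompact_univ (X := M)).exists_bound_of_continuousOn
      hρ.continuous.continuousOn
    exact ⟨max C 1, lt_max_of_lt_right one_pos, fun x => (hC x (mem_univ x)).trans (le_max_left _ _)⟩
  set G := rescale ρ F with hG
  have hε' : 0 < ε / C := div_pos hε hC0
  have hGs : IsSmoothFamily n m (ε / C) G := hF.smooth_rescale hρ hC0 hC
  have hG0 : G 0 = F 0 := rescale_zero ρ F
  have hf : ContMDiff (𝓡 n) (𝓡 m) ∞ (F 0) := hF.contMDiff ⟨by linarith, hε⟩
  have hDc : Continuous (fun x => deriv (fun s => energyDensity g h (G s) x) 0) :=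
    hGs.continuous_deriv_energyDensity g h ⟨by linarith, hε'⟩
  have hPc := hF.continuous_mul_pairing g h hε hρ.continuous hsupp
  -- It suffices that `w` has integral zero. It vanishes off the support of `ρ`, so its integral can
  -- be computed in the single chart at `p`.
  set w : M → ℝ := fun x => 1 / 2 * deriv (fun s => energyDensity g h (G s) x) 0
    + ρ x * pairing g h p q F x with hw
  have hwc : Continuous w := (continuous_const.mul hDc).add hPc
  have hw0 : ∀ x ∉ tsupport ρ, w x = 0 := by
    intro x hx
    simp only [hw]
    rw [deriv_energyDensity_rescale_eq_zero g h hx, image_eq_zero_of_notMem_tsupport hx]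
    ring
  suffices hzero : ∫ x, w x ∂(riemannianVolume g) = 0 by
    have hi1 : Integrable (fun x => 1 / 2 * deriv (fun s => energyDensity g h (G s) x) 0)
        (riemannianVolume g) := (continuous_const.mul hDc).integrable_of_hasCompactSupport
      (HasCompactSupport.of_compactSpace _)
    have hi2 : Integrable (fun x => ρ x * pairing g h p q F x)
        (riemannianVolume g) := hPc.integrable_of_hasCompactSupport
      (HasCompactSupport.of_compactSpace _)
    rw [hw, integral_add hi1 hi2, integral_const_mul] at hzero
    linarith
  rw [integral_riemannianVolume_eq g p hwc.continuousOn fun x hx =>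
    hw0 x fun hx' => hx (hsupp hx').1]
  set T := (extChartAt (𝓡 n) p).target with hT
  set Ω : Set (𝔼 n) := T ∩ (extChartAt (𝓡 n) p).symm ⁻¹' (F 0 ⁻¹' (extChartAt (𝓡 m) q).source)
    with hΩ
  have hΩo : IsOpen Ω := (continuousOn_extChartAt_symm p).isOpen_inter_preimage
    (isOpen_extChartAt_target p) ((isOpen_extChartAt_source q).preimage hf.continuous)
  set K : Set (𝔼 n) := extChartAt (𝓡 n) p '' tsupport ρ with hK
  have hKc : IsCompact K := (isClosed_tsupport ρ).isCompact.image_of_continuousOn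
    ((continuousOn_extChartAt p).mono fun x hx => (hsupp hx).1)
  have hKΩ : K ⊆ Ω := by
    rintro _ ⟨x, hx, rfl⟩
    refine ⟨(extChartAt (𝓡 n) p).map_source (hsupp hx).1, ?_⟩
    rw [mem_preimage, (extChartAt (𝓡 n) p).left_inv (hsupp hx).1]
    exact (hsupp hx).2
  have hnotK : ∀ y ∈ T, y ∉ K → (extChartAt (𝓡 n) p).symm y ∉ tsupport ρ := by
    intro y hy hyK hx
    exact hyK ⟨_, hx, (extChartAt (𝓡 n) p).right_inv hy⟩
  set u : (𝔼 n) → 𝔼 m := localRep p q (F 0) with hu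
  -- On `Ω` outside the compact set `K` the flux vanishes, because the variation field of `rescale ρ
  -- F` carries the factor `ρ`. Extension by zero is therefore `C¹` with compact support, and its
  -- divergence integrates to zero.
  set X : Fin n → (𝔼 n) → ℝ := fun j => Ω.indicator
    (fluxCoord g h p q u (velocityCoord p q G) j) with hX
  have hXzero : ∀ j, ∀ y ∉ K, X j y = 0 := by
    intro j y hyK
    by_cases hy : y ∈ Ω
    · have hr := image_eq_zero_of_notMem_tsupport (hnotK y hy.1 hyK)
      simp only [hX]
      rw [indicator_of_mem hy, fluxCoord, hG, velocityCoord_rescale, hr]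
      simp
    · exact indicator_of_notMem hy _
  have hXev : ∀ j, ∀ y ∉ K, X j =ᶠ[𝓝 y] fun _ => 0 := by
    intro j y hyK
    filter_upwards [hKc.isClosed.isOpen_compl.mem_nhds hyK] with z hz
    exact hXzero j z hz
  have hXΩ : ∀ j, ∀ y ∈ Ω, X j =ᶠ[𝓝 y] fluxCoord g h p q u (velocityCoord p q G) j := by
    intro j y hy
    filter_upwards [hΩo.mem_nhds hy] with z hz
    exact indicator_of_mem hz _
  have hudiff : ∀ y ∈ Ω, ContDiffAt ℝ ∞ u y := fun y hy => contDiffAt_localRep hy.1 (hf _) hy.2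
  have hVdiff : ∀ y ∈ Ω, ContDiffAt ℝ ∞ (velocityCoord p q G : (𝔼 n) → 𝔼 m) y := fun y hy =>
    hGs.contDiffAt_velocityCoord hε' hy.1 (by rw [hG0]; exact hy.2)
  have huq : ∀ y ∈ Ω, u y ∈ (extChartAt (𝓡 m) q).target := fun y hy =>
    (extChartAt (𝓡 m) q).map_source hy.2
  have hXdiff : ∀ j, ContDiff ℝ 1 (X j) := by
    intro j
    refine contDiff_iff_contDiffAt.2 fun y => ?_
    by_cases hy : y ∈ K
    · have hyΩ := hKΩ hy
      exact ((contDiffAt_fluxCoord g h hyΩ.1 (hudiff y hyΩ) (hVdiff y hyΩ) (huq y hyΩ)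
        j).of_le (by simp)).congr_of_eventuallyEq (hXΩ j y hyΩ)
    · exact contDiffAt_const.congr_of_eventuallyEq (hXev j y hy)
  have hXsupp : ∀ j, HasCompactSupport (X j) := fun j => HasCompactSupport.intro hKc (hXzero j)
  have hpd0 : ∀ y ∉ K, ∑ j, pd j (X j) y = 0 := by
    intro y hy
    refine Finset.sum_eq_zero fun j _ => ?_
    rw [pd_congr (hXev j y hy) j]
    simp [pd]
  have hpt : ∀ y ∈ T, volDensity g p y * w ((extChartAt (𝓡 n) p).symm y) =
      ∑ j, pd j (X j) y := by
    intro y hy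
    by_cases hyK : y ∈ K
    · have hyΩ := hKΩ hyK
      have h1 := hGs.deriv_energyDensity_eq g h hε' (p := p) (q := q) hy
        (by rw [hG0]; exact hyΩ.2)
      have h2 := volDensity_mul_energyVariation g h hy (hudiff y hyΩ) (hVdiff y hyΩ) (huq y hyΩ)
      rw [hG0] at h1
      have h3 : ∑ d, tensionLower g h p q u y d * velocityCoord p q G y d =
          ρ ((extChartAt (𝓡 n) p).symm y) * pairing g h p q F ((extChartAt (𝓡 n) p).symm y) := by
        rw [pairing, (extChartAt (𝓡 n) p).right_inv hy, Finset.mul_sum]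
        refine Finset.sum_congr rfl fun d _ => ?_
        rw [hG, velocityCoord_rescale, PiLp.smul_apply, smul_eq_mul]
        ring
      rw [h3] at h2
      rw [Finset.sum_congr rfl fun j _ => pd_congr (hXΩ j y hyΩ) j]
      simp only [hw]
      rw [h1, mul_add]
      have h4 : volDensity g p y * (1 / 2 * energyVariation g h p q u
        (velocity fun s => localRep p q (G s)) y) = _ := h2
      rw [h4]
      ring
    · rw [hpd0 y hyK, hw0 _ (hnotK y hy hyK), mul_zero]
  rw [setIntegral_congr_fun (measurableSet_target p) hpt,
    setIntegral_eq_integral_of_forall_compl_eq_zero fun y hy => hpd0 y fun hyK => hy (hKΩ hyK).1,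
    integral_finsetSum _ fun j _ => integrable_pd (hXdiff j) (hXsupp j) j]
  exact Finset.sum_eq_zero fun j _ => integral_pd_eq_zero (hXdiff j) (hXsupp j) j

/-- A function whose integral against all smooth functions supported in an open set vanishes is
zero on this set, if it is continuous there. -/
theorem eq_zero_of_integral_mul_eq_zero (g : Metric n M) {O : Set M} (hO : IsOpen O) {A : M → ℝ}
    (hA : ContinuousOn A O)
    (hvanish : ∀ ρ : M → ℝ, ContMDiff (𝓡 n) 𝓘(ℝ, ℝ) ∞ ρ → tsupport ρ ⊆ O →
      ∫ x, ρ x * A x ∂(riemannianVolume g) = 0) {x : M} (hx : x ∈ O) : A x = 0 := by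
  have h1 := hO.ae_eq_zero_of_integral_contMDiff_smul_eq_zero (𝓡 n) (μ := riemannianVolume g)
    (f := A) (hA.locallyIntegrableOn hO.measurableSet)
    (fun ρ hρ _ hs => by simpa using hvanish ρ hρ hs)
  have h2 : A =ᵐ[(riemannianVolume g).restrict O] fun _ => 0 := by
    rw [Filter.EventuallyEq, ae_restrict_iff' hO.measurableSet]
    exact h1
  exact Measure.eqOn_open_of_ae_eq h2 hO hA continuousOn_const hx

/-- Chart independence without transforming Christoffel symbols: tested against any cutoff supported
in both domains, each pairing gives `-½` times the same chart-free integral. Their continuous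
difference is therefore zero. -/
theorem IsSmoothFamily.pairing_eq (g : Metric n M) (h : Metric m N)
    {ε : ℝ} (hε : 0 < ε) {F : ℝ → M → N} (hF : IsSmoothFamily n m ε F) {p p' : M} {q q' : N} {x : M}
    (hx : x ∈ chartDomain n m p q (F 0)) (hx' : x ∈ chartDomain n m p' q' (F 0)) :
    pairing g h p q F x = pairing g h p' q' F x := by
  have hf : ContMDiff (𝓡 n) (𝓡 m) ∞ (F 0) := hF.contMDiff ⟨by linarith, hε⟩
  set O := chartDomain n m p q (F 0) ∩ chartDomain n m p' q' (F 0)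
  have hO : IsOpen O :=
    (isOpen_chartDomain p q hf.continuous).inter (isOpen_chartDomain p' q' hf.continuous)
  refine sub_eq_zero.1 (eq_zero_of_integral_mul_eq_zero g hO
    (A := fun x => pairing g h p q F x - pairing g h p' q' F x)
    (((hF.continuousOn_pairing g h hε p q).mono inter_subset_left).sub
      ((hF.continuousOn_pairing g h hε p' q').mono inter_subset_right)) ?_ ⟨hx, hx'⟩)
  intro ρ hρ hs
  have e1 := hF.integral_deriv_energyDensity_rescale g h hε hρ (hs.trans inter_subset_left)
  have e2 := hF.integral_deriv_energyDensity_rescale g h hε hρ (hs.trans inter_subset_right)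
  have i1 := (hF.continuous_mul_pairing g h hε hρ.continuous
    (hs.trans inter_subset_left)).integrable_of_hasCompactSupport (μ := riemannianVolume g)
      (HasCompactSupport.of_compactSpace _)
  have i2 := (hF.continuous_mul_pairing g h hε hρ.continuous
    (hs.trans inter_subset_right)).integrable_of_hasCompactSupport (μ := riemannianVolume g)
      (HasCompactSupport.of_compactSpace _)
  simp only [mul_sub]
  rw [integral_sub i1 i2]
  linarith

end Global

/-! ### Harmonicity and the tension field -/

section Harmonic

set_option linter.unusedSectionVars false

variable {n m : ℕ} {M : Type*} [TopologicalSpace M] [ChartedSpace (EuclideanSpace ℝ (Fin n)) M]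
  [IsManifold (𝓡 n) ∞ M]
  {N : Type*} [TopologicalSpace N] [ChartedSpace (EuclideanSpace ℝ (Fin m)) N]
  [IsManifold (𝓡 m) ∞ N]

theorem energyVariation_zero (g : Metric n M) (h : Metric m N) (p : M) (q : N)
    (u : (𝔼 n) → 𝔼 m) (y : 𝔼 n) : energyVariation g h p q u (fun _ => 0) y = 0 := by
  simp [energyVariation, pd]

theorem energyVariation_add (g : Metric n M) (h : Metric m N) (p : M) (q : N)
    (u : (𝔼 n) → 𝔼 m) {V W : (𝔼 n) → 𝔼 m} {y : 𝔼 n} (hV : ContDiffAt ℝ ∞ V y)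
    (hW : ContDiffAt ℝ ∞ W y) :
    energyVariation g h p q u (fun z => V z + W z) y =
      energyVariation g h p q u V y + energyVariation g h p q u W y := by
  have hpd : ∀ i a, pd i (fun z => (V z + W z) a) y =
      pd i (fun z => V z a) y + pd i (fun z => W z a) y := by
    intro i a
    have h1 : DifferentiableAt ℝ (fun z => V z a) y :=
      (contDiffAt_coord hV a).differentiableAt (by simp)
    have h2 : DifferentiableAt ℝ (fun z => W z a) y :=
      (contDiffAt_coord hW a).differentiableAt (by simp)
    simp only [pd, PiLp.add_apply]
    rw [fderiv_fun_add h1 h2]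
    rfl
  simp only [energyVariation, hpd, ← Finset.sum_add_distrib, ← mul_add]
  refine Finset.sum_congr rfl fun i _ => Finset.sum_congr rfl fun j _ => ?_
  congr 1
  refine Finset.sum_congr rfl fun a _ => Finset.sum_congr rfl fun b _ => ?_
  have hs : ∑ c, pd c (fun z => coeff (metricTensor h) q z a b) (u y) * (V y + W y) c =
      ∑ c, pd c (fun z => coeff (metricTensor h) q z a b) (u y) * V y c
      + ∑ c, pd c (fun z => coeff (metricTensor h) q z a b) (u y) * W y c := by
    simp only [PiLp.add_apply, mul_add, Finset.sum_add_distrib]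
  rw [hs]
  ring

theorem energyVariation_sum (g : Metric n M) (h : Metric m N) (p : M) (q : N)
    (u : (𝔼 n) → 𝔼 m) {ι : Type*} (s : Finset ι) {V : ι → (𝔼 n) → 𝔼 m} {y : 𝔼 n}
    (hV : ∀ i, ContDiffAt ℝ ∞ (V i) y) :
    energyVariation g h p q u (fun z => ∑ i ∈ s, V i z) y =
      ∑ i ∈ s, energyVariation g h p q u (V i) y := by
  classical
  induction s using Finset.induction_on with
  | empty => simpa using energyVariation_zero g h p q u y
  | insert i s hi ih =>
    simp only [Finset.sum_insert hi]
    rw [energyVariation_add g h p q u (hV i) (ContDiffAt.sum fun i _ => hV i), ih]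

/-- The derivative of the energy density is additive under partitions of unity. -/
theorem IsSmoothFamily.sum_deriv_energyDensity_rescale (g : Metric n M) (h : Metric m N) {ε : ℝ}
    (hε : 0 < ε) {F : ℝ → M → N} (hF : IsSmoothFamily n m ε F) {ι : Type*} [Fintype ι]
    {ρ : ι → M → ℝ} (hρ : ∀ i, ContMDiff (𝓡 n) 𝓘(ℝ, ℝ) ∞ (ρ i))
    {C : ℝ} (hC : 0 < C) (hρC : ∀ i x, |ρ i x| ≤ C) (hsum : ∀ x, ∑ i, ρ i x = 1) (x : M) :
    deriv (fun s => energyDensity g h (F s) x) 0 =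
      ∑ i, deriv (fun s => energyDensity g h (rescale (ρ i) F s) x) 0 := by
  have hε' : 0 < ε / C := div_pos hε hC
  have hG : ∀ i, IsSmoothFamily n m (ε / C) (rescale (ρ i) F) := fun i =>
    hF.smooth_rescale (hρ i) hC (hρC i)
  have hx := extChartAt_to_inv (I := 𝓡 n) x
  set y := extChartAt (𝓡 n) x x with hydef
  have hy : y ∈ (extChartAt (𝓡 n) x).target := mem_extChartAt_target x
  have hq : F 0 ((extChartAt (𝓡 n) x).symm y) ∈ (extChartAt (𝓡 m) (F 0 x)).source := by
    rw [hx]; exact mem_extChartAt_source _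
  have hqG : ∀ i, rescale (ρ i) F 0 ((extChartAt (𝓡 n) x).symm y) ∈
      (extChartAt (𝓡 m) (F 0 x)).source := fun i => by rw [rescale_zero]; exact hq
  have e1 := hF.deriv_energyDensity_eq g h hε (p := x) (q := F 0 x) hy hq
  have e2 := fun i => (hG i).deriv_energyDensity_eq g h hε' (p := x) (q := F 0 x) hy (hqG i)
  simp only [hx, rescale_zero] at e1 e2
  rw [e1, Finset.sum_congr rfl fun i _ => e2 i]
  -- The fields `ρᵢ V` of the rescaled families add up to `V` because the `ρᵢ` sum to one.
  have hV : (velocity fun s => (localRep x (F 0 x) (F s) : (𝔼 n) → 𝔼 m)) =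
      fun z => ∑ i, velocityCoord x (F 0 x) (rescale (ρ i) F) z := by
    ext1 z
    simp only [velocityCoord_rescale, ← Finset.sum_smul, hsum, one_smul]
    rfl
  rw [hV]
  exact energyVariation_sum g h x (F 0 x) _ Finset.univ fun i =>
    (hG i).contDiffAt_velocityCoord hε' hy (hqG i)

theorem pairing_self (g : Metric n M) (h : Metric m N) (F : ℝ → M → N) (x : M) :
    pairing g h x (F 0 x) F x = h.inner (F 0 x) (tension g h (F 0) x)
      (∑ d, (velocityCoord x (F 0 x) F (extChartAt (𝓡 n) x x)) d •
        (show TangentSpace (𝓡 m) (F 0 x) from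
          coordVec (F 0 x) d (extChartAt (𝓡 m) (F 0 x) (F 0 x)))) :=
  (inner_tension g h (F 0) x _).symm

variable [T2Space M] [CompactSpace M] [MeasurableSpace M] [BorelSpace M]

/-- A map with vanishing tension field is harmonic. -/
theorem isHarmonic_of_tension_eq_zero (g : Metric n M) (h : Metric m N) {f : M → N}
    (hf : ContMDiff (𝓡 n) (𝓡 m) ∞ f) (hτ : ∀ x, tension g h f x = 0) : IsHarmonic g h f := by
  refine ⟨hf, fun U hU _ ε hε F hvar => ?_⟩
  have hF : IsSmoothFamily n m ε F := isSmoothFamily_iff.2 hvar.smooth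
  have hF0 : F 0 = f := hvar.initial
  obtain ⟨K, hK, hKU, hKF⟩ := hvar.support
  have h0 : (0 : ℝ) ∈ Ioo (-ε) ε := ⟨by linarith, hε⟩
  -- A point outside `U` lies in the open complement of `K`, where the family is stationary.
  -- Integrals over `U` may thus be taken over all of `M`.
  have hD0 : ∀ x ∉ U, deriv (fun s => energyDensity g h (F s) x) 0 = 0 := by
    intro x hx
    refine deriv_energyDensity_eq_zero g h
      (hK.isClosed.isOpen_compl.mem_nhds fun hxK => hx (hKU hxK)) hε fun t ht z hz => ?_
    rw [hKF t ht z hz, hF0]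
  -- Passing to the charts at `x` and `f x` identifies the pairing with an inner product with `τ`,
  -- which is zero.
  have hpair : ∀ (p : M) (q : N), ∀ x ∈ chartDomain n m p q (F 0), pairing g h p q F x = 0 := by
    intro p q x hx
    rw [hF.pairing_eq g h hε hx (mem_chartDomain_self x (F 0)), pairing_self, hF0, hτ x]
    simp
  have hopen : ∀ x : M, IsOpen (chartDomain n m x (F 0 x) (F 0)) := fun x =>
    isOpen_chartDomain _ _ (hF.contMDiff h0).continuous
  obtain ⟨t, ht⟩ := isCompact_univ.elim_finite_subcover
    (fun x : M => chartDomain n m x (F 0 x) (F 0)) hopen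
    (fun x _ => mem_iUnion.2 ⟨x, mem_chartDomain_self x (F 0)⟩)
  obtain ⟨ρ, hρ⟩ := SmoothPartitionOfUnity.exists_isSubordinate (𝓡 n) isClosed_univ
    (fun i : t => chartDomain n m (i : M) (F 0 i) (F 0)) (fun i => hopen i) (by
      intro x hx
      obtain ⟨i, hi, hxi⟩ := mem_iUnion₂.1 (ht hx)
      exact mem_iUnion.2 ⟨⟨i, hi⟩, hxi⟩)
  have hsmooth : ∀ i, ContMDiff (𝓡 n) 𝓘(ℝ, ℝ) ∞ (ρ i) := fun i => (ρ i).contMDiff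
  have hle : ∀ i x, |ρ i x| ≤ 1 := fun i x => by
    rw [abs_of_nonneg (ρ.nonneg i x)]; exact ρ.le_one i x
  have hsum : ∀ x, ∑ i, ρ i x = 1 := fun x => by
    rw [← finsum_eq_sum_of_fintype]; exact ρ.sum_eq_one (mem_univ x)
  have hvanish : ∫ x, deriv (fun s => energyDensity g h (F s) x) 0 ∂(riemannianVolume g) = 0 := by
    simp only [hF.sum_deriv_energyDensity_rescale g h hε hsmooth one_pos hle hsum]
    rw [integral_finsetSum]
    · refine Finset.sum_eq_zero fun i _ => ?_
      rw [hF.integral_deriv_energyDensity_rescale g h hε (hsmooth i) (hρ i)]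
      have : ∀ x, ρ i x * pairing g h (i : M) (F 0 i) F x = 0 := by
        intro x
        by_cases hx : x ∈ tsupport (ρ i)
        · rw [hpair _ _ x (hρ i hx), mul_zero]
        · rw [image_eq_zero_of_notMem_tsupport hx, zero_mul]
      simp [this]
    · intro i _
      have hε' : 0 < ε / 1 := by simpa using hε
      exact ((hF.smooth_rescale (hsmooth i) one_pos (hle i)).continuous_deriv_energyDensity g h
        ⟨by linarith, hε'⟩).integrable_of_hasCompactSupport (HasCompactSupport.of_compactSpace _)
  have hder := hF.hasDerivAt_energy g h hε U
  rwa [setIntegral_eq_integral_of_forall_compl_eq_zero hD0, hvanish, mul_zero] at hder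

/-- Near a point, a map can be varied with any prescribed velocity at that point. -/
theorem exists_isSmoothFamily_velocity {f : M → N} (hf : ContMDiff (𝓡 n) (𝓡 m) ∞ f) (x : M)
    (v : 𝔼 m) : ∃ ε > 0, ∃ F : ℝ → M → N, IsSmoothFamily n m ε F ∧ F 0 = f ∧
      velocityCoord x (f x) F (extChartAt (𝓡 n) x x) = v := by
  classical
  set O := chartDomain n m x (f x) f with hOdef
  have hO : IsOpen O := isOpen_chartDomain _ _ hf.continuous
  have hxO : x ∈ O := mem_chartDomain_self x f
  obtain ⟨χ, -, hχ⟩ := (SmoothBumpFunction.nhds_basis_tsupport (I := 𝓡 n) x).mem_iff.1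
    (hO.mem_nhds hxO)
  set ψ := extChartAt (𝓡 m) (f x) with hψ
  -- The image point is moved in the target chart along the fixed vector `v`, cut off by the bump
  -- function `χ`.
  set c : ℝ × M → 𝔼 m := fun w => ψ (f w.2) + (w.1 * χ w.2) • v with hc
  have hcs : ∀ t : ℝ, ∀ z ∈ O, ContMDiffAt (𝓘(ℝ, ℝ).prod (𝓡 n)) 𝓘(ℝ, 𝔼 m) ∞ c (t, z) := by
    intro t z hz
    have h1 : ContMDiffAt (𝓘(ℝ, ℝ).prod (𝓡 n)) 𝓘(ℝ, 𝔼 m) ∞ (fun w : ℝ × M => ψ (f w.2)) (t, z) :=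
      ContMDiffAt.comp (g := fun z => ψ (f z)) (f := Prod.snd) (t, z)
        ((contMDiffAt_chart (f x) hz.2).comp z (hf z)) contMDiffAt_snd
    have h2 : ContMDiffAt (𝓘(ℝ, ℝ).prod (𝓡 n)) 𝓘(ℝ, ℝ) ∞ (fun w : ℝ × M => w.1 * χ w.2) (t, z) :=
      contMDiffAt_fst.mul (ContMDiffAt.comp (g := χ) (f := Prod.snd) (t, z)
        (χ.contMDiff z) contMDiffAt_snd)
    exact h1.add (h2.smul contMDiffAt_const)
  have hc0 : ∀ z, c (0, z) = ψ (f z) := fun z => by simp [hc]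
  -- Compactness of the support of `χ` gives one time interval on which all moved points stay in the
  -- target of the chart.
  have hev : ∀ᶠ t in 𝓝 (0 : ℝ), ∀ z ∈ tsupport χ, c (t, z) ∈ ψ.target := by
    refine (isClosed_tsupport χ).isCompact.eventually_forall_of_forall_eventually fun z hz => ?_
    refine (hcs 0 z (hχ hz)).continuousAt.eventually
      ((isOpen_extChartAt_target (I := 𝓡 m) (f x)).eventually_mem ?_)
    rw [hc0]
    exact ψ.map_source (hχ hz).2
  obtain ⟨ε, hε, hball⟩ := Metric.eventually_nhds_iff.1 hev
  have htar : ∀ t ∈ Ioo (-ε) ε, ∀ z ∈ tsupport χ, c (t, z) ∈ ψ.target := fun t ht z hz =>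
    hball (by rw [Real.dist_eq, sub_zero]; exact abs_lt.2 ht) z hz
  set F : ℝ → M → N := fun t z => if z ∈ O then ψ.symm (c (t, z)) else f z with hF
  have hFO : ∀ t, ∀ z ∈ O, F t z = ψ.symm (c (t, z)) := fun t z hz => if_pos hz
  have hFf : ∀ t z, χ z = 0 → F t z = f z := by
    intro t z hz
    by_cases hzO : z ∈ O
    · have : c (t, z) = ψ (f z) := by simp [hc, hz]
      rw [hFO t z hzO, this, ψ.left_inv hzO.2]
    · exact if_neg hzO
  refine ⟨ε, hε, F, ?_, ?_, ?_⟩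
  · intro t ht z
    by_cases hz : z ∈ tsupport χ
    · have h1 : ContMDiffAt (𝓘(ℝ, ℝ).prod (𝓡 n)) (𝓡 m) ∞ (fun w => ψ.symm (c w)) (t, z) :=
        ContMDiffAt.comp (g := ψ.symm) (f := c) (t, z)
          (contMDiffAt_chart_symm (f x) (htar t ht z hz)) (hcs t z (hχ hz))
      refine h1.congr_of_eventuallyEq ?_
      have : ∀ᶠ w : ℝ × M in 𝓝 (t, z), w.2 ∈ O :=
        continuousAt_snd.eventually (hO.eventually_mem (hχ hz))
      filter_upwards [this] with w hw
      exact hFO w.1 w.2 hw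
    · have h1 : ContMDiffAt (𝓘(ℝ, ℝ).prod (𝓡 n)) (𝓡 m) ∞ (fun w : ℝ × M => f w.2) (t, z) :=
        ContMDiffAt.comp (g := f) (f := Prod.snd) (t, z) (hf z) contMDiffAt_snd
      refine h1.congr_of_eventuallyEq ?_
      have : ∀ᶠ w : ℝ × M in 𝓝 (t, z), χ w.2 = 0 :=
        continuousAt_snd.eventually (notMem_tsupport_iff_eventuallyEq.1 hz)
      filter_upwards [this] with w hw
      exact hFf w.1 w.2 hw
  · ext z
    by_cases hzO : z ∈ O
    · rw [hFO 0 z hzO, hc0, ψ.left_inv hzO.2]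
    · exact if_neg hzO
  · have hxs : x ∈ tsupport χ := subset_tsupport _ (by simp)
    have hloc : (fun s => (localRep x (f x) (F s) (extChartAt (𝓡 n) x x) : 𝔼 m)) =ᶠ[𝓝 0]
        fun s => ψ (f x) + s • v := by
      filter_upwards [isOpen_Ioo.eventually_mem (show (0 : ℝ) ∈ Ioo (-ε) ε from
        ⟨by linarith, hε⟩)] with s hs
      rw [localRep, extChartAt_to_inv, hFO s x hxO, ψ.right_inv (htar s hs x hxs)]
      simp [hc]
    rw [velocityCoord, velocity, hloc.deriv_eq]
    have : HasDerivAt (fun s : ℝ => ψ (f x) + s • v) ((1 : ℝ) • v) 0 :=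
      ((hasDerivAt_id (0 : ℝ)).smul_const v).const_add _
    rw [this.deriv, one_smul]

/-- A family with velocity equal to the basis vector `e_d` at `x` makes the pairing there the `d`-th
lowered component of `τ`. Harmonicity, applied to all cutoffs of this family, forces the pairing to
vanish. -/
theorem IsHarmonic.tensionLower_eq_zero {g : Metric n M} {h : Metric m N} {f : M → N}
    (hfh : IsHarmonic g h f) (x : M) (d : Fin m) :
    tensionLower g h x (f x) (localRep x (f x) f) (extChartAt (𝓡 n) x x) d = 0 := by
  obtain ⟨hf, hcrit⟩ := hfh
  obtain ⟨ε, hε, F, hF, hF0, hv⟩ :=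
    exists_isSmoothFamily_velocity hf x (EuclideanSpace.single d (1 : ℝ))
  have hzero : pairing g h x (F 0 x) F x = 0 := by
    refine eq_zero_of_integral_mul_eq_zero g
      (isOpen_chartDomain x (F 0 x) (by rw [hF0]; exact hf.continuous))
      (hF.continuousOn_pairing g h hε x (F 0 x)) (fun ρ hρ hs => ?_) (mem_chartDomain_self x (F 0))
    obtain ⟨C, hC0, hC⟩ : ∃ C, 0 < C ∧ ∀ x, |ρ x| ≤ C := by
      obtain ⟨C, hC⟩ := (isCompact_univ (X := M)).exists_bound_of_continuousOn
        hρ.continuous.continuousOn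
      exact ⟨max C 1, lt_max_of_lt_right one_pos,
        fun x => (hC x (mem_univ x)).trans (le_max_left _ _)⟩
    have hG := hF.smooth_rescale hρ hC0 hC
    have hε' : 0 < ε / C := div_pos hε hC0
    -- Since `M` is compact, `univ` serves both as the relatively compact open set and as the
    -- compact support.
    have hvar : IsVariation n m f univ (ε / C) (rescale ρ F) :=
      ⟨isSmoothFamily_iff.1 hG, (rescale_zero ρ F).trans hF0,
        univ, isCompact_univ, subset_univ _, fun t _ x hx => absurd (mem_univ x) hx⟩
    have h1 := hcrit univ isOpen_univ isClosed_closure.isCompact (ε / C) hε' _ hvar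
    have h2 := (hG.hasDerivAt_energy g h hε' univ).unique h1
    rw [setIntegral_univ, hF.integral_deriv_energyDensity_rescale g h hε hρ hs] at h2
    linarith
  rw [hF0, pairing, hF0, hv] at hzero
  simpa [Pi.single_apply] using hzero

theorem IsHarmonic.inner_tension_eq_zero {g : Metric n M} {h : Metric m N} {f : M → N}
    (hfh : IsHarmonic g h f) (x : M) (Y : TangentSpace (𝓡 n) x) :
    h.inner (f x) (tension g h f x) (mfderiv (𝓡 n) (𝓡 m) f x Y) = 0 := by
  refine (congrArg (fun v => h.inner (f x) (tension g h f x) v)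
    (mfderiv_apply_eq_sum x (hfh.1 x) Y)).trans ?_
  refine (inner_tension g h f x _).trans ?_
  exact Finset.sum_eq_zero fun d _ => by rw [hfh.tensionLower_eq_zero, zero_mul]

end Harmonic

end HarmonicMap

end

/-! ### The theorem -/

theorem theorem1 {n m : ℕ}
    {M : Type*} [TopologicalSpace M] [ChartedSpace (EuclideanSpace ℝ (Fin n)) M]
    [IsManifold (𝓡 n) ∞ M] [T2Space M] [CompactSpace M] [MeasurableSpace M] [BorelSpace M]
    {N : Type*} [TopologicalSpace N] [ChartedSpace (EuclideanSpace ℝ (Fin m)) N]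
    [IsManifold (𝓡 m) ∞ N] [T2Space N]
    (g : HarmonicMap.Metric n M) (h : HarmonicMap.Metric m N)
    (f : M → N) (hf : ContMDiff (𝓡 n) (𝓡 m) ∞ f) :
    (∀ (x : M) (Y : TangentSpace (𝓡 n) x),
      HarmonicMap.divergence g (HarmonicMap.pullbackMetric h f) x Y
          + (1 / 2) * mvfderiv (𝓡 n) (HarmonicMap.energyDensity g h f) x Y
        = -(h.inner (f x) (HarmonicMap.tension g h f x) (mfderiv (𝓡 n) (𝓡 m) f x Y))) ∧
    (HarmonicMap.IsHarmonic g h f → HarmonicMap.DivergenceIdentity g h f) ∧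
    (HarmonicMap.DivergenceIdentity g h f →
      ((n = m ∧ ∃ Φ : M ≃ₘ^∞⟮𝓡 n, 𝓡 m⟯ N, ⇑Φ = f) ∨
        (m ≤ n ∧ ∀ x : M, Function.Surjective (mfderiv (𝓡 n) (𝓡 m) f x))) →
      HarmonicMap.IsHarmonic g h f) := by
  have part1 := fun x Y => HarmonicMap.divergence_add_half_mvfderiv g h hf x Y
  refine ⟨part1, fun hh x Y => ?_, fun hdiv hcase => ?_⟩
  · have h1 := part1 x Y
    rw [hh.inner_tension_eq_zero x Y] at h1
    linarith
  · have hsurj : ∀ x : M, Function.Surjective (mfderiv (𝓡 n) (𝓡 m) f x) := by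
      rcases hcase with ⟨-, Φ, rfl⟩ | ⟨-, hs⟩
      · intro x
        exact (Φ.mfderivToContinuousLinearEquiv (by simp) x).surjective
      · exact hs
    refine HarmonicMap.isHarmonic_of_tension_eq_zero g h hf fun x => ?_
    -- Choosing `Y` with `f_* Y = τ` turns the identity into `h(τ, τ) = 0`, which contradicts
    -- positivity of `h`.
    by_contra hne
    obtain ⟨Y, hY⟩ := hsurj x (HarmonicMap.tension g h f x)
    have h1 := part1 x Y
    rw [hdiv x Y, hY] at h1
    have h2 := h.pos (f x) _ hne
    linarith
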